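/- Let $M$ be a smooth (Hausdorff, second countable) 7-manifold with a $G_2$-form $\varphi$, i.e. a smooth 3-form which at each point is identified by a linear isomorphism $T_mM\cong\mathbb{R}^7$ with the standard form $\varphi_0=e^{123}+e^{145}+e^{167}+e^{246}-e^{257}-e^{347}-e^{356}$. It induces a metric $g$, a Hodge dual $\ast\varphi$ (with $\ast\varphi_0=e^{4567}+e^{2367}+e^{2345}+e^{1357}-e^{1346}-e^{1256}-e^{1247}$) and a cross product $g(u\times v,z)=\varphi(u,v,z)$. Assume that $d\varphi=0$, $d{\ast\varphi}=0$ and $b_1(M)=0$ (every closed 1-form is exact). Let $T^2$ act smoothly on $M$ preserving $\varphi$, and let $X_1,X_2$ be the vector fields generated by a basis of its Lie algebra. Write $(i_X\alpha)(v_1,\dots)=\alpha(X,v_1,\dots)$. Then $i_{X_1}i_{X_2}\varphi=df$ for some smooth function $f$, and each such $f$ is $T^2$-invariant. Let $N=f^{-1}(c)$ be a level set on which $T^2$ acts freely. Then: 1. $N$ is an embedded 6-dimensional submanifold of $M$, and $M_{red}=N/T^2$, with the quotient topology, is Hausdorff and second countable and carries a smooth 4-manifold structure for which $\pi:N\to M_{red}$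 is a submersion. 2. There are unique 2-forms $\omega',\eta_1',\eta_2'$ on $M_{red}$ such that $\pi^*\omega'=(i_{X_1}i_{X_2}{\ast\varphi})|_N$ and $\pi^*\eta_i'=(i_{X_i}\varphi)|_N$. They are smooth and closed, and $\omega'$ is a symplectic form. 3. At $m\in N$ let $(e_1,e_2)$ be an orthonormal basis of $\mathrm{span}(X_1,X_2)$ with the orientation given by $(X_1,X_2)$, let $e_3=e_1\times e_2$, and let $W_m$ be the orthogonal complement of $\mathrm{span}(e_1,e_2,e_3)$ in $T_mM$. Then $W_m\subset T_mN$, the map $w\mapsto w\times e_3$ sends $W_m$ into $T_mN$, and there is a smooth almost complex structure $J$ on $M_{red}$ with $J(d\pi(w))=d\pi(w\times e_3)$ for all $m\in N$ and $w\in W_m$. It is compatible with $\omega'$: $\omega'(J\cdot,J\cdot)=\omega'$ and $\omega'(u,Ju)>0$ for $u\neq 0$. The canonical bundle $\Lambda^{2,0}$ of $(M_{red},J)$ is trivial, i.e. it has a smooth nowhere vanishing section. 4. Let $S$ be an embedded 2-dimensional submanifold of $M_{red}$. Then $\pi^{-1}(S)$ is a coassociative submanifold of $M$ (an embedded 4-dimensional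 submanifold calibrated by $\ast\varphi$) if and only if $S$ is pseudoholomorphic (the tangent spaces of $S$ are $J$-invariant), and this holds if and only if $\eta_1'|_S=\eta_2'|_S=0$. -/

import Mathlib

open Set Manifold
open scoped ContDiff Manifold Topology

noncomputable section

namespace G2Reduction

/-- Euclidean `n`-space, the model space of all manifolds below. -/
abbrev Euc (n : ℕ) : Type := EuclideanSpace ℝ (Fin n)

/-! ### Differential forms on manifolds -/

section Forms

variable {n : ℕ} {M : Type*} [TopologicalSpace M] [ChartedSpace (Euc n) M]
  {F : Type*} [NormedAddCommGroup F] [NormedSpace ℝ F]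

/-- A (not necessarily smooth) differential `k`-form on the `n`-manifold `M`
with values in `F` (`F = ℝ` or `F = ℂ` below). -/
abbrev DForm (n : ℕ) (M : Type*) [TopologicalSpace M] [ChartedSpace (Euc n) M] (k : ℕ)
    (F : Type*) [NormedAddCommGroup F] [NormedSpace ℝ F] : Type _ :=
  ∀ m : M, TangentSpace (𝓡 n) m [⋀^Fin k]→L[ℝ] F

/-- The expression of a form in the preferred chart at `x`, a form on an open subset of `ℝⁿ`. -/
def chartRep {k : ℕ} (α : DForm n M k F) (x : M) : Euc n → Euc n [⋀^Fin k]→L[ℝ] F := fun y =>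
  (α ((extChartAt (𝓡 n) x).symm y)).compContinuousLinearMap
    (mfderiv 𝓘(ℝ, Euc n) (𝓡 n) (extChartAt (𝓡 n) x).symm y)

/-- A form is smooth if it is smooth in the charts. -/
def IsSmoothForm {k : ℕ} (α : DForm n M k F) : Prop :=
  ∀ x : M, ContDiffOn ℝ ∞ (chartRep α x) (extChartAt (𝓡 n) x).target

/-- A closed form: a smooth form whose exterior derivative vanishes (computed in the charts). -/
def IsClosedForm {k : ℕ} (α : DForm n M k F) : Prop :=
  IsSmoothForm α ∧
    ∀ x : M, ∀ y ∈ (extChartAt (𝓡 n) x).target, extDeriv (chartRep α x) y = 0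

/-- The interior product `(i_X α)(v₁, …, v_k) = α(X, v₁, …, v_k)`. -/
def interiorProduct {k : ℕ} (X : ∀ m : M, TangentSpace (𝓡 n) m) (α : DForm n M (k + 1) F) :
    DForm n M k F := fun m =>
  ContinuousAlternatingMap.curryLeft (E := Euc n) (α m) (X m)

/-- The pullback `h^* α` of a form on an `n`-manifold `M` by a map `h : M' → M` from an
`n'`-manifold `M'`. -/
def formPullback (n' n : ℕ) {M' M : Type*} [TopologicalSpace M'] [ChartedSpace (Euc n') M']
    [TopologicalSpace M] [ChartedSpace (Euc n) M] {k : ℕ}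
    (h : M' → M) (α : DForm n M k F) : DForm n' M' k F := fun m =>
  (α (h m)).compContinuousLinearMap (mfderiv (𝓡 n') (𝓡 n) h m)

/-- `df = σ` for a real function `f` and a `1`-form `σ`. -/
def IsDifferentialOf (σ : DForm n M 1 ℝ) (f : M → ℝ) : Prop :=
  ∀ (m : M) (v : TangentSpace (𝓡 n) m), mfderiv (𝓡 n) 𝓘(ℝ, ℝ) f m v = σ m ![v]

/-- `b₁(M) = 0`, i.e. `H¹(M, ℝ) = 0` in de Rham cohomology:
each closed `1`-form is the differential of a smooth function. -/
def FirstBettiZero (n : ℕ) (M : Type*) [TopologicalSpace M] [ChartedSpace (Euc n) M] : Prop :=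
  ∀ σ : DForm n M 1 ℝ, IsClosedForm σ →
    ∃ f : M → ℝ, ContMDiff (𝓡 n) 𝓘(ℝ, ℝ) ∞ f ∧ IsDifferentialOf σ f

end Forms

/-! ### `G₂`-structures -/

/-- The constant form `e^{i₀} ∧ … ∧ e^{i_{k-1}}` on `ℝⁿ`:
its value on `v₀, …, v_{k-1}` is the determinant of the matrix with entries `(v_a)_{i_b}`. -/
def coordForm {n k : ℕ} (i : Fin k → Fin n) : Euc n [⋀^Fin k]→L[ℝ] ℝ :=
  { (Matrix.detRowAlternating (n := Fin k) (R := ℝ)).compLinearMap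
      ((LinearMap.funLeft ℝ ℝ i) ∘ₗ (WithLp.linearEquiv 2 ℝ (Fin n → ℝ)).toLinearMap) with
    cont := by
      change Continuous fun v : Fin k → Euc n => Matrix.det (Matrix.of fun a b => v a (i b))
      fun_prop }

/-- The standard `G₂`-form `e¹²³ + e¹⁴⁵ + e¹⁶⁷ + e²⁴⁶ - e²⁵⁷ - e³⁴⁷ - e³⁵⁶` on `ℝ⁷`
(the indices are shifted by one). -/
def phi0 : Euc 7 [⋀^Fin 3]→L[ℝ] ℝ :=
  coordForm ![0, 1, 2] + coordForm ![0, 3, 4] + coordForm ![0, 5, 6] + coordForm ![1, 3, 5]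
    - coordForm ![1, 4, 6] - coordForm ![2, 3, 6] - coordForm ![2, 4, 5]

/-- The Hodge dual `∗φ₀ = e⁴⁵⁶⁷ + e²³⁶⁷ + e²³⁴⁵ + e¹³⁵⁷ - e¹³⁴⁶ - e¹²⁵⁶ - e¹²⁴⁷` of `φ₀` for the
standard metric and orientation of `ℝ⁷`. -/
def starPhi0 : Euc 7 [⋀^Fin 4]→L[ℝ] ℝ :=
  coordForm ![3, 4, 5, 6] + coordForm ![1, 2, 5, 6] + coordForm ![1, 2, 3, 4]
    + coordForm ![0, 2, 4, 6] - coordForm ![0, 2, 3, 5] - coordForm ![0, 1, 4, 5]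
    - coordForm ![0, 1, 3, 6]

/-- The cross product of `ℝ⁷` (the imaginary part of the Cayley product of imaginary Cayley
numbers): `⟨u × v, z⟩ = φ₀(u, v, z)`. -/
def cross0 (u v : Euc 7) : Euc 7 :=
  WithLp.toLp 2 fun k => phi0 ![u, v, EuclideanSpace.single k 1]

section G2

variable {M : Type*} [TopologicalSpace M] [ChartedSpace (Euc 7) M]

/-- `σ : T_mM ≅ ℝ⁷` identifies `φ` at `m` with the standard form: `σ^* φ₀ = φ`. -/
def IsG2Frame (φ : DForm 7 M 3 ℝ) (m : M) (σ : TangentSpace (𝓡 7) m ≃L[ℝ] Euc 7) : Prop :=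
  phi0.compContinuousLinearMap (σ : TangentSpace (𝓡 7) m →L[ℝ] Euc 7) = φ m

open Classical in
/-- A frame at `m` adapted to `φ`. Two such frames differ by an element of `G₂ ⊂ SO(7)`, so that
the metric, the Hodge dual `∗φ` and the cross product obtained from it below do not depend
on the choice. -/
def g2Frame (φ : DForm 7 M 3 ℝ) (m : M) : TangentSpace (𝓡 7) m ≃L[ℝ] Euc 7 :=
  if h : ∃ σ, IsG2Frame φ m σ then h.choose else ContinuousLinearEquiv.refl ℝ (Euc 7)

/-- The Riemannian metric of a `G₂`-form. -/
def g2Metric (φ : DForm 7 M 3 ℝ) (m : M) (u v : TangentSpace (𝓡 7) m) : ℝ :=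
  inner ℝ (g2Frame φ m u) (g2Frame φ m v)

/-- The Hodge dual `∗φ` of a `G₂`-form. -/
def g2Star (φ : DForm 7 M 3 ℝ) : DForm 7 M 4 ℝ := fun m =>
  starPhi0.compContinuousLinearMap (g2Frame φ m : TangentSpace (𝓡 7) m →L[ℝ] Euc 7)

/-- The Cayley (cross) product on the tangent spaces given by a `G₂`-form. -/
def g2Cross (φ : DForm 7 M 3 ℝ) (m : M) (u v : TangentSpace (𝓡 7) m) : TangentSpace (𝓡 7) m :=
  (g2Frame φ m).symm (cross0 (g2Frame φ m u) (g2Frame φ m v))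

/-- `φ` is a closed and co-closed `G₂`-form on `M`. -/
structure IsParallelG2Form (φ : DForm 7 M 3 ℝ) : Prop where
  exists_frame : ∀ m, ∃ σ, IsG2Frame φ m σ
  closed : IsClosedForm φ
  coclosed : IsClosedForm (g2Star φ)

/-- A coassociative submanifold of `(M, φ)`: an embedded `4`-dimensional submanifold `L`
calibrated by `∗φ`, that is `∗φ` takes the values `±1` on the orthonormal bases of its tangent
spaces (so that `∗φ` restricts to the volume form of `L` for a unique orientation of `L`). -/
def IsCoassociative (φ : DForm 7 M 3 ℝ) (L : Set M) : Prop :=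
  ∃ (_ : ChartedSpace (Euc 4) L) (_ : IsManifold (𝓡 4) ∞ L),
    IsSmoothEmbedding (𝓡 4) (𝓡 7) ∞ (Subtype.val : L → M) ∧
    ∀ (p : L) (u : Fin 4 → TangentSpace (𝓡 4) p),
      (∀ i j, g2Metric φ p.1 (mfderiv (𝓡 4) (𝓡 7) (Subtype.val : L → M) p (u i))
        (mfderiv (𝓡 4) (𝓡 7) (Subtype.val : L → M) p (u j)) = if i = j then 1 else 0) →
      |formPullback 4 7 (Subtype.val : L → M) (g2Star φ) p u| = 1

end G2

/-! ### Torus actions -/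

/-- The `2`-torus. -/
abbrev Torus : Type := Circle × Circle

/-- The model with corners of the `2`-torus. -/
abbrev torusModel := (𝓡 1).prod (𝓡 1)

section Torus

variable {M : Type*} [TopologicalSpace M] [ChartedSpace (Euc 7) M] [MulAction Torus M]

/-- The vector field on `M` generated by the element `v = (a, b)` of the Lie algebra `ℝ²` of `T²`:
its value at `m` is the derivative of `(e^{ias}, e^{ibs}) • m` at `s = 0`. -/
def flowField (v : ℝ × ℝ) (m : M) : TangentSpace (𝓡 7) m :=
  mfderiv 𝓘(ℝ, ℝ) (𝓡 7)
    (fun s : ℝ => ((Circle.exp (v.1 * s), Circle.exp (v.2 * s)) : Torus) • m) (0 : ℝ) (1 : ℝ)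

/-- The action of `T²` preserves the form `φ`. -/
def PreservesForm {k : ℕ} (φ : DForm 7 M k ℝ) : Prop :=
  ∀ t : Torus, formPullback 7 7 (fun m : M => t • m) φ = φ

/-- The orbit space `N / T²` of an invariant subset `N` of `M`, with the quotient topology. -/
abbrev OrbitSpace (N : Set M) : Type _ :=
  Quotient ((MulAction.orbitRel Torus M).comap (Subtype.val : N → M))

/-- The projection `π : N → N / T²`. -/
abbrev proj (N : Set M) : N → OrbitSpace N := Quotient.mk _

/-- `(e₁, e₂)` is an orthonormal basis of `span(X₁, X₂)` at `m`, with the orientation given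
by `X₁, X₂`. -/
def IsOrientedOrthonormalBasis (φ : DForm 7 M 3 ℝ) (m : M)
    (X₁ X₂ e₁ e₂ : TangentSpace (𝓡 7) m) : Prop :=
  (∃ a b c d : ℝ, 0 < a * d - b * c ∧ e₁ = a • X₁ + b • X₂ ∧ e₂ = c • X₁ + d • X₂) ∧
    g2Metric φ m e₁ e₁ = 1 ∧ g2Metric φ m e₂ e₂ = 1 ∧ g2Metric φ m e₁ e₂ = 0

end Torus

/-! ### Symplectic forms and almost complex structures -/

section Symplectic

variable {n : ℕ} {Q : Type*} [TopologicalSpace Q] [ChartedSpace (Euc n) Q]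

/-- A symplectic form: closed and nondegenerate. -/
def IsSymplectic (σ : DForm n Q 2 ℝ) : Prop :=
  IsClosedForm σ ∧ ∀ (q : Q) (u : TangentSpace (𝓡 n) q), u ≠ 0 → ∃ v, σ q ![u, v] ≠ 0

/-- A smooth almost complex structure `J`. -/
def IsAlmostComplex [IsManifold (𝓡 n) ∞ Q]
    (J : ∀ q : Q, TangentSpace (𝓡 n) q →L[ℝ] TangentSpace (𝓡 n) q) : Prop :=
  ContMDiff (𝓡 n) ((𝓡 n).prod 𝓘(ℝ, Euc n →L[ℝ] Euc n)) ∞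
    (fun q => Bundle.TotalSpace.mk' (Euc n →L[ℝ] Euc n)
      (E := fun q : Q => TangentSpace (𝓡 n) q →L[ℝ] TangentSpace (𝓡 n) q) q (J q)) ∧
  ∀ q u, J q (J q u) = -u

/-- `J` is compatible with `σ`: `σ(u, Jv)` is a positive definite symmetric bilinear form. -/
def IsCompatible (σ : DForm n Q 2 ℝ)
    (J : ∀ q : Q, TangentSpace (𝓡 n) q →L[ℝ] TangentSpace (𝓡 n) q) : Prop :=
  ∀ q u, (∀ v, σ q ![J q u, J q v] = σ q ![u, v]) ∧ (u ≠ 0 → 0 < σ q ![u, J q u])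

/-- The canonical bundle `Λ^{2,0}` of the almost complex `4`-manifold `(Q, J)` is trivial: it has
a smooth nowhere vanishing section, i.e. there is a nowhere vanishing smooth complex `2`-form `Ω`
which is complex linear with respect to `J` in its arguments. -/
def HasTrivialCanonicalBundle {Q : Type*} [TopologicalSpace Q] [ChartedSpace (Euc 4) Q]
    (J : ∀ q : Q, TangentSpace (𝓡 4) q →L[ℝ] TangentSpace (𝓡 4) q) : Prop :=
  ∃ Ω : DForm 4 Q 2 ℂ, IsSmoothForm Ω ∧ (∀ q, Ω q ≠ 0) ∧
    ∀ q u v, Ω q ![J q u, v] = Complex.I * Ω q ![u, v]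

/-- The submanifold `S ⊆ Q` (of dimension `k`) is pseudoholomorphic: its tangent spaces
are invariant under `J`. -/
def IsPseudoholomorphic (J : ∀ q : Q, TangentSpace (𝓡 n) q →L[ℝ] TangentSpace (𝓡 n) q)
    (k : ℕ) (S : Set Q) [ChartedSpace (Euc k) S] : Prop :=
  ∀ (s : S) (v : TangentSpace (𝓡 k) s), ∃ w : TangentSpace (𝓡 k) s,
    mfderiv (𝓡 k) (𝓡 n) (Subtype.val : S → Q) s w =
      J s.1 (mfderiv (𝓡 k) (𝓡 n) (Subtype.val : S → Q) s v)

end Symplectic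

end G2Reduction

end

open G2Reduction

open Set Manifold
open scoped ContDiff Manifold Topology

noncomputable section

namespace G2Reduction

/-! ### Linear algebra of the standard `G₂`-form -/

/-! Linear algebra. A linear automorphism A of ℝ⁷ with A^*φ₀ = φ₀ is an isometry
(`inner_map_of_phi0_comp`) and preserves ∗φ₀, since ∗φ₀ is a polynomial in the metric and the cross
product (`starPhi0_eq`). Hence ∗φ does not depend on the frames used to define it, and an action
preserving φ preserves ∗φ.

Existence of f. Contracting an invariant closed form with a generating field gives a closed form
(`extDeriv_contraction_eq_zero`), and the result is again invariant because the torus is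
commutative. So i_{X₁} i_{X₂} φ is closed, hence exact. Its primitive f is constant on orbits
because φ(X₂, X₁, X) = 0 for every generating field X. At a point with trivial stabilizer X₁, X₂ are
independent and df is a negative multiple of ⟨e₃, ·⟩. So c is a regular value along N, T_mN is the
orthogonal complement of e₃, and it contains X₁, X₂ and W_m.

The quotient. Slices for the free action, together with compactness of the torus, give charts of
N/T² that come with smooth local sections of π (`exists_quotient_manifold`). An invariant form whose
restriction to N is killed by the orbit directions descends to N/T², and through local sections its
descent inherits closedness (`isClosedForm_descent`).

The complex structure. On W_m let J w = w × e₃ and α = φ(e₁, ·, ·). The Cayley identities give J² =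
-1 and φ(e₂, ·, ·) = -α(J·, ·), while ∗φ(e₁, e₂, ·, ·) = -⟨J·, ·⟩. Expanding X₁, X₂ in e₁, e₂, one
finds that ω' is a positive multiple of ⟨J·, ·⟩ and that η₂' = a η₁' - b η₁'(J·, ·) with b > 0
(`exists_isTransverseTriple`). The endomorphism K with η₁'(K·, ·) = η₂' is therefore a - b J. As J
is trace free with J² = -1, the forms determine a, b and J by a formula smooth in them
(`quotient_eq`). This shows at once that J is independent of e₁, e₂ and of the point of the orbit,
and that it is smooth. The form η₁' - i η₁'(J·, ·) trivializes Λ^{2,0}.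

Surfaces. A plane Y in the tangent space of the quotient is J-invariant iff η₁' and η₂' vanish on it
(`invariant_iff`). The tangent space of π⁻¹(S) is span(e₁, e₂) plus the lift of Y. On an orthonormal
basis e₁, e₂, w, w' of it ∗φ is -⟨J w, w'⟩, which is ±1 exactly when w' = ±J w. -/

lemma coordForm_apply {n k : ℕ} (i : Fin k → Fin n) (v : Fin k → Euc n) :
    coordForm i v = Matrix.det (Matrix.of fun a b => v a (i b)) := rfl

lemma coordForm_three (i : Fin 3 → Fin 7) (u v w : Euc 7) :
    coordForm i ![u, v, w] = u (i 0) * v (i 1) * w (i 2) - u (i 0) * v (i 2) * w (i 1)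
      - u (i 1) * v (i 0) * w (i 2) + u (i 1) * v (i 2) * w (i 0)
      + u (i 2) * v (i 0) * w (i 1) - u (i 2) * v (i 1) * w (i 0) := by
  rw [coordForm_apply, Matrix.det_fin_three]
  rfl

lemma coordForm_four (i : Fin 4 → Fin 7) (u v w z : Euc 7) :
    coordForm i ![u, v, w, z] =
      u (i 0) * coordForm ![i 1, i 2, i 3] ![v, w, z]
      - u (i 1) * coordForm ![i 0, i 2, i 3] ![v, w, z]
      + u (i 2) * coordForm ![i 0, i 1, i 3] ![v, w, z]
      - u (i 3) * coordForm ![i 0, i 1, i 2] ![v, w, z] := by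
  rw [coordForm_apply, Matrix.det_succ_row_zero]
  simp only [coordForm_apply, Fin.sum_univ_four, Matrix.det_fin_three, Matrix.submatrix_apply,
    Matrix.of_apply]
  simp [Fin.succAbove, Fin.lt_def]
  ring

lemma phi0_apply (u v w : Euc 7) : phi0 ![u, v, w] =
    coordForm ![0, 1, 2] ![u, v, w] + coordForm ![0, 3, 4] ![u, v, w]
    + coordForm ![0, 5, 6] ![u, v, w] + coordForm ![1, 3, 5] ![u, v, w]
    - coordForm ![1, 4, 6] ![u, v, w] - coordForm ![2, 3, 6] ![u, v, w]
    - coordForm ![2, 4, 5] ![u, v, w] := by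
  simp only [phi0, ContinuousAlternatingMap.add_apply, ContinuousAlternatingMap.sub_apply]

lemma starPhi0_apply (u v w z : Euc 7) : starPhi0 ![u, v, w, z] =
    coordForm ![3, 4, 5, 6] ![u, v, w, z] + coordForm ![1, 2, 5, 6] ![u, v, w, z]
    + coordForm ![1, 2, 3, 4] ![u, v, w, z] + coordForm ![0, 2, 4, 6] ![u, v, w, z]
    - coordForm ![0, 2, 3, 5] ![u, v, w, z] - coordForm ![0, 1, 4, 5] ![u, v, w, z]
    - coordForm ![0, 1, 3, 6] ![u, v, w, z] := by
  simp only [starPhi0, ContinuousAlternatingMap.add_apply, ContinuousAlternatingMap.sub_apply]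

lemma cross0_coords (u v : Euc 7) :
    (cross0 u v 0 = u 1 * v 2 - u 2 * v 1 + (u 3 * v 4 - u 4 * v 3) + (u 5 * v 6 - u 6 * v 5)) ∧
    (cross0 u v 1 = u 2 * v 0 - u 0 * v 2 + (u 3 * v 5 - u 5 * v 3) - (u 4 * v 6 - u 6 * v 4)) ∧
    (cross0 u v 2 = u 0 * v 1 - u 1 * v 0 - (u 3 * v 6 - u 6 * v 3) - (u 4 * v 5 - u 5 * v 4)) ∧
    (cross0 u v 3 = u 4 * v 0 - u 0 * v 4 + (u 5 * v 1 - u 1 * v 5) - (u 6 * v 2 - u 2 * v 6)) ∧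
    (cross0 u v 4 = u 0 * v 3 - u 3 * v 0 - (u 6 * v 1 - u 1 * v 6) - (u 5 * v 2 - u 2 * v 5)) ∧
    (cross0 u v 5 = u 6 * v 0 - u 0 * v 6 + (u 1 * v 3 - u 3 * v 1) - (u 2 * v 4 - u 4 * v 2)) ∧
    (cross0 u v 6 = u 0 * v 5 - u 5 * v 0 - (u 1 * v 4 - u 4 * v 1)
      - (u 2 * v 3 - u 3 * v 2)) := by
  refine ⟨?_, ?_, ?_, ?_, ?_, ?_, ?_⟩ <;>
  · simp only [cross0, phi0_apply, coordForm_three]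
    simp <;> ring

lemma inner_euc7 (u v : Euc 7) : inner ℝ u v =
    u 0 * v 0 + u 1 * v 1 + u 2 * v 2 + u 3 * v 3 + u 4 * v 4 + u 5 * v 5 + u 6 * v 6 := by
  simp [PiLp.inner_apply, Fin.sum_univ_seven]
  ring

lemma inner_cross0 (u v w : Euc 7) : inner ℝ (cross0 u v) w = phi0 ![u, v, w] := by
  obtain ⟨h0, h1, h2, h3, h4, h5, h6⟩ := cross0_coords u v
  rw [inner_euc7, h0, h1, h2, h3, h4, h5, h6, phi0_apply]
  simp only [coordForm_three]
  simp
  ring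

lemma euc7_ext {u v : Euc 7} (h0 : u 0 = v 0) (h1 : u 1 = v 1) (h2 : u 2 = v 2)
    (h3 : u 3 = v 3) (h4 : u 4 = v 4) (h5 : u 5 = v 5) (h6 : u 6 = v 6) : u = v := by
  ext k
  fin_cases k <;> assumption

/-- This is the alternative law u(uv) = u²v of the Cayley numbers, checked in coordinates. The
relations among e₁, e₂, e₃ and the transverse space follow from it, from `starPhi0_eq` and from the
symmetries of φ₀. -/
lemma cross0_cross0_self (u v : Euc 7) :
    cross0 u (cross0 u v) = inner ℝ u v • u - inner ℝ u u • v := by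
  obtain ⟨h0, h1, h2, h3, h4, h5, h6⟩ := cross0_coords u v
  obtain ⟨g0, g1, g2, g3, g4, g5, g6⟩ := cross0_coords u (cross0 u v)
  apply euc7_ext <;> simp only [PiLp.sub_apply, PiLp.smul_apply, smul_eq_mul, inner_euc7]
  · rw [g0, h1, h2, h3, h4, h5, h6]; ring
  · rw [g1, h0, h2, h3, h4, h5, h6]; ring
  · rw [g2, h0, h1, h3, h4, h5, h6]; ring
  · rw [g3, h0, h1, h2, h4, h5, h6]; ring
  · rw [g4, h0, h1, h2, h3, h5, h6]; ring
  · rw [g5, h0, h1, h2, h3, h4, h6]; ring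
  · rw [g6, h0, h1, h2, h3, h4, h5]; ring

/-- Only the metric and the cross product occur on the right, so a linear map compatible with both
preserves ∗φ₀, without any reference to a Hodge star or an orientation. -/
lemma starPhi0_eq (u v w z : Euc 7) : starPhi0 ![u, v, w, z] =
    - inner ℝ (cross0 u (cross0 v w)) z - inner ℝ u v * inner ℝ w z
      + inner ℝ u w * inner ℝ v z := by
  obtain ⟨h0, h1, h2, h3, h4, h5, h6⟩ := cross0_coords v w
  obtain ⟨g0, g1, g2, g3, g4, g5, g6⟩ := cross0_coords u (cross0 v w)
  rw [starPhi0_apply]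
  simp only [coordForm_four, coordForm_three, inner_euc7, g0, g1, g2, g3, g4, g5, g6,
    h0, h1, h2, h3, h4, h5, h6]
  simp
  ring

lemma cross0_add_right (u v w : Euc 7) : cross0 u (v + w) = cross0 u v + cross0 u w := by
  ext k
  simp only [cross0, phi0_apply, coordForm_three, PiLp.add_apply]
  ring

lemma cross0_smul_right (c : ℝ) (u v : Euc 7) : cross0 u (c • v) = c • cross0 u v := by
  ext k
  simp only [cross0, phi0_apply, coordForm_three, PiLp.smul_apply, smul_eq_mul]
  ring

lemma cross0_swap (u v : Euc 7) : cross0 u v = - cross0 v u := by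
  ext k
  simp only [cross0, phi0_apply, coordForm_three, PiLp.neg_apply]
  ring

lemma cross0_add_left (u v w : Euc 7) : cross0 (u + v) w = cross0 u w + cross0 v w := by
  rw [cross0_swap, cross0_add_right, neg_add, ← cross0_swap, ← cross0_swap]

lemma cross0_smul_left (c : ℝ) (u v : Euc 7) : cross0 (c • u) v = c • cross0 u v := by
  rw [cross0_swap, cross0_smul_right, ← smul_neg, ← cross0_swap]

lemma cross0_self (u : Euc 7) : cross0 u u = 0 := by
  ext k
  simp only [cross0, phi0_apply, coordForm_three, PiLp.zero_apply]
  ring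

/-- The cross product as a linear endomorphism `v ↦ u × v`. -/
def crossL (u : Euc 7) : Euc 7 →ₗ[ℝ] Euc 7 where
  toFun := cross0 u
  map_add' := cross0_add_right u
  map_smul' c := cross0_smul_right c u

lemma crossL_apply (u v : Euc 7) : crossL u v = cross0 u v := rfl

lemma inner_cross0_swap (u v w : Euc 7) : inner ℝ (cross0 u v) w = - inner ℝ v (cross0 u w) := by
  rw [real_inner_comm (cross0 u w) v, inner_cross0, inner_cross0, phi0_apply, phi0_apply]
  simp only [coordForm_three]
  ring

lemma inner_cross0_cyclic (u v w : Euc 7) :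
    inner ℝ (cross0 u v) w = inner ℝ (cross0 v w) u := by
  rw [inner_cross0, inner_cross0, phi0_apply, phi0_apply]
  simp only [coordForm_three]
  ring

lemma inner_cross0_self_right (u v : Euc 7) : inner ℝ (cross0 u v) v = 0 := by
  have := inner_cross0_swap u v v
  rw [real_inner_comm] at this
  rw [real_inner_comm]
  linarith

lemma inner_cross0_self_left (u v : Euc 7) : inner ℝ (cross0 u v) u = 0 := by
  rw [cross0_swap, inner_neg_left, inner_cross0_self_right, neg_zero]

/-- The rank one endomorphism `v ↦ ⟨b, v⟩ b`. -/
def rankOneSelf (b : Euc 7) : Euc 7 →ₗ[ℝ] Euc 7 :=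
  (innerₛₗ ℝ b).smulRight b

lemma rankOneSelf_apply (b v : Euc 7) : rankOneSelf b v = inner ℝ b v • b := rfl

lemma det_adjoint_real {E : Type*} [NormedAddCommGroup E] [InnerProductSpace ℝ E]
    [FiniteDimensional ℝ E] (A : E →ₗ[ℝ] E) : LinearMap.det (LinearMap.adjoint A) =
      LinearMap.det A := by
  let b := stdOrthonormalBasis ℝ E
  rw [← LinearMap.det_toMatrix b.toBasis, LinearMap.toMatrix_adjoint b b A,
    Matrix.det_conjTranspose, LinearMap.det_toMatrix]
  simp

lemma adjoint_crossL_add (y z : Euc 7) :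
    LinearMap.adjoint (crossL y + rankOneSelf z) = - crossL y + rankOneSelf z := by
  symm
  rw [LinearMap.eq_adjoint_iff]
  intro v w
  simp only [LinearMap.add_apply, LinearMap.neg_apply, crossL_apply, rankOneSelf_apply,
    inner_add_left, inner_add_right, inner_neg_left, inner_smul_left, inner_smul_right,
    inner_cross0_swap y v w, real_inner_comm z v]
  simp
  ring

/-- The squared determinant of `v ↦ y × v + ⟨z, v⟩ z` for `z = s y` with `s² |y| = 1`. -/
lemma det_crossL_add_sq (y : Euc 7) (s r : ℝ) (hr : inner ℝ y y = r ^ 2)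
    (hs : s ^ 2 * r = 1) :
    LinearMap.det (crossL y + rankOneSelf (s • y)) ^ 2 = (r ^ 2) ^ 7 := by
  -- The adjoint changes the sign of the skew part. The mixed terms vanish because y × y = 0, and
  -- the condition s² r = 1 makes the square of the rank one part cancel the term ⟨y, ·⟩ y coming
  -- from -y × (y × ·).
  have h1 : LinearMap.adjoint (crossL y + rankOneSelf (s • y)) *
      (crossL y + rankOneSelf (s • y)) = (r ^ 2) • (1 : Euc 7 →ₗ[ℝ] Euc 7) := by
    rw [adjoint_crossL_add]
    ext1 v
    have h2 : s ^ 4 * r ^ 2 = 1 := by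
      calc s ^ 4 * r ^ 2 = (s ^ 2 * r) ^ 2 := by ring
        _ = 1 := by rw [hs, one_pow]
    simp only [Module.End.mul_apply, LinearMap.add_apply, LinearMap.neg_apply, crossL_apply,
      rankOneSelf_apply, cross0_add_right, cross0_cross0_self, cross0_smul_right, cross0_self,
      inner_add_right, inner_smul_left, inner_smul_right, hr, LinearMap.smul_apply,
      Module.End.one_apply, real_inner_comm (cross0 y v) y, inner_cross0_self_left]
    simp only [smul_zero, conj_trivial, mul_zero, zero_add, add_zero, smul_smul]
    have h3 : s * (s * inner ℝ y v * (s * r ^ 2)) * s = inner ℝ y v := by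
      calc _ = (s ^ 4 * r ^ 2) * inner ℝ y v := by ring
        _ = _ := by rw [h2, one_mul]
    match_scalars
    · linear_combination h3
    · ring
  have h4 := congrArg LinearMap.det h1
  rw [map_mul, det_adjoint_real, LinearMap.det_smul] at h4
  simpa [sq] using h4

/-- The transvection E v = v + ⟨b - u, v⟩ u leaves `crossL u` unchanged under congruence, because u
× u = 0, and its adjoint sends u to b. So Eᵀ(· + u uᵀ)E replaces u uᵀ by b bᵀ, at the cost of (det
E)² = ⟨b, u⟩². -/
lemma det_crossL_add_rankOneSelf (u b : Euc 7) (hu : inner ℝ u u = (1 : ℝ)) :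
    LinearMap.det (crossL u + rankOneSelf b) =
      inner ℝ b u ^ 2 * LinearMap.det (crossL u + rankOneSelf u) := by
  let E := LinearMap.transvection (innerₛₗ ℝ (b - u)) u
  have hE : ∀ v, E v = v + inner ℝ (b - u) v • u := fun v => rfl
  have hadj : ∀ v, LinearMap.adjoint E v = v + inner ℝ u v • (b - u) := by
    intro v
    refine ext_inner_right ℝ fun w => ?_
    rw [LinearMap.adjoint_inner_left, hE, inner_add_right, inner_add_left, inner_smul_right,
      inner_smul_left, real_inner_comm u v]
    simp [mul_comm]
  have h1 : crossL u + rankOneSelf b =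
      LinearMap.adjoint E * ((crossL u + rankOneSelf u) * E) := by
    ext1 v
    simp only [Module.End.mul_apply, LinearMap.add_apply, crossL_apply, rankOneSelf_apply, hE,
      hadj, cross0_add_right, cross0_smul_right, cross0_self, inner_add_right, inner_smul_right,
      hu, real_inner_comm (cross0 u v) u, inner_cross0_self_left, inner_sub_left]
    simp only [inner_zero_right]
    module
  have h2 : LinearMap.det E = inner ℝ b u := by
    have := LinearMap.transvection.det (innerₛₗ ℝ (b - u)) u
    rw [this, innerₛₗ_apply_apply, inner_sub_left, hu]
    ring
  rw [h1, map_mul, map_mul, det_adjoint_real, h2]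
  ring

/-- A linear automorphism of `ℝ⁷` preserving `φ₀` is an isometry. -/
lemma inner_map_of_phi0_comp (A : Euc 7 →ₗ[ℝ] Euc 7) (hA0 : LinearMap.det A ≠ 0)
    (hA : ∀ u v w, phi0 ![A u, A v, A w] = phi0 ![u, v, w]) (u v : Euc 7) :
    inner ℝ (A u) (A v) = inner ℝ u v := by
  -- Invariance of φ₀ is the congruence Aᵀ (Au × ·) A = (u × ·). Since u × · kills u, a rank one
  -- term is added before determinants are compared.
  have hcross : ∀ u, LinearMap.adjoint A * (crossL (A u) * A) = crossL u := by
    intro u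
    ext1 v
    refine ext_inner_right ℝ fun w => ?_
    rw [Module.End.mul_apply, LinearMap.adjoint_inner_left, Module.End.mul_apply, crossL_apply,
      crossL_apply, inner_cross0, inner_cross0, hA]
  have hrank : ∀ z, LinearMap.adjoint A * (rankOneSelf z * A) =
      rankOneSelf (LinearMap.adjoint A z) := by
    intro z
    ext1 v
    rw [Module.End.mul_apply, Module.End.mul_apply, rankOneSelf_apply, rankOneSelf_apply,
      map_smul, LinearMap.adjoint_inner_left]
  set D := LinearMap.det A
  -- the norm on the unit sphere
  have key : ∀ u : Euc 7, inner ℝ u u = (1 : ℝ) → D ^ 4 * inner ℝ (A u) (A u) ^ 4 = (1 : ℝ) := by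
    intro u hu
    set y := A u with hy
    have hy0 : 0 < ‖y‖ := by
      rw [norm_pos_iff]
      intro h
      have hinj : Function.Injective A :=
        (LinearMap.isUnit_iff_ker_eq_bot A).1 ((LinearMap.isUnit_iff_isUnit_det A).2
          (isUnit_iff_ne_zero.2 hA0)) |> LinearMap.ker_eq_bot.1
      have : u = 0 := hinj (by rw [map_zero, ← hy, h])
      simp [this] at hu
    set r := ‖y‖
    have hr : inner ℝ y y = r ^ 2 := real_inner_self_eq_norm_sq y
    -- With z = s y the congruence by A turns `crossL y + rankOneSelf z` into `crossL u +
    -- rankOneSelf (Aᵀ z)`, and ⟨Aᵀ z, u⟩ = s r². Comparing determinants and squaring, which removes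
    -- their unknown signs, gives D⁴ r¹⁴ = s⁴ r⁸ = r⁶.
    obtain ⟨s, hs⟩ : ∃ s : ℝ, s ^ 2 * r = 1 :=
      ⟨Real.sqrt r⁻¹, by rw [Real.sq_sqrt (inv_nonneg.2 hy0.le), inv_mul_cancel₀ hy0.ne']⟩
    have h1 := det_crossL_add_sq y s r hr hs
    have h2 := det_crossL_add_sq u 1 1 (by rw [hu]; norm_num) (by norm_num)
    have h3 := det_crossL_add_rankOneSelf u (LinearMap.adjoint A (s • y)) hu
    rw [← hcross u, ← hrank, ← hy, ← mul_add, ← add_mul, map_mul, map_mul, det_adjoint_real,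
      hcross u, LinearMap.adjoint_inner_left, ← hy, inner_smul_left, hr] at h3
    simp only [conj_trivial, one_smul] at h2 h3
    have h4 : (D ^ 2 * LinearMap.det (crossL y + rankOneSelf (s • y))) ^ 2 =
        ((s * r ^ 2) ^ 2 * LinearMap.det (crossL u + rankOneSelf u)) ^ 2 := by
      rw [← h3]; ring
    rw [mul_pow, mul_pow, h1, h2] at h4
    have h5 : r ^ 6 * (D ^ 4 * (r ^ 2) ^ 4) = r ^ 6 * 1 := by
      calc r ^ 6 * (D ^ 4 * (r ^ 2) ^ 4) = (D ^ 2) ^ 2 * (r ^ 2) ^ 7 := by ring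
        _ = (s ^ 2 * r) ^ 2 * r ^ 6 := by rw [h4]; ring
        _ = _ := by rw [hs]; ring
    rw [hr]
    exact mul_left_cancel₀ (pow_ne_zero 6 hy0.ne') h5
  -- the norm up to a constant
  have hD : 0 < |D| := abs_pos.2 hA0
  have key2 : ∀ u : Euc 7, inner ℝ (A u) (A u) = |D|⁻¹ * inner ℝ u u := by
    intro u
    by_cases hu : u = 0
    · simp [hu]
    have hn : ‖u‖ ≠ 0 := norm_ne_zero_iff.2 hu
    have h1 := key (‖u‖⁻¹ • u) (by
      rw [inner_smul_left, inner_smul_right, real_inner_self_eq_norm_sq]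
      simp only [conj_trivial]
      field_simp)
    rw [map_smul, inner_smul_left, inner_smul_right, real_inner_self_eq_norm_sq] at h1
    simp only [conj_trivial] at h1
    have h2 : (|D| * (‖u‖⁻¹ * (‖u‖⁻¹ * ‖A u‖ ^ 2))) ^ 4 = 1 ^ 4 := by
      rw [mul_pow, one_pow, ← h1]
      congr 1
      exact (by decide : Even 4).pow_abs D
    have h3 := (pow_left_inj₀ (by positivity) zero_le_one (by norm_num)).1 h2
    rw [real_inner_self_eq_norm_sq, real_inner_self_eq_norm_sq]
    field_simp at h3 ⊢
    exact h3
  have key3 : ∀ u v : Euc 7, inner ℝ (A u) (A v) = |D|⁻¹ * inner ℝ u v := by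
    intro u v
    have h1 := key2 (u + v)
    have h2 := key2 u
    have h3 := key2 v
    rw [map_add, real_inner_add_add_self, real_inner_add_add_self] at h1
    linarith
  -- Taking determinants in dimension 7 gives D² = |D|⁻⁷, so |D| = 1.
  have h4 : LinearMap.adjoint A * A = |D|⁻¹ • (1 : Euc 7 →ₗ[ℝ] Euc 7) := by
    ext1 v
    refine ext_inner_right ℝ fun w => ?_
    rw [Module.End.mul_apply, LinearMap.adjoint_inner_left, key3, LinearMap.smul_apply,
      Module.End.one_apply, inner_smul_left]
    simp
  have h5 := congrArg LinearMap.det h4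
  rw [map_mul, det_adjoint_real, LinearMap.det_smul] at h5
  simp only [finrank_euclideanSpace, Fintype.card_fin, map_one, mul_one] at h5
  have h6 : |D| ^ 9 = 1 ^ 9 := by
    have : |D| ^ 2 = |D|⁻¹ ^ 7 := by rw [sq_abs, ← h5]; ring
    calc |D| ^ 9 = |D| ^ 2 * |D| ^ 7 := by ring
      _ = (|D|⁻¹ * |D|) ^ 7 := by rw [this]; ring
      _ = 1 ^ 9 := by rw [inv_mul_cancel₀ hD.ne']; norm_num
  have h7 := (pow_left_inj₀ hD.le zero_le_one (by norm_num)).1 h6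
  rw [key3, h7, inv_one, one_mul]

/-- A linear automorphism of `ℝ⁷` preserving `φ₀` preserves `∗φ₀`. -/
lemma starPhi0_map_of_phi0_comp (A : Euc 7 →ₗ[ℝ] Euc 7) (hA0 : LinearMap.det A ≠ 0)
    (hA : ∀ u v w, phi0 ![A u, A v, A w] = phi0 ![u, v, w]) (u v w z : Euc 7) :
    starPhi0 ![A u, A v, A w, A z] = starPhi0 ![u, v, w, z] := by
  have hi := inner_map_of_phi0_comp A hA0 hA
  have hsurj : Function.Surjective A :=
    LinearMap.range_eq_top.1 ((LinearMap.isUnit_iff_range_eq_top A).1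
      ((LinearMap.isUnit_iff_isUnit_det A).2 (isUnit_iff_ne_zero.2 hA0)))
  have hc : ∀ u v, cross0 (A u) (A v) = A (cross0 u v) := by
    intro u v
    refine ext_inner_right ℝ fun w => ?_
    obtain ⟨w, rfl⟩ := hsurj w
    rw [inner_cross0, hA, hi, inner_cross0]
  rw [starPhi0_eq, starPhi0_eq, hc, hc, hi, hi, hi, hi, hi]

/-- The map σ ∘ τ⁻¹ preserves φ₀. This makes the arbitrary choice in `g2Frame` harmless for ∗φ. -/
lemma starPhi0_comp_eq_of_phi0_comp_eq (σ τ : Euc 7 ≃L[ℝ] Euc 7)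
    (h : phi0.compContinuousLinearMap (σ : Euc 7 →L[ℝ] Euc 7) =
      phi0.compContinuousLinearMap (τ : Euc 7 →L[ℝ] Euc 7)) :
    starPhi0.compContinuousLinearMap (σ : Euc 7 →L[ℝ] Euc 7) =
      starPhi0.compContinuousLinearMap (τ : Euc 7 →L[ℝ] Euc 7) := by
  let A : Euc 7 ≃ₗ[ℝ] Euc 7 := τ.symm.toLinearEquiv.trans σ.toLinearEquiv
  have hA0 : LinearMap.det (A : Euc 7 →ₗ[ℝ] Euc 7) ≠ 0 := A.isUnit_det'.ne_zero
  have hAτ : ∀ x, A (τ x) = σ x := fun x => by simp [A]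
  have key := starPhi0_map_of_phi0_comp A hA0 (fun u v w => by
    obtain ⟨u, rfl⟩ := τ.surjective u
    obtain ⟨v, rfl⟩ := τ.surjective v
    obtain ⟨w, rfl⟩ := τ.surjective w
    have := congrArg (fun f => f ![u, v, w]) h
    simp only [ContinuousAlternatingMap.compContinuousLinearMap_apply] at this
    simp only [LinearEquiv.coe_coe, hAτ]
    convert this using 2 <;> ext i <;> fin_cases i <;> rfl)
  ext x
  simp only [ContinuousAlternatingMap.compContinuousLinearMap_apply]
  have := key (τ (x 0)) (τ (x 1)) (τ (x 2)) (τ (x 3))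
  simp only [LinearEquiv.coe_coe, hAτ] at this
  convert this using 2 <;> ext i <;> fin_cases i <;> rfl

/-! ### The transverse quaternionic structure of an orthonormal pair -/

/-- The orthogonal complement of `e₁, e₂, e₁ × e₂`. -/
def transverse (e₁ e₂ : Euc 7) : Submodule ℝ (Euc 7) :=
  (Submodule.span ℝ (Set.range ![e₁, e₂, cross0 e₁ e₂]))ᗮ

lemma mem_transverse {e₁ e₂ w : Euc 7} : w ∈ transverse e₁ e₂ ↔
    inner ℝ w e₁ = (0 : ℝ) ∧ inner ℝ w e₂ = (0 : ℝ) ∧ inner ℝ w (cross0 e₁ e₂) = (0 : ℝ) := by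
  rw [transverse, Submodule.mem_orthogonal']
  constructor
  · intro h
    exact ⟨h _ (Submodule.subset_span ⟨0, rfl⟩), h _ (Submodule.subset_span ⟨1, rfl⟩),
      h _ (Submodule.subset_span ⟨2, rfl⟩)⟩
  · rintro ⟨h1, h2, h3⟩ u hu
    induction hu using Submodule.span_induction with
    | mem x hx =>
      obtain ⟨i, rfl⟩ := hx
      fin_cases i <;> assumption
    | zero => exact inner_zero_right _
    | add x y _ _ hx hy => rw [inner_add_right, hx, hy, add_zero]
    | smul a x _ hx => rw [inner_smul_right, hx, mul_zero]

section Pair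

variable {e₁ e₂ w w' : Euc 7}

/-- The vectors e₁, e₂, e₃ = e₁ × e₂ span the imaginary part of a quaternion subalgebra; this lemma
and the next are its multiplication table. -/
lemma cross0_e3_e1
    (h₁ : inner ℝ e₁ e₁ = (1 : ℝ)) (h₁₂ : inner ℝ e₁ e₂ = (0 : ℝ)) :
    cross0 (cross0 e₁ e₂) e₁ = e₂ := by
  rw [cross0_swap, cross0_cross0_self, h₁, h₁₂]
  simp

lemma cross0_e3_e2
    (h₂ : inner ℝ e₂ e₂ = (1 : ℝ)) (h₁₂ : inner ℝ e₁ e₂ = (0 : ℝ)) :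
    cross0 (cross0 e₁ e₂) e₂ = -e₁ := by
  rw [cross0_swap, cross0_swap e₁ e₂, ← neg_one_smul ℝ (cross0 e₂ e₁), cross0_smul_right,
    cross0_cross0_self, h₂, real_inner_comm, h₁₂]
  simp

lemma inner_e3_self
    (h₁ : inner ℝ e₁ e₁ = (1 : ℝ)) (h₂ : inner ℝ e₂ e₂ = (1 : ℝ))
    (h₁₂ : inner ℝ e₁ e₂ = (0 : ℝ)) :
    inner ℝ (cross0 e₁ e₂) (cross0 e₁ e₂) = (1 : ℝ) := by
  rw [inner_cross0_cyclic, cross0_swap, cross0_e3_e2 h₂ h₁₂, neg_neg, h₁]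

lemma orthonormal_triple
    (h₁ : inner ℝ e₁ e₁ = (1 : ℝ)) (h₂ : inner ℝ e₂ e₂ = (1 : ℝ))
    (h₁₂ : inner ℝ e₁ e₂ = (0 : ℝ)) :
    Orthonormal ℝ ![e₁, e₂, cross0 e₁ e₂] := by
  have h3 := inner_e3_self h₁ h₂ h₁₂
  have h13 := inner_cross0_self_left e₁ e₂
  have h23 := inner_cross0_self_right e₁ e₂
  rw [orthonormal_iff_ite]
  intro i j
  fin_cases i <;> fin_cases j <;>
    simp only [Fin.zero_eta, Fin.mk_one, Fin.reduceFinMk, Matrix.cons_val] <;>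
    simp [-inner_self_eq_norm_sq_to_K, h₁, h₂, h₁₂, h3, h13, h23,
      real_inner_comm e₁ e₂, real_inner_comm (cross0 e₁ e₂)]

lemma finrank_transverse
    (h₁ : inner ℝ e₁ e₁ = (1 : ℝ)) (h₂ : inner ℝ e₂ e₂ = (1 : ℝ))
    (h₁₂ : inner ℝ e₁ e₂ = (0 : ℝ)) :
    Module.finrank ℝ (transverse e₁ e₂) = 4 := by
  have h := Submodule.finrank_add_finrank_orthogonal
    (Submodule.span ℝ (Set.range ![e₁, e₂, cross0 e₁ e₂]))
  rw [finrank_span_eq_card (orthonormal_triple h₁ h₂ h₁₂).linearIndependent] at h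
  simp only [Fintype.card_fin, finrank_euclideanSpace] at h
  rw [transverse]
  omega


lemma cross0_e3_mem_transverse
    (h₁ : inner ℝ e₁ e₁ = (1 : ℝ)) (h₂ : inner ℝ e₂ e₂ = (1 : ℝ)) (h₁₂ : inner ℝ e₁ e₂ = (0 : ℝ))
    (hw : w ∈ transverse e₁ e₂) :
    cross0 w (cross0 e₁ e₂) ∈ transverse e₁ e₂ := by
  obtain ⟨g1, g2, -⟩ := mem_transverse.1 hw
  refine mem_transverse.2 ⟨?_, ?_, inner_cross0_self_right _ _⟩
  · rw [inner_cross0_cyclic, cross0_e3_e1 h₁ h₁₂, real_inner_comm, g2]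
  · rw [inner_cross0_cyclic, cross0_e3_e2 h₂ h₁₂, inner_neg_left, real_inner_comm, g1, neg_zero]

lemma cross0_e1_mem_transverse
    (h₁ : inner ℝ e₁ e₁ = (1 : ℝ)) (h₁₂ : inner ℝ e₁ e₂ = (0 : ℝ)) (hw : w ∈ transverse e₁ e₂) :
    cross0 e₁ w ∈ transverse e₁ e₂ := by
  obtain ⟨g1, g2, g3⟩ := mem_transverse.1 hw
  refine mem_transverse.2 ⟨inner_cross0_self_left _ _, ?_, ?_⟩
  · rw [inner_cross0_cyclic, inner_cross0_cyclic, cross0_swap, inner_neg_left, real_inner_comm, g3,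
      neg_zero]
  · rw [inner_cross0_cyclic, inner_cross0_cyclic, cross0_e3_e1 h₁ h₁₂, real_inner_comm, g2]

lemma cross0_e3_e3
    (h₁ : inner ℝ e₁ e₁ = (1 : ℝ)) (h₂ : inner ℝ e₂ e₂ = (1 : ℝ)) (h₁₂ : inner ℝ e₁ e₂ = (0 : ℝ))
    (hw : w ∈ transverse e₁ e₂) :
    cross0 (cross0 w (cross0 e₁ e₂)) (cross0 e₁ e₂) = -w := by
  obtain ⟨-, -, g3⟩ := mem_transverse.1 hw
  rw [cross0_swap, cross0_swap w, ← neg_one_smul ℝ (cross0 (cross0 e₁ e₂) w), cross0_smul_right,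
    cross0_cross0_self, inner_e3_self h₁ h₂ h₁₂, real_inner_comm, g3]
  simp

lemma cross0_e1_e1
    (hw : w ∈ transverse e₁ e₂) : cross0 e₁ (cross0 e₁ w) = - (inner ℝ e₁ e₁ : ℝ) • w := by
  obtain ⟨g1, -, -⟩ := mem_transverse.1 hw
  rw [cross0_cross0_self, real_inner_comm, g1]
  simp

lemma starPhi0_cyclic (u v w z : Euc 7) : starPhi0 ![u, v, w, z] = starPhi0 ![w, u, v, z] := by
  simp only [starPhi0_apply, coordForm_four, coordForm_three]
  simp
  ring

/-- After a cyclic permutation that puts w first, the two metric terms of `starPhi0_eq` drop out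
because w is orthogonal to e₁ and e₂. Both ω' and the calibration are computed from this formula. -/
lemma starPhi0_pair
    (hw : w ∈ transverse e₁ e₂) :
    starPhi0 ![e₁, e₂, w, w'] = - inner ℝ (cross0 w (cross0 e₁ e₂)) w' := by
  obtain ⟨g1, g2, -⟩ := mem_transverse.1 hw
  rw [starPhi0_cyclic, starPhi0_eq, g1, g2]
  ring

/-- `e₁ × (e₂ × w) = w × e₃` on the transverse space. -/
lemma cross0_e1_e2
    (h₁₂ : inner ℝ e₁ e₂ = (0 : ℝ)) (hw : w ∈ transverse e₁ e₂) :
    cross0 e₁ (cross0 e₂ w) = cross0 w (cross0 e₁ e₂) := by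
  obtain ⟨g1, g2, -⟩ := mem_transverse.1 hw
  refine ext_inner_right ℝ fun z => ?_
  -- Both sides compute -∗φ₀(e₁, e₂, w, z): one expansion puts w first, the other e₁.
  have h := starPhi0_pair (w' := z) hw
  rw [starPhi0_eq, h₁₂, real_inner_comm w e₁, g1] at h
  rw [← neg_inj, ← h]
  ring

/-- `e₂ × w = - e₁ × (w × e₃)` on the transverse space. -/
lemma cross0_e2_eq
    (h₁ : inner ℝ e₁ e₁ = (1 : ℝ)) (h₁₂ : inner ℝ e₁ e₂ = (0 : ℝ)) (hw : w ∈ transverse e₁ e₂) :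
    cross0 e₂ w = - cross0 e₁ (cross0 w (cross0 e₁ e₂)) := by
  obtain ⟨g1, g2, g3⟩ := mem_transverse.1 hw
  rw [← cross0_e1_e2 h₁₂ hw, cross0_cross0_self, h₁, real_inner_comm (cross0 e₂ w),
    inner_cross0_cyclic, inner_cross0_cyclic, real_inner_comm, g3]
  simp

/-- With α = φ₀(e₁, ·, ·) and J w = w × e₃ this is φ₀(e₂, ·, ·) = -α(J·, ·), the source of the
relation between η₁' and η₂'. -/
lemma phi0_e2_eq
    (h₁ : inner ℝ e₁ e₁ = (1 : ℝ)) (h₁₂ : inner ℝ e₁ e₂ = (0 : ℝ)) (hw : w ∈ transverse e₁ e₂) :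
    phi0 ![e₂, w, w'] = - phi0 ![e₁, cross0 w (cross0 e₁ e₂), w'] := by
  rw [← inner_cross0, ← inner_cross0, cross0_e2_eq h₁ h₁₂ hw, inner_neg_left]

end Pair

lemma phi0_swap (u v w : Euc 7) : phi0 ![u, v, w] = - phi0 ![u, w, v] := by
  simp only [phi0_apply, coordForm_three]
  ring

/-! ### The complex structure determined by three `2`-forms on `ℝ⁴` -/

lemma vecCons_two_swap {E F : Type*} [NormedAddCommGroup E] [NormedSpace ℝ E]
    [NormedAddCommGroup F] [NormedSpace ℝ F] (η : E [⋀^Fin 2]→L[ℝ] F) (x y : E) :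
    η ![x, y] = - η ![y, x] := by
  have h := η.toAlternatingMap.map_swap ![y, x] (i := 0) (j := 1) (by decide)
  have h2 : ![y, x] ∘ Equiv.swap (0 : Fin 2) 1 = ![x, y] := by
    ext i; fin_cases i <;> rfl
  rw [h2] at h
  exact h

/-- A `2`-form as a map to the dual space. -/
def flat {E : Type*} [NormedAddCommGroup E] [NormedSpace ℝ E] :
    (E [⋀^Fin 2]→L[ℝ] ℝ) →L[ℝ] (E →L[ℝ] E →L[ℝ] ℝ) :=
  (ContinuousLinearMap.compL ℝ E (E [⋀^Fin 1]→L[ℝ] ℝ) (E →L[ℝ] ℝ)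
    (ContinuousAlternatingMap.ofSubsingletonLIE (𝕜 := ℝ) (E := E) (F := ℝ)
      (0 : Fin 1)).symm.toContinuousLinearEquiv).comp
  (ContinuousAlternatingMap.curryLeftLI (𝕜 := ℝ) (E := E) (F := ℝ) (n := 1)).toContinuousLinearMap

lemma flat_apply {E : Type*} [NormedAddCommGroup E] [NormedSpace ℝ E]
    (η : E [⋀^Fin 2]→L[ℝ] ℝ) (x y : E) : flat η x y = η ![x, y] := by
  change η _ = η _
  congr 1
  ext i
  fin_cases i <;> rfl

/-- The algebraic relations between the forms `ω'`, `η₁'`, `η₂'` and the almost complex structure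
at a point of the quotient. -/
structure IsTransverseTriple (ϖ η₁ η₂ : Euc 4 [⋀^Fin 2]→L[ℝ] ℝ) (J : Euc 4 →L[ℝ] Euc 4) :
    Prop where
  sq : ∀ x, J (J x) = -x
  rel : ∃ a b : ℝ, 0 < b ∧ ∀ x y, η₂ ![x, y] = a * η₁ ![x, y] - b * η₁ ![J x, y]
  symm : ∀ x y, η₁ ![J x, y] = η₁ ![x, J y]
  nondeg : ∀ x, x ≠ 0 → ∃ y, η₁ ![x, y] ≠ 0
  compat : ∀ x y, ϖ ![J x, J y] = ϖ ![x, y]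
  pos : ∀ x, x ≠ 0 → 0 < ϖ ![x, J x]

/-- The forms and complex structure of a transverse slice of an orthonormal pair. -/
lemma exists_isTransverseTriple {x₁ x₂ e₁ e₂ : Euc 7} (h₁ : inner ℝ e₁ e₁ = (1 : ℝ))
    (h₂ : inner ℝ e₂ e₂ = (1 : ℝ)) (h₁₂ : inner ℝ e₁ e₂ = (0 : ℝ)) {p p' q r : ℝ}
    (hx₁ : x₁ = p • e₁ + p' • e₂) (hx₂ : x₂ = q • e₁ + r • e₂) (hD : 0 < p * r - p' * q)
    (lift : Euc 4 →ₗ[ℝ] Euc 7) (hinj : Function.Injective lift)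
    (hlift : ∀ x, lift x ∈ transverse e₁ e₂) {ϖ η₁ η₂ : Euc 4 [⋀^Fin 2]→L[ℝ] ℝ}
    (hϖ : ∀ x y, ϖ ![x, y] = starPhi0 ![x₂, x₁, lift x, lift y])
    (hη₁ : ∀ x y, η₁ ![x, y] = phi0 ![x₁, lift x, lift y])
    (hη₂ : ∀ x y, η₂ ![x, y] = phi0 ![x₂, lift x, lift y]) :
    ∃ J, IsTransverseTriple ϖ η₁ η₂ J ∧ ∀ x, lift (J x) = cross0 (lift x) (cross0 e₁ e₂) := by
  have hrange : LinearMap.range lift = transverse e₁ e₂ := by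
    apply Submodule.eq_of_le_of_finrank_eq
    · rintro _ ⟨x, rfl⟩
      exact hlift x
    · rw [LinearMap.finrank_range_of_inj hinj, finrank_transverse h₁ h₂ h₁₂]
      simp
  let R : Euc 7 →ₗ[ℝ] Euc 7 := - crossL (cross0 e₁ e₂)
  have hR : ∀ w, R w = cross0 w (cross0 e₁ e₂) := fun w => by
    rw [cross0_swap]; rfl
  let L := LinearEquiv.ofInjective lift hinj
  have hmem : ∀ x, R (lift x) ∈ LinearMap.range lift := fun x => by
    rw [hrange, hR]
    exact cross0_e3_mem_transverse h₁ h₂ h₁₂ (hlift x)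
  let J : Euc 4 →ₗ[ℝ] Euc 4 := L.symm.toLinearMap ∘ₗ (R ∘ₗ lift).codRestrict _ hmem
  have hJ : ∀ x, lift (J x) = cross0 (lift x) (cross0 e₁ e₂) := fun x => by
    have : (L (J x) : Euc 7) = R (lift x) := by
      simp [J]
    rw [← hR, ← this]
    rfl
  have hα : ∀ x y, phi0 ![e₂, lift x, lift y] = - phi0 ![e₁, lift (J x), lift y] := fun x y => by
    rw [phi0_e2_eq h₁ h₁₂ (hlift x), hJ]
  have hJJ : ∀ x, J (J x) = -x := fun x => hinj (by
    rw [hJ, hJ, cross0_e3_e3 h₁ h₂ h₁₂ (hlift x), map_neg])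
  have hsymm : ∀ x y, phi0 ![e₁, lift (J x), lift y] = phi0 ![e₁, lift x, lift (J y)] := by
    intro x y
    -- The symmetry α(Jx, y) = α(x, Jy) is the antisymmetry of φ₀(e₂, ·, ·) = -α(J·, ·), combined
    -- with that of α.
    have a := hα x y
    have b := hα y x
    rw [phi0_swap, b] at a
    rw [phi0_swap e₁ (lift x)]
    linarith
  have hlin : ∀ (a b : ℝ) (u v : Euc 7), phi0 ![a • e₁ + b • e₂, u, v] =
      a * phi0 ![e₁, u, v] + b * phi0 ![e₂, u, v] := by
    intro a b u v
    simp only [phi0_apply, coordForm_three, PiLp.add_apply, PiLp.smul_apply, smul_eq_mul]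
    ring
  have hη₁' : ∀ x y, η₁ ![x, y] =
      p * phi0 ![e₁, lift x, lift y] - p' * phi0 ![e₁, lift (J x), lift y] := fun x y => by
    rw [hη₁, hx₁, hlin, hα]
    ring
  have hη₂' : ∀ x y, η₂ ![x, y] =
      q * phi0 ![e₁, lift x, lift y] - r * phi0 ![e₁, lift (J x), lift y] := fun x y => by
    rw [hη₂, hx₂, hlin, hα]
    ring
  have hη₁J : ∀ x y, η₁ ![J x, y] =
      p * phi0 ![e₁, lift (J x), lift y] + p' * phi0 ![e₁, lift x, lift y] := fun x y => by
    rw [hη₁', hJJ]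
    have : phi0 ![e₁, lift (-x), lift y] = - phi0 ![e₁, lift x, lift y] := by
      simp only [map_neg, phi0_apply, coordForm_three, PiLp.neg_apply]
      ring
    rw [this]
    ring
  have hϖ' : ∀ x y, ϖ ![x, y] = (p * r - p' * q) * inner ℝ (lift (J x)) (lift y) := fun x y => by
    have := starPhi0_pair (w' := lift y) (hlift x)
    rw [hϖ, hJ, hx₁, hx₂]
    -- The order x₂, x₁, which comes from i_{X₁} i_{X₂}, produces a sign that cancels the one in
    -- `starPhi0_pair`; hence ω' is a positive multiple of ⟨J·, ·⟩.
    have h3 : starPhi0 ![q • e₁ + r • e₂, p • e₁ + p' • e₂, lift x, lift y] =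
        -(p * r - p' * q) * starPhi0 ![e₁, e₂, lift x, lift y] := by
      simp only [starPhi0_apply, coordForm_four, coordForm_three, PiLp.add_apply,
        PiLp.smul_apply, smul_eq_mul]
      simp
      ring
    rw [h3, this]
    ring
  have hn : 0 < p ^ 2 + p' ^ 2 := by
    rcases eq_or_ne p 0 with h | h
    · have : p' ≠ 0 := by
        rintro rfl
        simp [h] at hD
      positivity
    · positivity
  have hskew : ∀ x y, inner ℝ (lift (J x)) (lift y) = - (inner ℝ (lift x) (lift (J y)) : ℝ) := by
    intro x y
    rw [hJ, hJ, cross0_swap, inner_neg_left, inner_cross0_swap, cross0_swap (lift y),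
      inner_neg_right, neg_neg]
  refine ⟨LinearMap.toContinuousLinearMap J, ⟨hJJ, ?_, ?_, ?_, ?_, ?_⟩, hJ⟩
  -- Since η₁ = p α - p' α(J·, ·) and η₂ = q α - r α(J·, ·), the coefficients are given by a + i b =
  -- (q + i r) / (p + i p'). Positivity of b is the orientation condition.
  · refine ⟨(p * q + p' * r) / (p ^ 2 + p' ^ 2), (p * r - p' * q) / (p ^ 2 + p' ^ 2),
      by positivity, fun x y => ?_⟩
    rw [LinearMap.coe_toContinuousLinearMap', hη₁J, hη₁', hη₂']
    field_simp
    ring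
  · intro x y
    rw [LinearMap.coe_toContinuousLinearMap', hη₁J, hη₁', ← hsymm, ← hsymm, hJJ]
    have : phi0 ![e₁, lift (-x), lift y] = - phi0 ![e₁, lift x, lift y] := by
      simp only [map_neg, phi0_apply, coordForm_three, PiLp.neg_apply]
      ring
    rw [this]
    ring
  · intro x hx
    by_contra! hzero
    have hz : ∀ y, phi0 ![e₁, lift x, lift y] = 0 := by
      intro y
      have a := hzero y
      -- Testing against y and J y gives two linear equations for α(x, y) and α(Jx, y), with
      -- determinant p² + p'².
      have b := hzero (J y)
      rw [hη₁'] at a b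
      rw [← hsymm, ← hsymm, hJJ] at b
      have : phi0 ![e₁, lift (-x), lift y] = - phi0 ![e₁, lift x, lift y] := by
        simp only [map_neg, phi0_apply, coordForm_three, PiLp.neg_apply]
        ring
      rw [this] at b
      have h3 : (p ^ 2 + p' ^ 2) * phi0 ![e₁, lift x, lift y] = 0 := by
        linear_combination p * a + p' * b
      exact (mul_eq_zero.1 h3).resolve_left hn.ne'
    -- The vector e₁ × x is itself transverse, hence of the form `lift y`; testing against this y
    -- gives |e₁ × x|² = 0.
    have h5 := cross0_e1_mem_transverse h₁ h₁₂ (hlift x)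
    rw [← hrange] at h5
    obtain ⟨y, hy⟩ := h5
    have h6 := hz y
    rw [← inner_cross0, hy, inner_self_eq_zero] at h6
    have h7 := cross0_e1_e1 (hlift x)
    rw [h6, h₁] at h7
    have h8 : lift x = 0 := by
      have : cross0 e₁ 0 = 0 := by simpa using cross0_smul_right 0 e₁ 0
      rw [this] at h7
      simpa using h7.symm
    exact hx (hinj (by rw [h8, map_zero]))
  · intro x y
    rw [LinearMap.coe_toContinuousLinearMap', hϖ', hϖ', hskew (J x), hJJ, map_neg, inner_neg_right,
      neg_neg]
  · intro x hx
    rw [LinearMap.coe_toContinuousLinearMap', hϖ']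
    refine mul_pos hD (real_inner_self_pos.2 fun h => hx ?_)
    have : J x = 0 := hinj (by rw [h, map_zero])
    have h2 := hJJ x
    rw [this, map_zero] at h2
    exact neg_eq_zero.1 h2.symm

/-- The trace as a continuous functional. -/
def traceL : (Euc 4 →L[ℝ] Euc 4) →L[ℝ] ℝ :=
  LinearMap.toContinuousLinearMap
    (LinearMap.trace ℝ (Euc 4) ∘ₗ ContinuousLinearMap.coeLM ℝ)

lemma traceL_apply (A : Euc 4 →L[ℝ] Euc 4) : traceL A = LinearMap.trace ℝ (Euc 4) A := rfl

lemma traceL_id : traceL (ContinuousLinearMap.id ℝ (Euc 4)) = 4 := by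
  rw [traceL_apply, ContinuousLinearMap.coe_id, LinearMap.trace_id]
  simp

/-- The endomorphism `K` with `η₁ (K x, y) = η₂ (x, y)`. -/
def quotientEnd (η : (Euc 4 [⋀^Fin 2]→L[ℝ] ℝ) × (Euc 4 [⋀^Fin 2]→L[ℝ] ℝ)) :
    Euc 4 →L[ℝ] Euc 4 :=
  (ContinuousLinearMap.inverse (flat η.1)).comp (flat η.2)

/-- The mean `a` of the eigenvalues `a ± i b` of `quotientEnd`. -/
def quotientRe (η : (Euc 4 [⋀^Fin 2]→L[ℝ] ℝ) × (Euc 4 [⋀^Fin 2]→L[ℝ] ℝ)) : ℝ :=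
  traceL (quotientEnd η) / 4

/-- The trace-free part of `quotientEnd`. -/
def quotientEndFree (η : (Euc 4 [⋀^Fin 2]→L[ℝ] ℝ) × (Euc 4 [⋀^Fin 2]→L[ℝ] ℝ)) :
    Euc 4 →L[ℝ] Euc 4 :=
  quotientEnd η - quotientRe η • ContinuousLinearMap.id ℝ (Euc 4)

/-- The imaginary part `b` of the eigenvalues `a ± i b` of `quotientEnd`. -/
def quotientIm (η : (Euc 4 [⋀^Fin 2]→L[ℝ] ℝ) × (Euc 4 [⋀^Fin 2]→L[ℝ] ℝ)) : ℝ :=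
  Real.sqrt (-(traceL ((quotientEndFree η).comp (quotientEndFree η))) / 4)

/-- The complex structure `- (K - a) / b`. -/
def quotientJ (η : (Euc 4 [⋀^Fin 2]→L[ℝ] ℝ) × (Euc 4 [⋀^Fin 2]→L[ℝ] ℝ)) :
    Euc 4 →L[ℝ] Euc 4 :=
  -((quotientIm η)⁻¹ • quotientEndFree η)

lemma contDiff_flat : ContDiff ℝ ∞ (fun η : Euc 4 [⋀^Fin 2]→L[ℝ] ℝ => flat η) :=
  ContinuousLinearMap.contDiff (𝕜 := ℝ) (E := Euc 4 [⋀^Fin 2]→L[ℝ] ℝ)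
    (F := Euc 4 →L[ℝ] Euc 4 →L[ℝ] ℝ) flat

/-- A nondegenerate form gives an isomorphism with the dual space. -/
lemma exists_flat_equiv {η : Euc 4 [⋀^Fin 2]→L[ℝ] ℝ} (h : ∀ x, x ≠ 0 → ∃ y, η ![x, y] ≠ 0) :
    ∃ e : Euc 4 ≃L[ℝ] (Euc 4 →L[ℝ] ℝ), (e : Euc 4 →L[ℝ] (Euc 4 →L[ℝ] ℝ)) = flat η := by
  have hinj : Function.Injective (flat η) := by
    rw [injective_iff_map_eq_zero]
    intro x hx
    by_contra hx0
    obtain ⟨y, hy⟩ := h x hx0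
    rw [← flat_apply, hx] at hy
    exact hy rfl
  have hdim : Module.finrank ℝ (Euc 4) = Module.finrank ℝ (Euc 4 →L[ℝ] ℝ) := by
    rw [← (LinearMap.toContinuousLinearMap (𝕜 := ℝ) (E := Euc 4) (F' := ℝ)).finrank_eq]
    exact (Subspace.dual_finrank_eq (K := ℝ) (V := Euc 4)).symm
  exact ⟨(LinearEquiv.ofInjectiveOfFinrankEq (flat η).toLinearMap hinj
    hdim).toContinuousLinearEquiv, by ext; rfl⟩

/-! ### Recovering the complex structure from two 2-forms -/

namespace IsTransverseTriple

variable {ϖ η₁ η₂ : Euc 4 [⋀^Fin 2]→L[ℝ] ℝ} {J : Euc 4 →L[ℝ] Euc 4}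

lemma nondeg_omega (h : IsTransverseTriple ϖ η₁ η₂ J) (x : Euc 4) (hx : x ≠ 0) :
    ∃ y, ϖ ![x, y] ≠ 0 :=
  ⟨J x, (h.pos x hx).ne'⟩

/-- Compatibility and J² = -1 give ϖ(Jx, y) = -ϖ(x, Jy). So the isomorphism with the dual space
defined by ϖ conjugates J to minus its transpose, and tr J = -tr J. -/
lemma trace_eq_zero (h : IsTransverseTriple ϖ η₁ η₂ J) : traceL J = 0 := by
  obtain ⟨e, he⟩ := exists_flat_equiv h.nondeg_omega
  let c : Euc 4 ≃ₗ[ℝ] Module.Dual ℝ (Euc 4) :=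
    e.toLinearEquiv.trans (LinearMap.toContinuousLinearMap (𝕜 := ℝ) (E := Euc 4) (F' := ℝ)).symm
  have hc : ∀ x y, c x y = ϖ ![x, y] := fun x y => by
    rw [← flat_apply, ← he]; rfl
  have h1 : c.conj (J : Euc 4 →ₗ[ℝ] Euc 4) =
      (-1 : ℝ) • Module.Dual.transpose (R := ℝ) (J : Euc 4 →ₗ[ℝ] Euc 4) := by
    ext f y
    obtain ⟨x, rfl⟩ := c.surjective f
    rw [LinearEquiv.conj_apply_apply, LinearEquiv.symm_apply_apply, hc]
    change _ = (-1 : ℝ) • (c x (J y))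
    rw [hc, neg_one_smul, ← h.compat x, ContinuousLinearMap.coe_coe, h.sq,
      ← flat_apply, ← flat_apply]
    simp
  have h2 := LinearMap.trace_conj' (J : Euc 4 →ₗ[ℝ] Euc 4) c
  rw [h1, map_smul, LinearMap.trace_transpose', neg_one_smul] at h2
  rw [traceL_apply]
  linarith

/-- The relation between the forms says K = a - b J. The trace gives a, the trace of the square of K
- a gives b² and hence b > 0, and then J = -(K - a)/b. In particular J is unique, which later
replaces every check that it is independent of choices. -/
lemma quotient_eq (h : IsTransverseTriple ϖ η₁ η₂ J) :
    0 < quotientIm (η₁, η₂) ∧ quotientJ (η₁, η₂) = J ∧ ∀ x y, η₂ ![x, y] =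
      quotientRe (η₁, η₂) * η₁ ![x, y] - quotientIm (η₁, η₂) * η₁ ![J x, y] := by
  obtain ⟨a, b, hb, hrel⟩ := h.rel
  obtain ⟨e, he⟩ := exists_flat_equiv h.nondeg
  have h1 : flat η₂ = (flat η₁).comp (a • ContinuousLinearMap.id ℝ (Euc 4) - b • J) := by
    ext x y
    simp only [ContinuousLinearMap.comp_apply, sub_apply,
      smul_apply, ContinuousLinearMap.id_apply, map_sub, map_smul, flat_apply,
      smul_eq_mul]
    exact hrel x y
  have h2 : quotientEnd (η₁, η₂) = a • ContinuousLinearMap.id ℝ (Euc 4) - b • J := by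
    rw [quotientEnd, h1, ← he, ContinuousLinearMap.inverse_equiv]
    ext1 x
    simp
  have h3 : quotientRe (η₁, η₂) = a := by
    rw [quotientRe, h2, map_sub, map_smul, map_smul, traceL_id, h.trace_eq_zero]
    simp
  have h4 : quotientEndFree (η₁, η₂) = - (b • J) := by
    rw [quotientEndFree, h2, h3]
    abel
  -- Here K - a = -b J has square -b², of trace -4 b².
  have h5 : quotientIm (η₁, η₂) = b := by
    have : (- (b • J)).comp (- (b • J)) = -(b ^ 2) • ContinuousLinearMap.id ℝ (Euc 4) := by
      ext1 x
      simp [h.sq, smul_smul, pow_two]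
    rw [quotientIm, h4, this, map_smul, traceL_id]
    rw [show -(-b ^ 2 • (4 : ℝ)) / 4 = b ^ 2 by simp, Real.sqrt_sq hb.le]
  refine ⟨h5 ▸ hb, ?_, by rw [h3, h5]; exact hrel⟩
  rw [quotientJ, h4, h5, smul_neg, neg_neg, smul_smul, inv_mul_cancel₀ hb.ne', one_smul]

/-- Pulling back a transverse triple by a linear isomorphism. -/
lemma pullback (h : IsTransverseTriple ϖ η₁ η₂ J) (A B : Euc 4 →L[ℝ] Euc 4)
    (hAB : ∀ x, A (B x) = x) (hBA : ∀ x, B (A x) = x) :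
    IsTransverseTriple (ϖ.compContinuousLinearMap A) (η₁.compContinuousLinearMap A)
      (η₂.compContinuousLinearMap A) (B.comp (J.comp A)) := by
  have hcomp : ∀ (η : Euc 4 [⋀^Fin 2]→L[ℝ] ℝ) x y,
      η.compContinuousLinearMap A ![x, y] = η ![A x, A y] := fun η x y => by
    rw [ContinuousAlternatingMap.compContinuousLinearMap_apply]
    congr 1
    ext i; fin_cases i <;> rfl
  have hinj : ∀ x, x ≠ 0 → A x ≠ 0 := fun x hx hA => hx (by rw [← hBA x, hA, map_zero])
  have hsurj : ∀ y, ∃ x, A x = y := fun y => ⟨B y, hAB y⟩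
  obtain ⟨a, b, hb, hrel⟩ := h.rel
  refine ⟨fun x => ?_, ⟨a, b, hb, fun x y => ?_⟩, fun x y => ?_, fun x hx => ?_, fun x y => ?_,
    fun x hx => ?_⟩
  · simp [hAB, h.sq, hBA]
  · simp only [hcomp, ContinuousLinearMap.comp_apply, hAB, hrel]
  · simp only [hcomp, ContinuousLinearMap.comp_apply, hAB, h.symm]
  · obtain ⟨y, hy⟩ := h.nondeg _ (hinj x hx)
    obtain ⟨y, rfl⟩ := hsurj y
    exact ⟨y, by rwa [hcomp]⟩
  · simp only [hcomp, ContinuousLinearMap.comp_apply, hAB, h.compat]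
  · simp only [hcomp, ContinuousLinearMap.comp_apply, hAB]
    exact h.pos _ (hinj x hx)

lemma contDiffAt_quotientEnd (h : IsTransverseTriple ϖ η₁ η₂ J) :
    ContDiffAt ℝ ∞ quotientEnd (η₁, η₂) := by
  obtain ⟨e, he⟩ := exists_flat_equiv h.nondeg
  unfold quotientEnd
  refine ContDiffAt.clm_comp ?_ ?_
  -- `ContinuousLinearMap.inverse` is a total function, and its smoothness is available at
  -- invertible maps; e witnesses that `flat η₁` is one.
  · have h1 := contDiffAt_map_inverse (𝕜 := ℝ) (n := ∞) e
    rw [he] at h1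
    exact ContDiffAt.comp (η₁, η₂) (g := ContinuousLinearMap.inverse) h1
      ((contDiff_flat.comp contDiff_fst).contDiffAt)
  · exact (contDiff_flat.comp contDiff_snd).contDiffAt

lemma contDiffAt_quotientRe (h : IsTransverseTriple ϖ η₁ η₂ J) :
    ContDiffAt ℝ ∞ quotientRe (η₁, η₂) :=
  (traceL.contDiff.contDiffAt.comp _ h.contDiffAt_quotientEnd).div_const 4

lemma contDiffAt_quotientEndFree (h : IsTransverseTriple ϖ η₁ η₂ J) :
    ContDiffAt ℝ ∞ quotientEndFree (η₁, η₂) :=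
  h.contDiffAt_quotientEnd.sub (h.contDiffAt_quotientRe.smul contDiffAt_const)

lemma contDiffAt_quotientIm (h : IsTransverseTriple ϖ η₁ η₂ J) :
    ContDiffAt ℝ ∞ quotientIm (η₁, η₂) := by
  refine ContDiffAt.sqrt ?_ ?_
  · exact ((traceL.contDiff.contDiffAt.comp _ (h.contDiffAt_quotientEndFree.clm_comp
      h.contDiffAt_quotientEndFree)).neg).div_const 4
  -- The square root is smooth away from zero, and a vanishing radicand would contradict b > 0.
  · intro h0
    have := h.quotient_eq.1
    rw [quotientIm, h0, Real.sqrt_zero] at this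
    exact lt_irrefl _ this

lemma contDiffAt_quotientJ (h : IsTransverseTriple ϖ η₁ η₂ J) :
    ContDiffAt ℝ ∞ quotientJ (η₁, η₂) :=
  ((h.contDiffAt_quotientIm.inv h.quotient_eq.1.ne').smul h.contDiffAt_quotientEndFree).neg

/-- A `2`-plane is invariant under `J` if and only if `η₁` and `η₂` vanish on it. -/
lemma invariant_iff (h : IsTransverseTriple ϖ η₁ η₂ J) (Y : Submodule ℝ (Euc 4))
    (hY : Module.finrank ℝ Y = 2) :
    (∀ x ∈ Y, J x ∈ Y) ↔ (∀ x ∈ Y, ∀ y ∈ Y, η₁ ![x, y] = 0) ∧ ∀ x ∈ Y, ∀ y ∈ Y, η₂ ![x, y] = 0 := by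
  obtain ⟨a, b, hb, hrel⟩ := h.rel
  have hdiag : ∀ x, η₁ ![x, x] = 0 := fun x => by
    have := vecCons_two_swap η₁ x x
    linarith
  constructor
  · intro hJ
    have key : ∀ x ∈ Y, ∀ y ∈ Y, η₁ ![x, y] = 0 := by
      intro x hx y hy
      by_cases hx0 : x = 0
      · rw [hx0, ← flat_apply]
        simp
      -- The pairing η₁(Jx, y) = η₁(x, Jy) is symmetric in x = y, while η₁ is alternating.
      have hJx : η₁ ![x, J x] = 0 := by
        have h1 := h.symm x x
        have h2 := vecCons_two_swap η₁ x (J x)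
        linarith
      have hli : LinearIndependent ℝ ![(⟨x, hx⟩ : Y), ⟨J x, hJ x hx⟩] := by
        rw [LinearIndependent.pair_iff]
        intro s t hst
        have hst' : s • x + t • J x = 0 := congrArg Subtype.val hst
        -- Pairing with x under ϖ isolates t, because ϖ(x, Jx) > 0.
        have h2 : ϖ ![x, s • x + t • J x] = 0 := by rw [hst', ← flat_apply, map_zero]
        have h3 : ϖ ![x, x] = 0 := by
          have := vecCons_two_swap ϖ x x
          linarith
        rw [← flat_apply, map_add, map_smul, map_smul, flat_apply, flat_apply, h3] at h2
        have ht : t = 0 := by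
          simpa [(h.pos x hx0).ne'] using h2
        subst ht
        simpa [hx0] using hst'
      have hspan := hli.span_eq_top_of_card_eq_finrank (by simp [hY])
      have hy' : (⟨y, hy⟩ : Y) ∈ Submodule.span ℝ (Set.range ![(⟨x, hx⟩ : Y), ⟨J x, hJ x hx⟩]) := by
        rw [hspan]
        trivial
      rw [Matrix.range_cons, Matrix.range_cons, Matrix.range_empty, Set.union_empty,
        Set.singleton_union, Submodule.mem_span_pair] at hy'
      obtain ⟨s, t, hst⟩ := hy'
      have hst' : s • x + t • J x = y := congrArg Subtype.val hst
      rw [← hst', ← flat_apply, map_add, map_smul, map_smul, flat_apply, flat_apply, hdiag, hJx]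
      simp
    refine ⟨key, fun x hx y hy => ?_⟩
    rw [hrel, key x hx y hy, key (J x) (hJ x hx) y hy]
    simp
  · rintro ⟨h1, h2⟩ x hx
    have h3 : ∀ y ∈ Y, η₁ ![J x, y] = 0 := fun y hy => by
      have := hrel x y
      rw [h1 x hx y hy, h2 x hx y hy] at this
      have : b * η₁ ![J x, y] = 0 := by linarith
      exact (mul_eq_zero.1 this).resolve_left hb.ne'
    obtain ⟨e, he⟩ := exists_flat_equiv h.nondeg
    let c : Euc 4 ≃ₗ[ℝ] Module.Dual ℝ (Euc 4) :=
      e.toLinearEquiv.trans (LinearMap.toContinuousLinearMap (𝕜 := ℝ) (E := Euc 4) (F' := ℝ)).symm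
    have hc : ∀ x y, c x y = η₁ ![x, y] := fun x y => by
      rw [← flat_apply, ← he]; rfl
    -- The η₁-annihilator of Y contains Y and has dimension 4 - 2 = 2, so it equals Y. As b ≠ 0, the
    -- vanishing of both forms puts Jx in this annihilator.
    have hle : Y ≤ Y.dualAnnihilator.comap c.toLinearMap := by
      intro z hz
      rw [Submodule.mem_comap, Submodule.mem_dualAnnihilator]
      intro w hw
      exact (hc z w).trans (h1 z hz w hw)
    have hfin : Module.finrank ℝ (Y.dualAnnihilator.comap c.toLinearMap) = 2 := by
      have e1 : Module.finrank ℝ (Y.dualAnnihilator.comap c.toLinearMap) =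
          Module.finrank ℝ Y.dualAnnihilator :=
        LinearEquiv.finrank_eq (c.submoduleMap _ |>.trans (LinearEquiv.ofEq _ _
          (Submodule.map_comap_eq_of_surjective c.surjective _)))
      have e2 := Subspace.finrank_add_finrank_dualAnnihilator_eq Y
      simp only [finrank_euclideanSpace, Fintype.card_fin] at e2
      omega
    have heq := Submodule.eq_of_le_of_finrank_eq hle (hY.trans hfin.symm)
    rw [heq, Submodule.mem_comap, Submodule.mem_dualAnnihilator]
    intro w hw
    exact (hc _ w).trans (h3 w hw)

end IsTransverseTriple

/-- The values of a `4`-form on two orthonormal bases of a `4`-dimensional space agree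
up to sign. -/
lemma abs_alternating_orthonormal {V : Type*} [NormedAddCommGroup V] [InnerProductSpace ℝ V]
    {n : ℕ} (hV : Module.finrank ℝ V = n) (f : V [⋀^Fin n]→ₗ[ℝ] ℝ) {u v : Fin n → V}
    (hu : Orthonormal ℝ u) (hv : Orthonormal ℝ v) : |f u| = |f v| := by
  -- `finrank` is also 0 in infinite dimension, so finite dimensionality follows only for n > 0; for
  -- n = 0 the two families coincide.
  have : FiniteDimensional ℝ V ∨ n = 0 := by
    rcases Nat.eq_zero_or_pos n with h | h
    · exact Or.inr h
    · exact Or.inl (Module.finite_of_finrank_pos (hV ▸ h))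
  rcases this with hfin | h0
  · have hspan : ∀ {w : Fin n → V}, Orthonormal ℝ w → ⊤ ≤ Submodule.span ℝ (Set.range w) :=
      fun hw => (hw.linearIndependent.span_eq_top_of_card_eq_finrank' (by simp [hV])).ge
    let b := OrthonormalBasis.mk hv (hspan hv)
    let a := OrthonormalBasis.mk hu (hspan hu)
    have h1 := f.eq_smul_basis_det b.toBasis
    have h2 : f u = f v * b.toBasis.det u := by
      conv_lhs => rw [h1]
      simp [b]
    have h3 : b.toBasis.det u = 1 ∨ b.toBasis.det u = -1 := by
      have := b.det_to_matrix_orthonormalBasis_real a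
      simpa [a] using this
    rw [h2, abs_mul]
    rcases h3 with h3 | h3 <;> simp [h3]
  · subst h0
    rw [Subsingleton.elim u v]

lemma inner_cross0_right_skew (w w' e : Euc 7) :
    inner ℝ (cross0 w e) w' = - (inner ℝ w (cross0 w' e) : ℝ) := by
  rw [cross0_swap, inner_neg_left, inner_cross0_swap, neg_neg, cross0_swap w', inner_neg_right,
    neg_neg]

set_option maxHeartbeats 800000 in
-- The value of ∗φ₀ on an orthonormal basis depends on the basis only up to sign, so e₁, e₂, w, w'
-- with w, w' an orthonormal basis of the lift of Y suffices. There the value is -⟨w × e₃, w'⟩, with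
-- both vectors of length one, so it is ±1 iff w × e₃ = ±w'.
lemma calibrated_iff {e₁ e₂ : Euc 7} (h₁ : inner ℝ e₁ e₁ = (1 : ℝ))
    (h₂ : inner ℝ e₂ e₂ = (1 : ℝ)) (h₁₂ : inner ℝ e₁ e₂ = (0 : ℝ))
    (lift : Euc 4 →ₗ[ℝ] Euc 7) (hinj : Function.Injective lift)
    (hlift : ∀ x, lift x ∈ transverse e₁ e₂) {J : Euc 4 →L[ℝ] Euc 4}
    (hJ : ∀ x, lift (J x) = cross0 (lift x) (cross0 e₁ e₂))
    (Y : Submodule ℝ (Euc 4)) (hY : Module.finrank ℝ Y = 2) :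
    (∀ u : Fin 4 → Euc 7, (∀ i, u i ∈ Submodule.span ℝ {e₁, e₂} ⊔ Y.map lift) →
      (∀ i j, inner ℝ (u i) (u j) = if i = j then (1 : ℝ) else 0) → |starPhi0 u| = 1) ↔
    ∀ y ∈ Y, J y ∈ Y := by
  set V := Submodule.span ℝ {e₁, e₂} ⊔ Y.map lift with hVdef
  have he₁ : e₁ ∈ V := Submodule.mem_sup_left (Submodule.subset_span (by simp))
  have he₂ : e₂ ∈ V := Submodule.mem_sup_left (Submodule.subset_span (by simp))
  have hon : ∀ w w' : Euc 7, w ∈ transverse e₁ e₂ → w' ∈ transverse e₁ e₂ →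
      inner ℝ w w = (1 : ℝ) → inner ℝ w' w' = (1 : ℝ) → inner ℝ w w' = (0 : ℝ) →
      ∀ i j, inner ℝ (![e₁, e₂, w, w'] i) (![e₁, e₂, w, w'] j) = if i = j then (1 : ℝ) else 0 := by
    intro w w' hw hw' a b c
    obtain ⟨g1, g2, -⟩ := mem_transverse.1 hw
    obtain ⟨g1', g2', -⟩ := mem_transverse.1 hw'
    intro i j
    fin_cases i <;> fin_cases j <;>
      simp only [Fin.zero_eta, Fin.mk_one, Fin.reduceFinMk, Matrix.cons_val] <;>
      simp [-inner_self_eq_norm_sq_to_K, h₁, h₂, h₁₂, a, b, c, g1, g2, g1', g2',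
        real_inner_comm e₁ e₂, real_inner_comm w w', real_inner_comm w e₁, real_inner_comm w e₂,
        real_inner_comm w' e₁, real_inner_comm w' e₂]
  have hmemV : ∀ w w' : Euc 7, w ∈ Y.map lift → w' ∈ Y.map lift →
      ∀ i, ![e₁, e₂, w, w'] i ∈ V := by
    intro w w' hw hw' i
    fin_cases i
    · exact he₁
    · exact he₂
    · exact Submodule.mem_sup_right hw
    · exact Submodule.mem_sup_right hw'
  have hmapt : ∀ w ∈ Y.map lift, w ∈ transverse e₁ e₂ := by
    rintro _ ⟨y, -, rfl⟩
    exact hlift y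
  have hfinY : Module.finrank ℝ (Y.map lift) = 2 := by
    rw [← (Submodule.equivMapOfInjective lift hinj Y).finrank_eq, hY]
  constructor
  · intro h
    let b := (stdOrthonormalBasis ℝ (Y.map lift)).reindex (finCongr hfinY)
    set w := (b 0 : Euc 7)
    set w' := (b 1 : Euc 7)
    have hw : w ∈ Y.map lift := (b 0).2
    have hw' : w' ∈ Y.map lift := (b 1).2
    have a1 : inner ℝ w w = (1 : ℝ) := by
      have := orthonormal_iff_ite.1 b.orthonormal 0 0
      rwa [if_pos rfl] at this
    have a2 : inner ℝ w' w' = (1 : ℝ) := by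
      have := orthonormal_iff_ite.1 b.orthonormal 1 1
      rwa [if_pos rfl] at this
    have a3 : inner ℝ w w' = (0 : ℝ) := by
      have := orthonormal_iff_ite.1 b.orthonormal 0 1
      rwa [if_neg zero_ne_one] at this
    have key : |starPhi0 ![e₁, e₂, w, w']| = 1 := h ![e₁, e₂, w, w'] (hmemV w w' hw hw')
      (hon w w' (hmapt w hw) (hmapt w' hw') a1 a2 a3)
    rw [starPhi0_pair (hmapt w hw), abs_neg] at key
    set Rw := cross0 w (cross0 e₁ e₂) with hRw
    have hRR : cross0 Rw (cross0 e₁ e₂) = -w := cross0_e3_e3 h₁ h₂ h₁₂ (hmapt w hw)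
    have a4 : inner ℝ Rw Rw = (1 : ℝ) := by
      rw [hRw, inner_cross0_right_skew, ← hRw, hRR, inner_neg_right, neg_neg, a1]
    -- Equality in Cauchy–Schwarz: with ε = ⟨Rw, w'⟩ = ±1, the square of the norm of Rw - ε w' is 1
    -- - ε² = 0.
    obtain ⟨ε, hε, hε2⟩ : ∃ ε : ℝ, Rw = ε • w' ∧ ε * ε = 1 := by
      refine ⟨inner ℝ Rw w', ?_, by rw [← abs_mul_abs_self, key, one_mul]⟩
      rw [← sub_eq_zero, ← inner_self_eq_zero (𝕜 := ℝ)]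
      simp only [inner_sub_left, inner_sub_right, inner_smul_left, inner_smul_right, a4, a2,
        conj_trivial, real_inner_comm Rw w']
      have : inner ℝ Rw w' * inner ℝ Rw w' = (1 : ℝ) := by rw [← abs_mul_abs_self, key, one_mul]
      linarith
    have hmul : ∀ (c : ℝ) (x y : Euc 7), cross0 (c • x) y = c • cross0 x y := cross0_smul_left
    have hRw' : cross0 w' (cross0 e₁ e₂) = -(ε • w) := by
      have h5 : w' = ε • Rw := by rw [hε, smul_smul, hε2, one_smul]
      rw [h5, cross0_smul_left, hRR, smul_neg]
    intro y hy
    have hyb : lift y = b.repr ⟨lift y, y, hy, rfl⟩ 0 • w + b.repr ⟨lift y, y, hy, rfl⟩ 1 • w' := by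
      have := congrArg Subtype.val (b.sum_repr ⟨lift y, y, hy, rfl⟩)
      rw [Fin.sum_univ_two] at this
      exact this.symm
    have hmem : lift (J y) ∈ Y.map lift := by
      rw [hJ, hyb, cross0_add_left, cross0_smul_left, cross0_smul_left, ← hRw, hε, hRw']
      exact add_mem (Submodule.smul_mem _ _ (Submodule.smul_mem _ _ hw'))
        (Submodule.smul_mem _ _ (neg_mem (Submodule.smul_mem _ _ hw)))
    obtain ⟨z, hz, hzy⟩ := hmem
    rwa [← hinj hzy]
  · intro h u hu hu1
    -- Any unit vector w of the lift is completed by w' = J w, and the value becomes -|w'|² = -1.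
    obtain ⟨⟨y, hy⟩, hy0⟩ := Module.finrank_pos_iff_exists_ne_zero.1
      (hY ▸ two_pos : 0 < Module.finrank ℝ Y)
    have hy0 : lift y ≠ 0 := fun h0 => hy0 (Subtype.ext (hinj (by rw [h0]; simp)))
    set c := ‖lift y‖⁻¹
    set w := lift (c • y) with hwdef
    have a1 : inner ℝ w w = (1 : ℝ) := by
      rw [hwdef, map_smul, inner_smul_left, inner_smul_right, real_inner_self_eq_norm_sq]
      have := norm_ne_zero_iff.2 hy0
      simp only [c, conj_trivial]
      field_simp
    have hw : w ∈ Y.map lift := ⟨_, Submodule.smul_mem _ _ hy, rfl⟩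
    set w' := lift (J (c • y)) with hwdef'
    have hw' : w' ∈ Y.map lift := ⟨_, h _ (Submodule.smul_mem _ _ hy), rfl⟩
    have hw'2 : w' = cross0 w (cross0 e₁ e₂) := hJ _
    have a2 : inner ℝ w' w' = (1 : ℝ) := by
      rw [hw'2, inner_cross0_right_skew, cross0_e3_e3 h₁ h₂ h₁₂ (hmapt w hw), inner_neg_right,
        neg_neg, a1]
    have a3 : inner ℝ w w' = (0 : ℝ) := by
      rw [hw'2, real_inner_comm, inner_cross0_self_left]
    have hon' := hon w w' (hmapt w hw) (hmapt w' hw') a1 a2 a3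
    have hmem' := hmemV w w' hw hw'
    have hVfin : Module.finrank ℝ V = 4 := by
      apply le_antisymm
      · have g1 := Submodule.finrank_add_le_finrank_add_finrank (Submodule.span ℝ {e₁, e₂})
          (Y.map lift)
        have g2 := finrank_span_le_card (R := ℝ) ({e₁, e₂} : Set (Euc 7))
        have g3 : ({e₁, e₂} : Set (Euc 7)).toFinset.card ≤ 2 := by
          simpa using Finset.card_le_two
        rw [← hVdef] at g1
        omega
      · have hli : LinearIndependent ℝ (fun i => (⟨_, hmem' i⟩ : V)) :=
          (orthonormal_iff_ite.2 (fun i j => by exact hon' i j) :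
            Orthonormal ℝ (fun i => (⟨_, hmem' i⟩ : V))).linearIndependent
        simpa using hli.fintype_card_le_finrank
    have key := abs_alternating_orthonormal hVfin
      (starPhi0.toAlternatingMap.compLinearMap V.subtype)
      (u := fun i => ⟨u i, hu i⟩) (v := fun i => ⟨_, hmem' i⟩)
      (orthonormal_iff_ite.2 fun i j => by exact hu1 i j)
      (orthonormal_iff_ite.2 fun i j => by exact hon' i j)
    change |starPhi0 u| = |starPhi0 ![e₁, e₂, w, w']| at key
    rw [key, starPhi0_pair (hmapt w hw), ← hw'2, a2]
    norm_num

/-! ### Smooth families of alternating forms -/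

section Smooth

variable {X E E' F : Type*} [NormedAddCommGroup X] [NormedSpace ℝ X]
  [NormedAddCommGroup E] [NormedSpace ℝ E] [NormedAddCommGroup E'] [NormedSpace ℝ E']
  [NormedAddCommGroup F] [NormedSpace ℝ F] {k : ℕ} {s : Set X} {x : X} {r : ℕ∞ω}

/-- Currying as a continuous linear map. -/
def curryLeftL (E F : Type*) [NormedAddCommGroup E] [NormedSpace ℝ E]
    [NormedAddCommGroup F] [NormedSpace ℝ F] (k : ℕ) :
    (E [⋀^Fin (k + 1)]→L[ℝ] F) →L[ℝ] (E →L[ℝ] E [⋀^Fin k]→L[ℝ] F) :=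
  (ContinuousAlternatingMap.curryLeftLI (𝕜 := ℝ) (E := E) (F := F)
    (n := k)).toContinuousLinearMap

lemma contDiff_curryLeft : ContDiff ℝ r
    (fun f : E [⋀^Fin (k + 1)]→L[ℝ] F => f.curryLeft) :=
  ContinuousLinearMap.contDiff (𝕜 := ℝ) (E := E [⋀^Fin (k + 1)]→L[ℝ] F)
    (F := E →L[ℝ] E [⋀^Fin k]→L[ℝ] F) (curryLeftL E F k)

/-- Induction on the degree: currying the first argument is continuous linear, which reduces the
claim to evaluation of linear maps. -/
lemma contDiffWithinAt_alternating_apply {f : X → E [⋀^Fin k]→L[ℝ] F} {v : Fin k → X → E}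
    (hf : ContDiffWithinAt ℝ r f s x) (hv : ∀ i, ContDiffWithinAt ℝ r (v i) s x) :
    ContDiffWithinAt ℝ r (fun y => f y (fun i => v i y)) s x := by
  induction k with
  | zero =>
    have h : (fun y => f y (fun i => v i y)) = fun y =>
        (ContinuousAlternatingMap.constOfIsEmptyLIE ℝ E F (Fin 0)).symm (f y) := by
      ext y
      rw [Subsingleton.elim (fun i => v i y) 0]
      rfl
    rw [h]
    exact (ContinuousAlternatingMap.constOfIsEmptyLIE ℝ E F
      (Fin 0)).symm.toContinuousLinearEquiv.contDiff.comp_contDiffWithinAt hf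
  | succ k ih =>
    have h1 : ContDiffWithinAt ℝ r (fun y => (f y).curryLeft (v 0 y)) s x :=
      (contDiff_curryLeft.comp_contDiffWithinAt hf).clm_apply (hv 0)
    refine (ih h1 fun i => hv i.succ).congr_of_eventuallyEq ?_ ?_
    · refine Filter.Eventually.of_forall fun y => ?_
      beta_reduce
      rw [ContinuousAlternatingMap.curryLeft_apply_apply]
      congr 1
      ext i
      refine Fin.cases ?_ (fun i => ?_) i <;> rfl
    · rw [ContinuousAlternatingMap.curryLeft_apply_apply]
      congr 1
      ext i
      refine Fin.cases ?_ (fun i => ?_) i <;> rfl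

variable [FiniteDimensional ℝ F]

/-- Evaluation on tuples of basis vectors is an injective linear map into a finite product of copies
of F, and any linear left inverse recovers the form from its values. -/
lemma contDiffWithinAt_alternating_iff [FiniteDimensional ℝ E] {f : X → E [⋀^Fin k]→L[ℝ] F} :
    ContDiffWithinAt ℝ r f s x ↔ ∀ v, ContDiffWithinAt ℝ r (fun y => f y v) s x := by
  refine ⟨fun h v => contDiffWithinAt_alternating_apply h fun i => contDiffWithinAt_const,
    fun h => ?_⟩
  let b := Module.finBasis ℝ E
  let T : (E [⋀^Fin k]→L[ℝ] F) →ₗ[ℝ] ((Fin k → Fin (Module.finrank ℝ E)) → F) :=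
    { toFun := fun f i => f fun j => b (i j)
      map_add' := fun _ _ => rfl
      map_smul' := fun _ _ => rfl }
  have hT : LinearMap.ker T = ⊥ := by
    rw [LinearMap.ker_eq_bot]
    intro f g hfg
    have : f.toMultilinearMap = g.toMultilinearMap :=
      Module.Basis.ext_multilinear (fun _ => b) fun i => congrFun hfg i
    ext v
    exact congrArg (fun t => t v) this
  obtain ⟨S, hS⟩ := T.exists_leftInverse_of_injective hT
  have h1 : f = fun y => LinearMap.toContinuousLinearMap S (fun i => f y fun j => b (i j)) := by
    ext1 y
    exact (congrArg (fun t => t (f y)) hS).symm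
  rw [h1]
  exact (LinearMap.toContinuousLinearMap S).contDiff.comp_contDiffWithinAt
    (contDiffWithinAt_pi.2 fun i => h _)

lemma contDiffWithinAt_alternating_compContinuousLinearMap [FiniteDimensional ℝ E']
    {f : X → E [⋀^Fin k]→L[ℝ] F} {g : X → E' →L[ℝ] E} (hf : ContDiffWithinAt ℝ r f s x)
    (hg : ContDiffWithinAt ℝ r g s x) :
    ContDiffWithinAt ℝ r (fun y => (f y).compContinuousLinearMap (g y)) s x :=
  contDiffWithinAt_alternating_iff.2 fun w =>
    contDiffWithinAt_alternating_apply (v := fun i y => g y (w i)) hf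
      fun _ => hg.clm_apply contDiffWithinAt_const

end Smooth

/-! ### Cartan's formula for forms invariant under a flow -/

/-- If `a` is a closed form near `y` which is invariant under a local flow `θ` with velocity `Y`,
then the contraction of `a` with `Y` is closed at `y`. -/
lemma extDeriv_contraction_eq_zero {E F : Type*} [NormedAddCommGroup E] [NormedSpace ℝ E]
    [NormedAddCommGroup F] [NormedSpace ℝ F] {k : ℕ} {a : E → E [⋀^Fin (k + 1)]→L[ℝ] F}
    {θ : ℝ × E → E} {y : E} (ha : DifferentiableAt ℝ a y) (hda : extDeriv a y = 0)
    (hθ : ContDiffAt ℝ ∞ θ (0, y)) (hθ0 : ∀ᶠ z in 𝓝 y, θ (0, z) = z)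
    (hinv : ∀ᶠ s in 𝓝 (0 : ℝ), (a (θ (s, y))).compContinuousLinearMap
      ((fderiv ℝ θ (s, y)).comp (ContinuousLinearMap.inr ℝ ℝ E)) = a y) :
    extDeriv (fun z => (a z).curryLeft (fderiv ℝ θ (0, z) (1, 0))) y = 0 := by
  have hθy : θ (0, y) = y := hθ0.self_of_nhds
  have hdθ : ContDiffAt ℝ 1 (fderiv ℝ θ) (0, y) := hθ.fderiv_right (m := 1) (by norm_cast)
  -- No Lie derivative is needed: b = θ^*a is closed at (0, y) as a pullback to space-time, and the
  -- claim is read off from one component of db = 0.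
  set b : ℝ × E → (ℝ × E) [⋀^Fin (k + 1)]→L[ℝ] F := fun p =>
    (a (θ p)).compContinuousLinearMap (fderiv ℝ θ p) with hb
  have hdb : extDeriv b (0, y) = 0 := by
    rw [hb, extDeriv_pullback (r := ∞) (by rw [hθy]; exact ha) hθ
      (by simpa using (ENat.LEInfty.out : (2 : ℕ∞ω) ≤ ∞)), hθy, hda]
    ext; simp
  have hbdiff : DifferentiableAt ℝ b (0, y) := by
    refine DifferentiableAt.continuousAlternatingMapCompContinuousLinearMap ?_ ?_
    · exact DifferentiableAt.comp (0, y) (by rw [hθy]; exact ha)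
        (hθ.differentiableAt (by simp))
    · exact hdθ.differentiableAt one_ne_zero
  have hYdiff : DifferentiableAt ℝ (fun z => fderiv ℝ θ (0, z) (1, 0)) y := by
    have : DifferentiableAt ℝ (fun z : E => fderiv ℝ θ (0, z)) y :=
      DifferentiableAt.comp y (g := fderiv ℝ θ) (hdθ.differentiableAt one_ne_zero)
        ((differentiableAt_const _).prodMk differentiableAt_id)
    exact this.clm_apply (differentiableAt_const _)
  have hcdiff : DifferentiableAt ℝ (fun z => (a z).curryLeft (fderiv ℝ θ (0, z) (1, 0))) y :=
    (((contDiff_curryLeft (r := 1)).differentiable one_ne_zero (a y)).comp y ha).clm_apply hYdiff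
  ext v
  -- In db(∂ₜ, v₀, …, v_k) the term differentiating along ∂ₜ vanishes by invariance. The others are
  -- those of d(i_Y a)(v₀, …, v_k) with the index shifted by one, hence with the opposite sign.
  let w : Fin (k + 2) → ℝ × E := Fin.cons (1, 0) fun i => (0, v i)
  let c : (Fin k → E) → Fin (k + 1) → ℝ × E := fun u => Fin.cons (1, 0) fun j => (0, u j)
  have h0 := congrArg (fun t => t w) hdb
  change extDeriv b (0, y) _ = 0 at h0
  rw [extDeriv_apply hbdiff, Fin.sum_univ_succ] at h0
  -- At time zero θ is the identity in the space variable near y, so contracting b with ∂ₜ and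
  -- restricting to t = 0 gives i_Y a. This is needed for all z near y because the equality is
  -- differentiated.
  have hlin : ∀ᶠ z in 𝓝 y, ∀ w, fderiv ℝ θ (0, z) (0, w) = w := by
    have h1 : ∀ᶠ p in 𝓝 ((0 : ℝ), y), DifferentiableAt ℝ θ p :=
      ((hθ.of_le (m := 1) (by norm_cast)).eventually (by simp)).mono
        fun p hp => hp.differentiableAt one_ne_zero
    have h2 : Filter.Tendsto (fun z : E => ((0 : ℝ), z)) (𝓝 y) (𝓝 (0, y)) :=
      (Continuous.prodMk_right (0 : ℝ)).tendsto y
    filter_upwards [h2.eventually h1, hθ0.eventually_nhds] with z hz hz0 w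
    have h3 : HasFDerivAt (fun z' : E => θ (0, z'))
        ((fderiv ℝ θ (0, z)).comp (ContinuousLinearMap.inr ℝ ℝ E)) z :=
      HasFDerivAt.comp z (g := θ) hz.hasFDerivAt (hasFDerivAt_prodMk_right (0 : ℝ) z)
    have h4 : HasFDerivAt (fun z' : E => θ (0, z')) (ContinuousLinearMap.id ℝ E) z :=
      (hasFDerivAt_id z).congr_of_eventuallyEq hz0
    exact congrArg (fun L => L w) (h3.unique h4)
  have happ : ∀ w, DifferentiableAt ℝ (fun p => b p w) (0, y) := fun w =>
    hbdiff.continuousAlternatingMap_apply (fun i => differentiableAt_const (w i))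
  have hterm0 : fderiv ℝ (fun p => b p ((0 : Fin (k + 2)).removeNth w)) (0, y) (1, 0) = 0 := by
    have hw : (0 : Fin (k + 2)).removeNth w = fun i => ((0 : ℝ), v i) := by
      ext1 j
      simp [Fin.removeNth, w]
    rw [hw]
    have h1 : HasFDerivAt (fun t : ℝ => b (t, y) fun i => (0, v i)) _ (0 : ℝ) :=
      HasFDerivAt.comp (0 : ℝ) (g := fun p => b p fun i => ((0 : ℝ), v i))
        (happ _).hasFDerivAt (hasFDerivAt_prodMk_left (0 : ℝ) y)
    have h2 : HasFDerivAt (fun t : ℝ => b (t, y) fun i => (0, v i)) (0 : ℝ →L[ℝ] F) (0 : ℝ) := by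
      refine (hasFDerivAt_const (a y v) (0 : ℝ)).congr_of_eventuallyEq ?_
      filter_upwards [hinv] with t ht
      rw [← ht]
      rfl
    exact congrArg (fun L => L 1) (h1.unique h2)
  have hterm : ∀ i : Fin (k + 1), fderiv ℝ (fun p => b p (i.succ.removeNth w)) (0, y) (0, v i) =
      fderiv ℝ (fun z => (a z).curryLeft (fderiv ℝ θ (0, z) (1, 0)) (i.removeNth v)) y (v i) := by
    intro i
    have hrem : i.succ.removeNth w = c (i.removeNth v) := by
      ext1 j
      refine Fin.cases ?_ (fun j => ?_) j
      · simp [Fin.removeNth, w, c]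
      · simp [Fin.removeNth, w, c]
    rw [hrem]
    have h1 : HasFDerivAt (fun z => b (0, z) (c (i.removeNth v))) _ y :=
      HasFDerivAt.comp y (g := fun p => b p (c (i.removeNth v)))
        (happ _).hasFDerivAt (hasFDerivAt_prodMk_right (0 : ℝ) y)
    have h2 : (fun z => (a z).curryLeft (fderiv ℝ θ (0, z) (1, 0)) (i.removeNth v)) =ᶠ[𝓝 y]
        fun z => b (0, z) (c (i.removeNth v)) := by
      filter_upwards [hlin, hθ0] with z hz hz0
      rw [ContinuousAlternatingMap.curryLeft_apply_apply, hb]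
      simp only [ContinuousAlternatingMap.compContinuousLinearMap_apply, hz0]
      congr 1
      ext1 j
      refine Fin.cases ?_ (fun j => ?_) j
      · rfl
      · exact (hz _).symm
    rw [h2.fderiv_eq, h1.fderiv]
    rfl
  simp only [show w 0 = (1, 0) from rfl,
    show ∀ i : Fin (k + 1), w i.succ = (0, v i) from fun _ => rfl,
    hterm0, hterm, smul_zero, zero_add] at h0
  rw [extDeriv_apply hcdiff]
  simp only [Fin.val_succ, pow_succ, mul_neg, mul_one, neg_smul, Finset.sum_neg_distrib,
    neg_eq_zero] at h0
  simpa using h0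

/-! ### Derivatives with values in the model spaces -/

section Derivative

variable {E₁ H₁ E₂ H₂ E₃ H₃ : Type*} [NormedAddCommGroup E₁] [NormedSpace ℝ E₁]
  [TopologicalSpace H₁] {I₁ : ModelWithCorners ℝ E₁ H₁} [NormedAddCommGroup E₂] [NormedSpace ℝ E₂]
  [TopologicalSpace H₂] {I₂ : ModelWithCorners ℝ E₂ H₂} [NormedAddCommGroup E₃] [NormedSpace ℝ E₃]
  [TopologicalSpace H₃] {I₃ : ModelWithCorners ℝ E₃ H₃}
  {M₁ : Type*} [TopologicalSpace M₁] [ChartedSpace H₁ M₁]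
  {M₂ : Type*} [TopologicalSpace M₂] [ChartedSpace H₂ M₂]
  {M₃ : Type*} [TopologicalSpace M₃] [ChartedSpace H₃ M₃]

/-- The derivative of a map of manifolds, as a map of the model spaces. -/
def md (I₁ : ModelWithCorners ℝ E₁ H₁) (I₂ : ModelWithCorners ℝ E₂ H₂) (f : M₁ → M₂) (x : M₁) :
    E₁ →L[ℝ] E₂ :=
  mfderiv I₁ I₂ f x

lemma md_comp {g : M₂ → M₃} {f : M₁ → M₂} (x : M₁) (hg : MDifferentiableAt I₂ I₃ g (f x))
    (hf : MDifferentiableAt I₁ I₂ f x) :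
    md I₁ I₃ (g ∘ f) x = (md I₂ I₃ g (f x)).comp (md I₁ I₂ f x) :=
  mfderiv_comp x hg hf

lemma md_congr {f g : M₁ → M₂} {x : M₁} (h : f =ᶠ[𝓝 x] g) : md I₁ I₂ f x = md I₁ I₂ g x :=
  h.mfderiv_eq

lemma md_const (c : M₂) (x : M₁) : md I₁ I₂ (fun _ => c) x = 0 :=
  mfderiv_const

lemma md_id (x : M₁) : md I₁ I₁ (fun y => y) x = ContinuousLinearMap.id ℝ E₁ :=
  mfderiv_id

lemma md_eq_fderiv (f : E₁ → E₂) (x : E₁) : md 𝓘(ℝ, E₁) 𝓘(ℝ, E₂) f x = fderiv ℝ f x :=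
  mfderiv_eq_fderiv

end Derivative

/-! ### Pulling back forms by smooth parametrizations -/

section PullRep

variable {n : ℕ} {M : Type*} [TopologicalSpace M] [ChartedSpace (Euc n) M]
  {F : Type*} [NormedAddCommGroup F] [NormedSpace ℝ F]
  {X : Type*} [NormedAddCommGroup X] [NormedSpace ℝ X] {k : ℕ}

/-- The value of a form, as a form on the model space. -/
def formAt (α : DForm n M k F) (m : M) : Euc n [⋀^Fin k]→L[ℝ] F := α m

lemma formAt_formPullback {m : ℕ} {P : Type*} [TopologicalSpace P] [ChartedSpace (Euc m) P]
    (α : DForm n M k F) (h : P → M) (p : P) : formAt (formPullback m n h α) p =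
      (formAt α (h p)).compContinuousLinearMap (md (𝓡 m) (𝓡 n) h p) := rfl

lemma formAt_interiorProduct (X : ∀ m : M, TangentSpace (𝓡 n) m) (α : DForm n M (k + 1) F)
    (m : M) : formAt (interiorProduct X α) m = (formAt α m).curryLeft (X m : Euc n) := rfl

/-- The pullback of a form by a map from a normed space. -/
def pullRep (α : DForm n M k F) (g : X → M) : X → X [⋀^Fin k]→L[ℝ] F := fun y =>
  (formAt α (g y)).compContinuousLinearMap (md 𝓘(ℝ, X) (𝓡 n) g y)

lemma chartRep_eq_pullRep (α : DForm n M k F) (x : M) :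
    chartRep α x = pullRep α (extChartAt (𝓡 n) x).symm := rfl

lemma pullRep_formPullback {m : ℕ} {P : Type*} [TopologicalSpace P] [ChartedSpace (Euc m) P]
    (α : DForm n M k F) {g : X → P} {h : P → M} {y : X}
    (hg : MDifferentiableAt 𝓘(ℝ, X) (𝓡 m) g y) (hh : MDifferentiableAt (𝓡 m) (𝓡 n) h (g y)) :
    pullRep (formPullback m n h α) g y = pullRep α (h ∘ g) y := by
  rw [pullRep, pullRep, md_comp y hh hg]
  rfl

lemma IsSmoothForm.contDiffAt_chartRep {α : DForm n M k F} (hα : IsSmoothForm α) {x : M}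
    {y : Euc n} (hy : y ∈ (extChartAt (𝓡 n) x).target) : ContDiffAt ℝ ∞ (chartRep α x) y :=
  (hα x).contDiffAt ((isOpen_extChartAt_target x).mem_nhds hy)

/-- A form is closed if its pullbacks by charts are. -/
lemma isClosedForm_of_chartRep {α : DForm n M k F}
    (h : ∀ (x : M), ∀ y ∈ (extChartAt (𝓡 n) x).target,
      ContDiffAt ℝ ∞ (chartRep α x) y ∧ extDeriv (chartRep α x) y = 0) : IsClosedForm α :=
  ⟨fun x y hy => (h x y hy).1.contDiffWithinAt, fun x y hy => (h x y hy).2⟩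

variable [IsManifold (𝓡 n) ∞ M]

lemma mdifferentiableAt_extChartAt_symm {x : M} {y : Euc n}
    (hy : y ∈ (extChartAt (𝓡 n) x).target) :
    MDifferentiableAt 𝓘(ℝ, Euc n) (𝓡 n) (extChartAt (𝓡 n) x).symm y :=
  ((contMDiffOn_extChartAt_symm (n := ∞) x).contMDiffAt
    ((isOpen_extChartAt_target x).mem_nhds hy)).mdifferentiableAt (by simp)

/-- Near y the map g factors as χ⁻¹ ∘ (χ ∘ g), and the chain rule applies. Being an equality near y,
it transfers smoothness and closedness from the charts to any smooth parametrization. -/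
lemma pullRep_eventuallyEq (α : DForm n M k F) {g : X → M} {y : X}
    (hg : ContMDiffAt 𝓘(ℝ, X) (𝓡 n) ∞ g y) (x : M) (hx : g y ∈ (extChartAt (𝓡 n) x).source) :
    pullRep α g =ᶠ[𝓝 y] fun z => (chartRep α x (extChartAt (𝓡 n) x (g z))).compContinuousLinearMap
      (fderiv ℝ (extChartAt (𝓡 n) x ∘ g) z) := by
  have h1 : ∀ᶠ z in 𝓝 y, MDifferentiableAt 𝓘(ℝ, X) (𝓡 n) g z :=
    ((contMDiffAt_iff_contMDiffAt_nhds (by simp)).1 (hg.of_le (m := 1) (by norm_cast))).mono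
      fun z hz => hz.mdifferentiableAt one_ne_zero
  have h2 : ∀ᶠ z in 𝓝 y, g z ∈ (extChartAt (𝓡 n) x).source :=
    hg.continuousAt.eventually ((isOpen_extChartAt_source x).mem_nhds hx)
  filter_upwards [h1, h2.eventually_nhds] with z hz1 hz2'
  have hz2 := hz2'.self_of_nhds
  set χ := extChartAt (𝓡 n) x
  have hχ : MDifferentiableAt (𝓡 n) 𝓘(ℝ, Euc n) χ (g z) :=
    mdifferentiableAt_extChartAt (by rwa [extChartAt_source] at hz2)
  have hd : MDifferentiableAt 𝓘(ℝ, X) 𝓘(ℝ, Euc n) (χ ∘ g) z := hχ.comp z hz1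
  have h5 : χ.symm (χ (g z)) = g z := χ.left_inv hz2
  have h3 : md 𝓘(ℝ, X) (𝓡 n) g z =
      (md 𝓘(ℝ, Euc n) (𝓡 n) χ.symm (χ (g z))).comp (fderiv ℝ (χ ∘ g) z) := by
    rw [← md_eq_fderiv]
    have h4 := md_comp (I₁ := 𝓘(ℝ, X)) (I₂ := 𝓘(ℝ, Euc n)) (I₃ := 𝓡 n) z
      (g := χ.symm) (f := χ ∘ g) (mdifferentiableAt_extChartAt_symm (χ.map_source hz2)) hd
    rw [Function.comp_apply] at h4
    rw [← h4]
    apply md_congr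
    filter_upwards [hz2'] with w hw
    exact (χ.left_inv hw).symm
  rw [chartRep_eq_pullRep, pullRep, pullRep, h3, h5]
  rfl

lemma contDiffAt_extChartAt_comp {g : X → M} {y : X}
    (hg : ContMDiffAt 𝓘(ℝ, X) (𝓡 n) ∞ g y) (x : M) (hx : g y ∈ (extChartAt (𝓡 n) x).source) :
    ContDiffAt ℝ ∞ (extChartAt (𝓡 n) x ∘ g) y := by
  rw [← contMDiffAt_iff_contDiffAt]
  exact (contMDiffAt_extChartAt' (by rwa [extChartAt_source] at hx)).comp y hg

lemma IsSmoothForm.contDiffAt_pullRep [FiniteDimensional ℝ X] [FiniteDimensional ℝ F]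
    {α : DForm n M k F} (hα : IsSmoothForm α) {g : X → M} {y : X}
    (hg : ContMDiffAt 𝓘(ℝ, X) (𝓡 n) ∞ g y) : ContDiffAt ℝ ∞ (pullRep α g) y := by
  have hx := mem_extChartAt_source (I := 𝓡 n) (g y)
  have hc := contDiffAt_extChartAt_comp hg (g y) hx
  refine ContDiffAt.congr_of_eventuallyEq ?_ (pullRep_eventuallyEq α hg (g y) hx)
  have h1 : ContDiffAt ℝ ∞ (chartRep α (g y) ∘ (extChartAt (𝓡 n) (g y) ∘ g)) y :=
    (hα.contDiffAt_chartRep (mem_extChartAt_target (g y))).comp y hc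
  exact contDiffWithinAt_alternating_compContinuousLinearMap h1
    (hc.fderiv_right (m := ∞) (by simp))

lemma IsClosedForm.extDeriv_pullRep {α : DForm n M k F} (hα : IsClosedForm α) {g : X → M} {y : X}
    (hg : ContMDiffAt 𝓘(ℝ, X) (𝓡 n) ∞ g y) : extDeriv (pullRep α g) y = 0 := by
  have hx := mem_extChartAt_source (I := 𝓡 n) (g y)
  have hc := contDiffAt_extChartAt_comp hg (g y) hx
  have hy := mem_extChartAt_target (I := 𝓡 n) (g y)
  rw [(pullRep_eventuallyEq α hg (g y) hx).extDeriv_eq]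
  have h := extDeriv_pullback (f := extChartAt (𝓡 n) (g y) ∘ g) (r := ∞)
    ((hα.1.contDiffAt_chartRep hy).differentiableAt (by simp)) hc
    (by simpa using (ENat.LEInfty.out : (2 : ℕ∞ω) ≤ ∞))
  refine h.trans ?_
  rw [Function.comp_apply, hα.2 _ _ hy]
  ext; simp

end PullRep

/-! ### Smooth torus actions -/

/-- The exponential map of the torus. -/
def expT (v : ℝ × ℝ) : Torus := (Circle.exp v.1, Circle.exp v.2)

lemma expT_zero : expT 0 = 1 := by simp [expT, Prod.ext_iff]

lemma expT_add (v w : ℝ × ℝ) : expT (v + w) = expT v * expT w := by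
  simp [expT, Circle.exp_add]

lemma expT_surjective (t : Torus) : ∃ v, expT v = t :=
  ⟨(Complex.arg t.1, Complex.arg t.2), by simp [expT, Circle.exp_arg]⟩

lemma contMDiff_expT : ContMDiff 𝓘(ℝ, ℝ × ℝ) torusModel ∞ expT :=
  (contMDiff_circleExp.comp (contMDiff_iff_contDiff.2 contDiff_fst)).prodMk
    (contMDiff_circleExp.comp (contMDiff_iff_contDiff.2 contDiff_snd))

/-- If a component a of v is nonzero, take s > 0 with s < ε and |s a| ≤ 1. Then s a is a multiple of
2π smaller than 2π, hence zero, a contradiction. -/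
lemma eq_zero_of_expT_smul {v : ℝ × ℝ} {ε : ℝ} (hε : 0 < ε)
    (h : ∀ s : ℝ, |s| < ε → expT (s • v) = 1) : v = 0 := by
  have key : ∀ a : ℝ, (∀ s : ℝ, |s| < ε → Circle.exp (s * a) = 1) → a = 0 := by
    intro a ha
    by_contra ha0
    have hpos : 0 < |a| := abs_pos.2 ha0
    set s := min (ε / 2) (1 / |a|) with hs
    have hs0 : 0 < s := lt_min (by positivity) (by positivity)
    have h1 := ha s (by rw [abs_of_pos hs0]; exact (min_le_left _ _).trans_lt (by linarith))
    obtain ⟨n, hn⟩ := Circle.exp_eq_one.1 h1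
    have h2 : |s * a| ≤ 1 := by
      rw [abs_mul, abs_of_pos hs0]
      calc s * |a| ≤ 1 / |a| * |a| := by gcongr; exact min_le_right _ _
        _ = 1 := by field_simp
    have h3 : n = 0 := by
      by_contra hn0
      have h4 : (1 : ℝ) ≤ |(n : ℝ)| := by exact_mod_cast Int.one_le_abs hn0
      rw [hn, abs_mul, abs_of_pos Real.two_pi_pos] at h2
      nlinarith [Real.pi_gt_three]
    rw [h3] at hn
    simp only [Int.cast_zero, zero_mul, mul_eq_zero] at hn
    exact hn.elim hs0.ne' ha0
  have h' : ∀ s : ℝ, |s| < ε → Circle.exp (s * v.1) = 1 ∧ Circle.exp (s * v.2) = 1 :=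
    fun s hs => Prod.ext_iff.1 (h s hs)
  exact Prod.ext (key _ fun s hs => (h' s hs).1) (key _ fun s hs => (h' s hs).2)

section Action

variable {n : ℕ} {M : Type*} [TopologicalSpace M] [ChartedSpace (Euc n) M]
  [MulAction Torus M] [ContMDiffSMul torusModel (𝓡 n) ∞ Torus M]

variable (n) in
lemma contMDiff_torus_smul :
    ContMDiff (torusModel.prod (𝓡 n)) (𝓡 n) ∞ (fun p : Torus × M => p.1 • p.2) :=
  contMDiff_smul

variable (n) in
lemma contMDiff_expT_smul :
    ContMDiff (𝓘(ℝ, ℝ × ℝ).prod (𝓡 n)) (𝓡 n) ∞ (fun p : (ℝ × ℝ) × M => expT p.1 • p.2) :=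
  (contMDiff_torus_smul n).comp ((contMDiff_expT.comp contMDiff_fst).prodMk contMDiff_snd)

variable (n) in
lemma contMDiff_smul_left (t : Torus) : ContMDiff (𝓡 n) (𝓡 n) ∞ (fun m : M => t • m) :=
  (contMDiff_torus_smul n).comp (contMDiff_const.prodMk contMDiff_id)

variable (n) in
lemma contMDiff_orbit (m : M) : ContMDiff 𝓘(ℝ, ℝ × ℝ) (𝓡 n) ∞ (fun v => expT v • m) :=
  (contMDiff_expT_smul n).comp (contMDiff_id.prodMk contMDiff_const)

/-- The infinitesimal action of the Lie algebra of the torus. -/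
def orbitDeriv (n : ℕ) {M : Type*} [TopologicalSpace M] [ChartedSpace (Euc n) M]
    [MulAction Torus M] (m : M) : ℝ × ℝ →L[ℝ] Euc n :=
  md 𝓘(ℝ, ℝ × ℝ) (𝓡 n) (fun v => expT v • m) 0

/-- Near v the orbit map of m is the orbit map of expT v • m, translated by -v. -/
lemma md_orbit (m : M) (v : ℝ × ℝ) :
    md 𝓘(ℝ, ℝ × ℝ) (𝓡 n) (fun w => expT w • m) v = orbitDeriv n (expT v • m) := by
  have h1 : (fun w => expT w • m) = (fun w => expT w • expT v • m) ∘ (fun w => w - v) := by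
    ext1 w
    simp only [Function.comp_apply, ← mul_smul, ← expT_add, sub_add_cancel]
  have h2 : HasFDerivAt (fun w : ℝ × ℝ => w - v) (ContinuousLinearMap.id ℝ _) v :=
    (hasFDerivAt_id v).sub_const v
  rw [h1, md_comp (I₂ := 𝓘(ℝ, ℝ × ℝ)) v, md_eq_fderiv, h2.fderiv, sub_self,
    ContinuousLinearMap.comp_id, orbitDeriv]
  · exact (contMDiff_orbit n _).mdifferentiable (by simp) _
  · exact h2.differentiableAt.mdifferentiableAt

/-- Commutativity of the torus makes its adjoint action trivial, so the generating fields are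
invariant. -/
lemma md_smul_orbitDeriv (t : Torus) (m : M) (v : ℝ × ℝ) :
    md (𝓡 n) (𝓡 n) (fun m : M => t • m) m (orbitDeriv n m v) = orbitDeriv n (t • m) v := by
  have h1 : (fun w => expT w • t • m) = (fun m : M => t • m) ∘ (fun w => expT w • m) := by
    ext1 w
    simp only [Function.comp_apply, ← mul_smul, mul_comm]
  have h2 : expT 0 • m = m := by rw [expT_zero, one_smul]
  have h3 := md_comp (I₁ := 𝓘(ℝ, ℝ × ℝ)) (I₂ := 𝓡 n) (I₃ := 𝓡 n) (f := fun w => expT w • m)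
    (g := fun m : M => t • m) 0
    ((contMDiff_smul_left n t).mdifferentiable (by simp) _)
    ((contMDiff_orbit n m).mdifferentiable (by simp) _)
  rw [← h1, h2] at h3
  rw [orbitDeriv, orbitDeriv, h3]
  rfl

lemma md_curve_eq (m : M) (v : ℝ × ℝ) (s : ℝ) :
    md 𝓘(ℝ, ℝ) (𝓡 n) (fun s : ℝ => expT (s • v) • m) s 1 = orbitDeriv n (expT (s • v) • m) v := by
  have h2 : HasFDerivAt (fun s : ℝ => s • v) ((ContinuousLinearMap.id ℝ ℝ).smulRight v) s :=
    (hasFDerivAt_id s).smul_const v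
  have h1 : (fun s : ℝ => expT (s • v) • m) = (fun w => expT w • m) ∘ (fun s : ℝ => s • v) := rfl
  rw [h1, md_comp (I₂ := 𝓘(ℝ, ℝ × ℝ)) s, md_eq_fderiv, h2.fderiv, md_orbit]
  · simp
  · exact (contMDiff_orbit n _).mdifferentiable (by simp) _
  · exact h2.differentiableAt.mdifferentiableAt

/-- A function whose derivative vanishes along the orbits is invariant. -/
lemma invariant_of_md_orbitDeriv {f : M → ℝ} (hf : MDifferentiable (𝓡 n) 𝓘(ℝ, ℝ) f)
    (h : ∀ m v, md (𝓡 n) 𝓘(ℝ, ℝ) f m (orbitDeriv n m v) = 0) (t : Torus) (m : M) :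
    f (t • m) = f m := by
  obtain ⟨v, rfl⟩ := expT_surjective t
  have hd : MDifferentiable 𝓘(ℝ, ℝ × ℝ) (𝓡 n) (fun w => expT w • m) :=
    (contMDiff_orbit n m).mdifferentiable (by simp)
  have hg : MDifferentiable 𝓘(ℝ, ℝ × ℝ) 𝓘(ℝ, ℝ) (f ∘ fun w => expT w • m) := hf.comp hd
  have h0 : ∀ w, fderiv ℝ (f ∘ fun w => expT w • m) w = 0 := fun w => by
    rw [← md_eq_fderiv, md_comp (I₂ := 𝓡 n) w (hf _) (hd _), md_orbit]
    exact ContinuousLinearMap.ext fun u => h _ u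
  have := is_const_of_fderiv_eq_zero (𝕜 := ℝ) hg.differentiable h0 v 0
  simpa [expT_zero] using this

variable [IsManifold (𝓡 n) ∞ M]

/-- The infinitesimal action is injective at points with trivial stabilizer. -/
lemma orbitDeriv_injective {m : M} (hm : ∀ t : Torus, t • m = m → t = 1) :
    Function.Injective (orbitDeriv n m) := by
  rw [injective_iff_map_eq_zero]
  intro v hv
  set χ := extChartAt (𝓡 n) m
  let γ : ℝ → M := fun s => expT (s • v) • m
  have hγs : ContMDiff 𝓘(ℝ, ℝ) (𝓡 n) ∞ γ :=
    (contMDiff_orbit n m).comp (contMDiff_iff_contDiff.2 (contDiff_id.smul contDiff_const))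
  -- The velocity at time s is the image under the action of the velocity at time 0, so it vanishes
  -- throughout. The curve is then constant while it stays in the chart, and expT (s • v) fixes m
  -- for all small s.
  have hγd : ∀ s, md 𝓘(ℝ, ℝ) (𝓡 n) γ s = 0 := fun s => by
    ext1
    rw [md_curve_eq, ← md_smul_orbitDeriv, hv]
    simp
  have h0 : γ 0 = m := by simp [γ, expT_zero]
  have hU : γ ⁻¹' χ.source ∈ 𝓝 (0 : ℝ) :=
    hγs.continuous.continuousAt.preimage_mem_nhds
      ((isOpen_extChartAt_source m).mem_nhds (by rw [h0]; exact mem_extChartAt_source m))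
  obtain ⟨ε, hε, hball⟩ := Metric.mem_nhds_iff.1 hU
  refine eq_zero_of_expT_smul hε fun s hs => hm _ ?_
  have hd : ∀ s ∈ Metric.ball (0 : ℝ) ε, MDifferentiableAt 𝓘(ℝ, ℝ) 𝓘(ℝ, Euc n) (χ ∘ γ) s ∧
      fderiv ℝ (χ ∘ γ) s = 0 := fun s hs => by
    have h1 : MDifferentiableAt (𝓡 n) 𝓘(ℝ, Euc n) χ (γ s) :=
      mdifferentiableAt_extChartAt (by simpa [χ] using hball hs)
    have h2 := hγs.mdifferentiable (by simp) s
    refine ⟨h1.comp s h2, ?_⟩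
    rw [← md_eq_fderiv, md_comp (I₂ := 𝓡 n) s h1 h2, hγd, ContinuousLinearMap.comp_zero]
  have hc := Metric.isOpen_ball.is_const_of_fderiv_eq_zero (𝕜 := ℝ) (f := χ ∘ γ)
    (convex_ball (0 : ℝ) ε).isPreconnected
    (fun s hs => (hd s hs).1.differentiableAt.differentiableWithinAt) (fun s hs => (hd s hs).2)
    (Metric.mem_ball_self hε) (y := s) (by simpa using hs)
  have := χ.injOn (hball (Metric.mem_ball_self hε)) (hball (by simpa using hs)) hc
  rw [h0] at this
  exact this.symm

end Action

/-! ### Closedness of contractions of invariant forms -/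

section Cartan

variable {M : Type*} [TopologicalSpace M] [ChartedSpace (Euc 7) M] [MulAction Torus M]
  [ContMDiffSMul torusModel (𝓡 7) ∞ Torus M] {k : ℕ}

lemma flowField_eq (v : ℝ × ℝ) (m : M) : (flowField v m : Euc 7) = orbitDeriv 7 m v := by
  have h := md_curve_eq (n := 7) m v 0
  rw [zero_smul, expT_zero, one_smul] at h
  rw [← h]
  change md 𝓘(ℝ, ℝ) (𝓡 7) _ 0 1 = _
  congr 2
  ext1 s
  simp [expT, mul_comm]

lemma formAt_interiorProduct_flowField (v : ℝ × ℝ) (α : DForm 7 M (k + 1) ℝ) (m : M) :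
    formAt (interiorProduct (flowField v) α) m = (formAt α m).curryLeft (orbitDeriv 7 m v) := by
  rw [formAt_interiorProduct]
  exact congrArg _ (flowField_eq v m)

lemma PreservesForm.formAt_smul {α : DForm 7 M k ℝ} (hα : PreservesForm α) (t : Torus) (m : M) :
    (formAt α (t • m)).compContinuousLinearMap (md (𝓡 7) (𝓡 7) (fun m : M => t • m) m) =
      formAt α m := by
  rw [← formAt_formPullback, hα t]

/-- Both the form and the generating field are invariant. This allows a second contraction. -/
lemma PreservesForm.interiorProduct {α : DForm 7 M (k + 1) ℝ} (hα : PreservesForm α)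
    (v : ℝ × ℝ) : PreservesForm (interiorProduct (flowField v) α) := by
  intro t
  ext1 m
  change formAt (formPullback 7 7 (fun m : M => t • m) _) m =
    formAt (G2Reduction.interiorProduct (flowField v) α) m
  rw [formAt_formPullback, formAt_interiorProduct_flowField, formAt_interiorProduct_flowField,
    ← hα.formAt_smul t m, ContinuousAlternatingMap.curryLeft_compContinuousLinearMap,
    md_smul_orbitDeriv]

variable [IsManifold (𝓡 7) ∞ M]

/-- In a chart the one-parameter group of v becomes a local flow θ to which
`extDeriv_contraction_eq_zero` applies; smoothness follows from the same formula for the contraction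
in terms of the velocity of θ. -/
lemma IsClosedForm.interiorProduct {α : DForm 7 M (k + 1) ℝ} (hα : IsClosedForm α)
    (hT : PreservesForm α) (v : ℝ × ℝ) : IsClosedForm (interiorProduct (flowField v) α) := by
  apply isClosedForm_of_chartRep
  intro x y hy
  set χ := extChartAt (𝓡 7) x with hχ
  let A : ℝ × Euc 7 → M := fun p => expT (p.1 • v) • χ.symm p.2
  let θ : ℝ × Euc 7 → Euc 7 := χ ∘ A
  have hA : ∀ s, ∀ z ∈ χ.target, ContMDiffAt 𝓘(ℝ, ℝ × Euc 7) (𝓡 7) ∞ A (s, z) := by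
    intro s z hz
    have h1 : ContMDiffAt 𝓘(ℝ, Euc 7) (𝓡 7) ∞ χ.symm z :=
      (contMDiffOn_extChartAt_symm x).contMDiffAt ((isOpen_extChartAt_target x).mem_nhds hz)
    refine ContMDiffAt.comp (s, z) (g := fun p : (ℝ × ℝ) × M => expT p.1 • p.2)
      (I' := 𝓘(ℝ, ℝ × ℝ).prod (𝓡 7)) (f := fun p : ℝ × Euc 7 => (p.1 • v, χ.symm p.2))
      ((contMDiff_expT_smul 7).contMDiffAt) (ContMDiffAt.prodMk ?_ ?_)
    · exact (contMDiff_iff_contDiff.2 (contDiff_fst.smul contDiff_const)).contMDiffAt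
    · exact ContMDiffAt.comp (s, z) (g := χ.symm) (f := Prod.snd) h1
        (contMDiff_iff_contDiff.2 contDiff_snd).contMDiffAt
  have hθ : ∀ s, ∀ z ∈ χ.target, A (s, z) ∈ χ.source → ContDiffAt ℝ ∞ θ (s, z) :=
    fun s z hz hs => contDiffAt_extChartAt_comp (hA s z hz) x hs
  have hA0 : ∀ z, A (0, z) = χ.symm z := fun z => by simp [A, expT_zero]
  have hAs0 : ∀ z ∈ χ.target, A (0, z) ∈ χ.source := fun z hz => by
    rw [hA0]; exact χ.map_target hz
  have hnear : ∀ z ∈ χ.target, ∀ᶠ z' in 𝓝 z, z' ∈ χ.target := fun z hz =>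
    (isOpen_extChartAt_target x).mem_nhds hz
  -- the velocity of the flow in the chart
  have hY : ∀ z ∈ χ.target, md 𝓘(ℝ, Euc 7) (𝓡 7) χ.symm z (fderiv ℝ θ (0, z) (1, 0)) =
      orbitDeriv 7 (χ.symm z) v := by
    intro z hz
    have hχd : MDifferentiableAt (𝓡 7) 𝓘(ℝ, Euc 7) χ (χ.symm z) :=
      mdifferentiableAt_extChartAt (by simpa [χ] using χ.map_target hz)
    have hχs := mdifferentiableAt_extChartAt_symm hz
    have h1 : fderiv ℝ θ (0, z) = (md (𝓡 7) 𝓘(ℝ, Euc 7) χ (χ.symm z)).comp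
        (md 𝓘(ℝ, ℝ × Euc 7) (𝓡 7) A (0, z)) := by
      rw [← md_eq_fderiv, md_comp (I₂ := 𝓡 7) _ (by rw [hA0]; exact hχd)
        ((hA 0 z hz).mdifferentiableAt (by simp)), hA0]
    have h2 : md 𝓘(ℝ, ℝ × Euc 7) (𝓡 7) A (0, z) (1, 0) = orbitDeriv 7 (χ.symm z) v := by
      have h3 := md_curve_eq (n := 7) (χ.symm z) v 0
      rw [zero_smul, expT_zero, one_smul] at h3
      have hpd : HasFDerivAt (fun s : ℝ => (s, z)) (ContinuousLinearMap.inl ℝ ℝ (Euc 7)) 0 :=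
        hasFDerivAt_prodMk_left 0 z
      have h4 := md_comp (I₁ := 𝓘(ℝ, ℝ)) (I₂ := 𝓘(ℝ, ℝ × Euc 7)) (I₃ := 𝓡 7) (g := A)
        (f := fun s : ℝ => (s, z)) 0
        ((hA 0 z hz).mdifferentiableAt (by simp)) hpd.differentiableAt.mdifferentiableAt
      rw [md_eq_fderiv, hpd.fderiv] at h4
      rw [← h3]
      exact (congrArg (fun L => L 1) h4).symm
    have h5 : (md 𝓘(ℝ, Euc 7) (𝓡 7) χ.symm z).comp (md (𝓡 7) 𝓘(ℝ, Euc 7) χ (χ.symm z)) =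
        ContinuousLinearMap.id ℝ (Euc 7) := by
      have hz' : χ (χ.symm z) = z := χ.right_inv hz
      have h6 := md_comp (I₁ := 𝓡 7) (I₂ := 𝓘(ℝ, Euc 7)) (I₃ := 𝓡 7) (g := χ.symm) (f := χ)
        (χ.symm z) (by rw [hz']; exact hχs) hχd
      rw [hz'] at h6
      rw [← h6, ← md_id (I₁ := 𝓡 7) (χ.symm z)]
      apply md_congr
      filter_upwards [(isOpen_extChartAt_source x).mem_nhds (χ.map_target hz)] with w hw
      exact χ.left_inv hw
    rw [h1, ContinuousLinearMap.comp_apply, h2]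
    exact congrArg (fun L => L (orbitDeriv 7 (χ.symm z) v)) h5
  have hrep : ∀ z ∈ χ.target, chartRep (G2Reduction.interiorProduct (flowField v) α) x z =
      (chartRep α x z).curryLeft (fderiv ℝ θ (0, z) (1, 0)) := by
    intro z hz
    rw [chartRep_eq_pullRep, chartRep_eq_pullRep, pullRep, pullRep,
      formAt_interiorProduct_flowField,
      ContinuousAlternatingMap.curryLeft_compContinuousLinearMap, hY z hz]
  have hrepe : chartRep (G2Reduction.interiorProduct (flowField v) α) x =ᶠ[𝓝 y]
      fun z => (chartRep α x z).curryLeft (fderiv ℝ θ (0, z) (1, 0)) := by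
    filter_upwards [hnear y hy] with z hz using hrep z hz
  have hθy := hθ 0 y hy (hAs0 y hy)
  have hαy := hα.1.contDiffAt_chartRep hy
  constructor
  · refine ContDiffAt.congr_of_eventuallyEq ?_ hrepe
    have h1 : ContDiffAt ℝ ∞ (fun z => fderiv ℝ θ (0, z)) y :=
      ContDiffAt.comp y (g := fderiv ℝ θ) (hθy.fderiv_right (m := ∞) (by simp))
        (contDiffAt_const.prodMk contDiffAt_id)
    exact (contDiff_curryLeft.contDiffAt.comp y hαy).clm_apply (h1.clm_apply contDiffAt_const)
  · rw [hrepe.extDeriv_eq]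
    refine extDeriv_contraction_eq_zero (hαy.differentiableAt (by simp)) (hα.2 x y hy) hθy ?_ ?_
    · filter_upwards [hnear y hy] with z hz
      simp only [θ, Function.comp_apply, hA0]
      exact χ.right_inv hz
    · have hcont : ContinuousAt (fun s : ℝ => A (s, y)) 0 :=
        ContinuousAt.comp (f := fun s : ℝ => (s, y)) (hA 0 y hy).continuousAt
          (Continuous.prodMk_left y).continuousAt
      filter_upwards [hcont.preimage_mem_nhds
        ((isOpen_extChartAt_source x).mem_nhds (hAs0 y hy))] with s hs
      have hg : ContMDiffAt 𝓘(ℝ, Euc 7) (𝓡 7) ∞ (fun z => A (s, z)) y :=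
        ContMDiffAt.comp y (g := A) (f := fun z => (s, z)) (hA s y hy)
          (contMDiff_iff_contDiff.2 (contDiff_const.prodMk contDiff_id)).contMDiffAt
      have h1 := (pullRep_eventuallyEq α hg x hs).self_of_nhds
      -- For fixed s the map A is the inverse chart followed by an element of the torus, and α is
      -- invariant under the latter.
      have h2 : pullRep α (fun z => A (s, z)) y = chartRep α x y := by
        have h3 := pullRep_formPullback α (g := χ.symm) (h := fun m : M => expT (s • v) • m)
          (y := y) (mdifferentiableAt_extChartAt_symm hy)
          ((contMDiff_smul_left 7 _).mdifferentiable (by simp) _)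
        rw [hT] at h3
        exact h3.symm
      rw [h2] at h1
      rw [h1]
      have h4 : fderiv ℝ (χ ∘ fun z => A (s, z)) y =
          (fderiv ℝ θ (s, y)).comp (ContinuousLinearMap.inr ℝ ℝ (Euc 7)) :=
        (HasFDerivAt.comp y (g := θ) ((hθ s y hy hs).differentiableAt (by simp)).hasFDerivAt
          (hasFDerivAt_prodMk_right s y)).fderiv
      change _ = (chartRep α x (χ (A (s, y)))).compContinuousLinearMap
        (fderiv ℝ (χ ∘ fun z => A (s, z)) y)
      rw [h4]
      rfl

end Cartan

/-! ### The inverse function theorem and straightening charts -/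

section InverseFunction

variable {E F : Type*} [NormedAddCommGroup E] [NormedSpace ℝ E] [FiniteDimensional ℝ E]
  [NormedAddCommGroup F] [NormedSpace ℝ F] [FiniteDimensional ℝ F]

lemma exists_equiv_of_bijective (A : E →L[ℝ] F) (hA : Function.Bijective A) :
    ∃ B : E ≃L[ℝ] F, (B : E →L[ℝ] F) = A :=
  ⟨(LinearEquiv.ofBijective A.toLinearMap hA).toContinuousLinearEquiv, by ext; rfl⟩

/-- The smooth inverse function theorem on an open set. -/
lemma exists_openPartialHomeomorph {f : E → F} {U : Set E} (hU : IsOpen U)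
    (hf : ContDiffOn ℝ ∞ f U) {x : E} (hx : x ∈ U) (hd : Function.Bijective (fderiv ℝ f x)) :
    ∃ e : OpenPartialHomeomorph E F, x ∈ e.source ∧ e.source ⊆ U ∧ ⇑e = f ∧
      ContDiffOn ℝ ∞ e.symm e.target := by
  have : CompleteSpace E := FiniteDimensional.complete ℝ E
  have hfx : ∀ y ∈ U, ContDiffAt ℝ ∞ f y := fun y hy => hf.contDiffAt (hU.mem_nhds hy)
  have hfd : ∀ y ∈ U, HasFDerivAt f (fderiv ℝ f y) y := fun y hy =>
    ((hfx y hy).differentiableAt (by simp)).hasFDerivAt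
  obtain ⟨B, hB⟩ := exists_equiv_of_bijective _ hd
  have hBx : HasFDerivAt f (B : E →L[ℝ] F) x := hB ▸ hfd x hx
  -- Restricting to points with invertible derivative makes the inverse smooth on its whole domain
  -- and not only at the image of x.
  let V := U ∩ fderiv ℝ f ⁻¹' range ((↑) : (E ≃L[ℝ] F) → E →L[ℝ] F)
  have hV : IsOpen V := (hf.continuousOn_fderiv_of_isOpen hU (by simp)).isOpen_inter_preimage hU
    ContinuousLinearEquiv.isOpen
  let e₀ := (hfx x hx).toOpenPartialHomeomorph f hBx (by simp)
  refine ⟨e₀.restrOpen V hV, ?_, ?_, rfl, fun y hy => ?_⟩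
  · exact ⟨(hfx x hx).mem_toOpenPartialHomeomorph_source hBx (by simp), hx, B, hB⟩
  · exact fun y hy => hy.2.1
  · have hy' := (e₀.restrOpen V hV).map_target hy
    obtain ⟨hyU, C, hC⟩ := hy'.2
    refine (OpenPartialHomeomorph.contDiffAt_symm (f₀' := C) _ hy ?_ (hfx _ hyU)).contDiffWithinAt
    rw [hC]
    exact hfd _ hyU

end InverseFunction

section Straighten

variable {n : ℕ} {M : Type*} [TopologicalSpace M] [ChartedSpace (Euc n) M] [IsManifold (𝓡 n) ∞ M]
  {G K : Type*} [NormedAddCommGroup G] [NormedSpace ℝ G] [FiniteDimensional ℝ G]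
  [NormedAddCommGroup K] [NormedSpace ℝ K] [FiniteDimensional ℝ K]

lemma md_chart_bijective {e : OpenPartialHomeomorph M (Euc n)}
    (he : e ∈ IsManifold.maximalAtlas (𝓡 n) ∞ M) {x : M} (hx : x ∈ e.source) :
    (md (𝓡 n) 𝓘(ℝ, Euc n) e x).comp (md 𝓘(ℝ, Euc n) (𝓡 n) e.symm (e x)) =
        ContinuousLinearMap.id ℝ _ ∧
      (md 𝓘(ℝ, Euc n) (𝓡 n) e.symm (e x)).comp (md (𝓡 n) 𝓘(ℝ, Euc n) e x) =
        ContinuousLinearMap.id ℝ _ := by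
  have h1 : MDifferentiableAt (𝓡 n) 𝓘(ℝ, Euc n) e x :=
    (contMDiffAt_of_mem_maximalAtlas he hx).mdifferentiableAt (by simp)
  have h2 : MDifferentiableAt 𝓘(ℝ, Euc n) (𝓡 n) e.symm (e x) :=
    (contMDiffAt_symm_of_mem_maximalAtlas he (e.map_source hx)).mdifferentiableAt (by simp)
  have hl : e.symm (e x) = x := e.left_inv hx
  constructor
  · have h3 := md_comp (I₁ := 𝓘(ℝ, Euc n)) (I₂ := 𝓡 n) (I₃ := 𝓘(ℝ, Euc n)) (g := e) (f := e.symm)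
      (e x) (by rwa [hl]) h2
    rw [hl] at h3
    rw [← h3, ← md_id (I₁ := 𝓘(ℝ, Euc n)) (e x)]
    apply md_congr
    filter_upwards [e.open_target.mem_nhds (e.map_source hx)] with z hz using e.right_inv hz
  · rw [← md_comp x h2 h1, ← md_id (I₁ := 𝓡 n) x]
    apply md_congr
    filter_upwards [e.open_source.mem_nhds hx] with z hz using e.left_inv hz

/-- A map with surjective derivative is, near a point, a linear projection in a suitable chart. -/
lemma exists_straightening_chart (eqv : (K × G) ≃L[ℝ] Euc n) {h : M → G} {U : Set M}
    (hU : IsOpen U) (hh : ContMDiffOn (𝓡 n) 𝓘(ℝ, G) ∞ h U) {p : M} (hp : p ∈ U)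
    (hs : Function.Surjective (md (𝓡 n) 𝓘(ℝ, G) h p)) :
    ∃ e ∈ IsManifold.maximalAtlas (𝓡 n) ∞ M, p ∈ e.source ∧ e.source ⊆ U ∧
      ∀ x ∈ e.source, (eqv.symm (e x)).2 = h x := by
  set χ := chartAt (Euc n) p with hχ
  have hχa : χ ∈ IsManifold.maximalAtlas (𝓡 n) ∞ M := IsManifold.chart_mem_maximalAtlas p
  have hpχ : p ∈ χ.source := mem_chart_source _ p
  have hl : χ.symm (χ p) = p := χ.left_inv hpχ
  let V := χ.target ∩ χ.symm ⁻¹' U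
  have hV : IsOpen V := χ.isOpen_inter_preimage_symm hU
  have hpV : χ p ∈ V := ⟨χ.map_source hpχ, by rwa [mem_preimage, hl]⟩
  have hg : ContDiffOn ℝ ∞ (h ∘ χ.symm) V := by
    rw [← contMDiffOn_iff_contDiffOn]
    exact hh.comp ((contMDiffOn_symm_of_mem_maximalAtlas hχa).mono inter_subset_left)
      fun x hx => hx.2
  set D := fderiv ℝ (h ∘ χ.symm) (χ p) with hD
  have hgd : HasFDerivAt (h ∘ χ.symm) D (χ p) :=
    ((hg.contDiffAt (hV.mem_nhds hpV)).differentiableAt (by simp)).hasFDerivAt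
  have hDs : Function.Surjective D := by
    have h1 : D = (md (𝓡 n) 𝓘(ℝ, G) h p).comp (md 𝓘(ℝ, Euc n) (𝓡 n) χ.symm (χ p)) := by
      rw [hD, ← md_eq_fderiv, md_comp (I₂ := 𝓡 n) (χ p), hl]
      · rw [hl]
        exact (hh.contMDiffAt (hU.mem_nhds hp)).mdifferentiableAt (by simp)
      · exact (contMDiffAt_symm_of_mem_maximalAtlas hχa (χ.map_source hpχ)).mdifferentiableAt
          (by simp)
    intro y
    obtain ⟨v, rfl⟩ := hs y
    refine ⟨md (𝓡 n) 𝓘(ℝ, Euc n) χ p v, ?_⟩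
    have h2 := congrArg (fun L => L v) (md_chart_bijective hχa hpχ).2
    rw [h1]
    exact congrArg (md (𝓡 n) 𝓘(ℝ, G) h p) h2
  have hfr : Module.finrank ℝ D.ker = Module.finrank ℝ K := by
    have h1 := LinearMap.finrank_range_add_finrank_ker D.toLinearMap
    have h2 : LinearMap.range D.toLinearMap = ⊤ := LinearMap.range_eq_top.2 hDs
    have h3 := eqv.toLinearEquiv.finrank_eq
    rw [h2, finrank_top, ← h3, Module.finrank_prod] at h1
    change Module.finrank ℝ (LinearMap.ker D.toLinearMap) = _
    omega
  -- The missing coordinates are supplied by the orthogonal projection to the kernel of D, so that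
  -- (P, D) is bijective.
  let κ : D.ker ≃L[ℝ] K := ContinuousLinearEquiv.ofFinrankEq hfr
  let P : Euc n →L[ℝ] K := (κ : D.ker →L[ℝ] K).comp (D.ker.orthogonalProjectionOnto)
  let f : Euc n → Euc n := fun y => eqv (P y, (h ∘ χ.symm) y)
  have hf : ContDiffOn ℝ ∞ f V := eqv.contDiff.comp_contDiffOn (P.contDiff.contDiffOn.prodMk hg)
  have hfd : HasFDerivAt f ((eqv : (K × G) →L[ℝ] Euc n).comp (P.prod D)) (χ p) :=
    (eqv : (K × G) →L[ℝ] Euc n).hasFDerivAt.comp (χ p) (P.hasFDerivAt.prodMk hgd)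
  have hbij : Function.Bijective (fderiv ℝ f (χ p)) := by
    rw [hfd.fderiv]
    have hinj : Function.Injective ((eqv : (K × G) →L[ℝ] Euc n).comp (P.prod D)) := by
      rw [injective_iff_map_eq_zero]
      intro v hv
      have h1 : P v = 0 ∧ D v = 0 := by
        have : (P v, D v) = (0 : K × G) := eqv.injective (hv.trans (map_zero eqv).symm)
        exact Prod.ext_iff.1 this
      have h2 : D.ker.orthogonalProjectionOnto v = 0 := κ.injective (h1.1.trans (map_zero κ).symm)
      have h3 := Submodule.orthogonalProjectionOnto_mem_subspace_eq_self
        (K := D.ker) ⟨v, h1.2⟩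
      rw [h2] at h3
      exact (congrArg Subtype.val h3).symm
    exact ⟨hinj, LinearMap.surjective_of_injective (f := ((eqv : (K × G) →L[ℝ] Euc n).comp
      (P.prod D)).toLinearMap) hinj⟩
  obtain ⟨e, hpe, heV, hef, hes⟩ := exists_openPartialHomeomorph hV hf hpV hbij
  refine ⟨χ.trans e, ?_, ?_, ?_, ?_⟩
  · rw [IsManifold.mem_maximalAtlas_iff_contMDiffOn]
    constructor
    · rw [OpenPartialHomeomorph.coe_trans, hef]
      exact (contMDiffOn_iff_contDiffOn.2 hf).comp
        ((contMDiffOn_of_mem_maximalAtlas hχa).mono (by simp)) fun x hx =>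
          heV (by simpa using hx.2)
    · rw [OpenPartialHomeomorph.coe_trans_symm]
      exact (contMDiffOn_symm_of_mem_maximalAtlas hχa).comp
        ((contMDiffOn_iff_contDiffOn.2 hes).mono (by simp))
        fun x hx => hx.2
  · simp [hpe, hpχ]
  · intro x hx
    have := heV (by simpa using hx.2 : χ x ∈ e.source)
    have h1 := this.2
    rwa [mem_preimage, χ.left_inv hx.1] at h1
  · intro x hx
    simp only [OpenPartialHomeomorph.coe_trans, hef, Function.comp_apply, f,
      ContinuousLinearEquiv.symm_apply_apply]
    rw [χ.left_inv hx.1]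

/-- A smooth map with surjective derivatives is a submersion. -/
lemma isSubmersion_of_md_surjective {k : ℕ} {Q : Type*} [TopologicalSpace Q]
    [ChartedSpace (Euc k) Q] [IsManifold (𝓡 k) ∞ Q] (eqv : (K × Euc k) ≃L[ℝ] Euc n) {f : M → Q}
    (hf : ContMDiff (𝓡 n) (𝓡 k) ∞ f) (hs : ∀ x, Function.Surjective (md (𝓡 n) (𝓡 k) f x)) :
    IsSubmersion (𝓡 n) (𝓡 k) ∞ f := by
  refine IsSubmersionOfComplement.isSubmersion (F := K) fun x => ?_
  set χ := chartAt (Euc k) (f x)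
  have hχa : χ ∈ IsManifold.maximalAtlas (𝓡 k) ∞ Q := IsManifold.chart_mem_maximalAtlas (f x)
  have hx : f x ∈ χ.source := mem_chart_source _ (f x)
  have hU : IsOpen (f ⁻¹' χ.source) := χ.open_source.preimage hf.continuous
  have h1 : ContMDiffOn (𝓡 n) 𝓘(ℝ, Euc k) ∞ (χ ∘ f) (f ⁻¹' χ.source) :=
    (contMDiffOn_of_mem_maximalAtlas hχa).comp hf.contMDiffOn fun y hy => hy
  have h2 : Function.Surjective (md (𝓡 n) 𝓘(ℝ, Euc k) (χ ∘ f) x) := by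
    rw [md_comp (I₂ := 𝓡 k) x ((contMDiffAt_of_mem_maximalAtlas hχa hx).mdifferentiableAt (by simp))
      (hf.mdifferentiable (by simp) x)]
    refine Function.Surjective.comp (g := md (𝓡 k) 𝓘(ℝ, Euc k) χ (f x)) (fun y => ?_) (hs x)
    exact ⟨_, congrArg (fun L => L y) (md_chart_bijective hχa hx).1⟩
  obtain ⟨e, hea, hxe, heU, he⟩ := exists_straightening_chart eqv hU h1 (p := x) hx h2
  refine IsSubmersionAtOfComplement.mk_of_charts
    (eqv.symm.trans (ContinuousLinearEquiv.prodComm ℝ K (Euc k))) e χ hxe hx hea hχa heU ?_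
  intro y hy
  have hy' : y ∈ e.target := by simpa using hy
  have := he (e.symm y) (e.map_target hy')
  rw [e.right_inv hy'] at this
  simpa using this.symm

end Straighten

/-! ### Embedded submanifolds and local defining functions -/

section Submanifold

variable {n k : ℕ} {M : Type*} [TopologicalSpace M] [ChartedSpace (Euc n) M]
  {G : Type*} [NormedAddCommGroup G] [NormedSpace ℝ G]

/-- Near `p`, the set `L` is the zero set of a smooth function with surjective derivative. -/
def HasDefiningFunctionAt (n : ℕ) {M : Type*} [TopologicalSpace M] [ChartedSpace (Euc n) M]
    (G : Type*) [NormedAddCommGroup G] [NormedSpace ℝ G] (L : Set M) (p : M) : Prop :=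
  ∃ (h : M → G) (U : Set M), IsOpen U ∧ p ∈ U ∧ ContMDiffOn (𝓡 n) 𝓘(ℝ, G) ∞ h U ∧
    Function.Surjective (md (𝓡 n) 𝓘(ℝ, G) h p) ∧ ∀ x ∈ U, x ∈ L ↔ h x = 0

open Classical in
/-- The chart of a subset `L` obtained from a chart in which `L` is the slice `y.2 = 0`. -/
def sliceChart (eqv : (Euc k × G) ≃L[ℝ] Euc n) {L : Set M} (p : L)
    (e : OpenPartialHomeomorph M (Euc n)) (he : ∀ x ∈ e.source, x ∈ L ↔ (eqv.symm (e x)).2 = 0) :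
    OpenPartialHomeomorph L (Euc k) where
  toFun x := (eqv.symm (e x)).1
  invFun y := if h : e.symm (eqv (y, 0)) ∈ L then ⟨e.symm (eqv (y, 0)), h⟩ else p
  source := Subtype.val ⁻¹' e.source
  target := (fun y => eqv (y, (0 : G))) ⁻¹' e.target
  map_source' x hx := by
    have h1 : eqv ((eqv.symm (e x)).1, 0) = e x := by
      rw [← (he x hx).1 x.2, Prod.mk.eta, eqv.apply_symm_apply]
    rw [mem_preimage, h1]
    exact e.map_source hx
  map_target' y hy := by
    have h1 : e.symm (eqv (y, 0)) ∈ L := by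
      rw [he _ (e.map_target hy), e.right_inv hy, eqv.symm_apply_apply]
    rw [dif_pos h1]
    exact e.map_target hy
  left_inv' x hx := by
    have h1 : e.symm (eqv ((eqv.symm (e x)).1, 0)) = x := by
      rw [← (he x hx).1 x.2, Prod.mk.eta, eqv.apply_symm_apply, e.left_inv hx]
    rw [dif_pos (by rw [h1]; exact x.2)]
    exact Subtype.ext h1
  right_inv' y hy := by
    have h1 : e.symm (eqv (y, 0)) ∈ L := by
      rw [he _ (e.map_target hy), e.right_inv hy, eqv.symm_apply_apply]
    rw [dif_pos h1, e.right_inv hy, eqv.symm_apply_apply]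
  open_source := e.open_source.preimage continuous_subtype_val
  open_target := e.open_target.preimage (by fun_prop)
  continuousOn_toFun := by
    have h1 : ContinuousOn (fun x : L => e x) (Subtype.val ⁻¹' e.source) :=
      e.continuousOn.comp continuous_subtype_val.continuousOn fun x hx => hx
    exact (continuous_fst.comp eqv.symm.continuous).comp_continuousOn h1
  continuousOn_invFun := by
    rw [Topology.IsInducing.subtypeVal.continuousOn_iff]
    have h1 : ContinuousOn (fun y => e.symm (eqv (y, (0 : G))))
        ((fun y => eqv (y, (0 : G))) ⁻¹' e.target) :=
      e.continuousOn_symm.comp (by fun_prop : Continuous fun y => eqv (y, (0 : G))).continuousOn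
        fun y hy => hy
    refine h1.congr fun y hy => ?_
    have h1 : e.symm (eqv (y, 0)) ∈ L := by
      rw [he _ (e.map_target hy), e.right_inv hy, eqv.symm_apply_apply]
    simp only [Function.comp_apply]
    rw [dif_pos h1]

lemma val_sliceChart_symm (eqv : (Euc k × G) ≃L[ℝ] Euc n) {L : Set M} (p : L)
    (e : OpenPartialHomeomorph M (Euc n)) (he : ∀ x ∈ e.source, x ∈ L ↔ (eqv.symm (e x)).2 = 0)
    {y : Euc k} (hy : y ∈ (sliceChart eqv p e he).target) :
    ((sliceChart eqv p e he).symm y : M) = e.symm (eqv (y, 0)) := by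
  have h1 : e.symm (eqv (y, 0)) ∈ L := by
    rw [he _ (e.map_target hy), e.right_inv hy, eqv.symm_apply_apply]
  exact congrArg Subtype.val (dif_pos h1)

variable [IsManifold (𝓡 n) ∞ M]

/-- A subset with local defining functions is an embedded submanifold. -/
lemma exists_isSmoothEmbedding_of_hasDefiningFunctionAt [FiniteDimensional ℝ G]
    (hfr : k + Module.finrank ℝ G = n) {L : Set M}
    (hL : ∀ p ∈ L, HasDefiningFunctionAt n G L p) :
    ∃ (_ : ChartedSpace (Euc k) L) (_ : IsManifold (𝓡 k) ∞ L),
      IsSmoothEmbedding (𝓡 k) (𝓡 n) ∞ (Subtype.val : L → M) := by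
  let eqv : (Euc k × G) ≃L[ℝ] Euc n := ContinuousLinearEquiv.ofFinrankEq (by simp [hfr])
  have key : ∀ p : L, ∃ e ∈ IsManifold.maximalAtlas (𝓡 n) ∞ M, p.1 ∈ e.source ∧
      ∀ x ∈ e.source, x ∈ L ↔ (eqv.symm (e x)).2 = 0 := by
    intro p
    obtain ⟨h, U, hU, hpU, hh, hs, hz⟩ := hL p p.2
    obtain ⟨e, hea, hpe, heU, he⟩ := exists_straightening_chart eqv hU hh hpU hs
    exact ⟨e, hea, hpe, fun x hx => by rw [hz x (heU hx), he x hx]⟩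
  choose e hea hpe he using key
  let chart : L → OpenPartialHomeomorph L (Euc k) := fun p => sliceChart eqv p (e p) (he p)
  let cs : ChartedSpace (Euc k) L :=
    { atlas := range chart
      chartAt := chart
      mem_chart_source := hpe
      chart_mem_atlas := fun p => mem_range_self p }
  have hman : IsManifold (𝓡 k) ∞ L := by
    apply isManifold_of_contDiffOn
    rintro _ _ ⟨p, rfl⟩ ⟨q, rfl⟩
    have h1 : ContDiffOn ℝ ∞ (e q ∘ (e p).symm) ((e p).target ∩ (e p).symm ⁻¹' (e q).source) := by
      rw [← contMDiffOn_iff_contDiffOn]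
      exact (contMDiffOn_of_mem_maximalAtlas (hea q)).comp
        ((contMDiffOn_symm_of_mem_maximalAtlas (hea p)).mono inter_subset_left) fun x hx => hx.2
    have h2 : ContDiffOn ℝ ∞ (fun y => (eqv.symm ((e q ∘ (e p).symm) (eqv (y, (0 : G))))).1)
        ((fun y => eqv (y, (0 : G))) ⁻¹' ((e p).target ∩ (e p).symm ⁻¹' (e q).source)) :=
      (contDiff_fst.comp eqv.symm.contDiff).comp_contDiffOn (h1.comp
        (eqv.contDiff.comp (contDiff_id.prodMk contDiff_const)).contDiffOn fun y hy => hy)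
    have h3 : ((chart p).symm ≫ₕ chart q).source ⊆
        (fun y => eqv (y, (0 : G))) ⁻¹' ((e p).target ∩ (e p).symm ⁻¹' (e q).source) := by
      intro y hy
      refine ⟨hy.1, ?_⟩
      have h4 : ((chart p).symm y : M) ∈ (e q).source := hy.2
      rwa [val_sliceChart_symm eqv p (e p) (he p) hy.1] at h4
    refine (h2.mono h3).congr_mono (fun y hy => ?_) (by simp)
    have hy1 : y ∈ ((chart p).symm ≫ₕ chart q).source := by simpa using hy
    change (eqv.symm (e q ((chart p).symm y : L))).1 = _
    rw [val_sliceChart_symm eqv p (e p) (he p) hy1.1]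
    rfl
  refine ⟨cs, hman, ?_, Topology.IsEmbedding.subtypeVal⟩
  refine IsImmersionOfComplement.isImmersion (F := G) fun p => ?_
  refine IsImmersionAtOfComplement.mk_of_charts eqv (chart p) (e p) (hpe p) (hpe p)
    (IsManifold.chart_mem_maximalAtlas p) (hea p) (fun x hx => hx) ?_
  intro y hy
  have hy' : y ∈ (chart p).target := by simpa using hy
  have := val_sliceChart_symm eqv p (e p) (he p) hy'
  simp only [OpenPartialHomeomorph.extend, Function.comp_apply]
  change e p ((chart p).symm y : L) = _
  rw [this, (e p).right_inv hy']

/-- The slices of an immersion. -/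
lemma IsImmersion.exists_slice {P : Type*} [TopologicalSpace P] [ChartedSpace (Euc k) P]
    {ι : P → M} (hι : IsImmersion (𝓡 k) (𝓡 n) ∞ ι) (p : P) :
    ∃ (G : Type) (_ : NormedAddCommGroup G) (_ : NormedSpace ℝ G) (eqv : (Euc k × G) ≃L[ℝ] Euc n)
      (d : OpenPartialHomeomorph P (Euc k)) (e : OpenPartialHomeomorph M (Euc n)),
      d ∈ IsManifold.maximalAtlas (𝓡 k) ∞ P ∧ e ∈ IsManifold.maximalAtlas (𝓡 n) ∞ M ∧
      p ∈ d.source ∧ ι p ∈ e.source ∧ ∀ x ∈ d.source, ι x ∈ e.source ∧ e (ι x) = eqv (d x, 0) := by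
  have h := hι.isImmersionOfComplement_complement p
  refine ⟨hι.complement, inferInstance, inferInstance, h.equiv, h.domChart, h.codChart,
    h.domChart_mem_maximalAtlas, h.codChart_mem_maximalAtlas, h.mem_domChart_source,
    h.mem_codChart_source, fun x hx => ⟨h.source_subset_preimage_source hx, ?_⟩⟩
  have hd : h.domChart x ∈ (h.domChart.extend (𝓡 k)).target := by
    simpa using h.domChart.map_source hx
  have := h.writtenInCharts hd
  simpa [h.domChart.left_inv hx] using this

/-- An immersion has a smooth local left inverse. -/
lemma IsImmersion.exists_leftInverse {P : Type*} [TopologicalSpace P] [ChartedSpace (Euc k) P]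
    {ι : P → M} (hι : IsImmersion (𝓡 k) (𝓡 n) ∞ ι) (p : P) :
    ∃ (r : M → P) (U : Set M) (V : Set P), IsOpen U ∧ IsOpen V ∧ ι p ∈ U ∧ p ∈ V ∧
      ContMDiffOn (𝓡 n) (𝓡 k) ∞ r U ∧ ∀ x ∈ V, ι x ∈ U ∧ r (ι x) = x := by
  obtain ⟨G, _, _, eqv, d, e, hd, he, hp, hιp, h⟩ := IsImmersion.exists_slice hι p
  have h1 : ContMDiffOn (𝓡 n) 𝓘(ℝ, Euc k) ∞ (fun x => (eqv.symm (e x)).1) e.source :=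
    (contMDiff_iff_contDiff.2 (contDiff_fst.comp eqv.symm.contDiff)).comp_contMDiffOn
      (contMDiffOn_of_mem_maximalAtlas he)
  refine ⟨d.symm ∘ fun x => (eqv.symm (e x)).1,
    e.source ∩ (fun x => (eqv.symm (e x)).1) ⁻¹' d.target, d.source,
    h1.continuousOn.isOpen_inter_preimage e.open_source d.open_target, d.open_source,
    ⟨hιp, ?_⟩, hp, (contMDiffOn_symm_of_mem_maximalAtlas hd).comp (h1.mono inter_subset_left)
      fun x hx => hx.2, fun x hx => ⟨⟨(h x hx).1, ?_⟩, ?_⟩⟩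
  · rw [mem_preimage, (h p hp).2, eqv.symm_apply_apply]
    exact d.map_source hp
  · rw [mem_preimage, (h x hx).2, eqv.symm_apply_apply]
    exact d.map_source hx
  · rw [Function.comp_apply, (h x hx).2, eqv.symm_apply_apply]
    exact d.left_inv hx

lemma IsImmersion.md_injective {P : Type*} [TopologicalSpace P] [ChartedSpace (Euc k) P]
    [IsManifold (𝓡 k) ∞ P]
    {ι : P → M} (hι : IsImmersion (𝓡 k) (𝓡 n) ∞ ι) (p : P) :
    Function.Injective (md (𝓡 k) (𝓡 n) ι p) := by
  obtain ⟨r, U, V, hU, hV, hpU, hpV, hr, h⟩ := IsImmersion.exists_leftInverse hι p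
  have h1 := md_comp (I₁ := 𝓡 k) (I₂ := 𝓡 n) (I₃ := 𝓡 k) p
    ((hr.contMDiffAt (hU.mem_nhds hpU)).mdifferentiableAt (by simp))
    (hι.contMDiff.mdifferentiable (by simp) p)
  have h2 : md (𝓡 k) (𝓡 k) (r ∘ ι) p = ContinuousLinearMap.id ℝ _ := by
    rw [← md_id (I₁ := 𝓡 k) p]
    apply md_congr
    filter_upwards [hV.mem_nhds hpV] with x hx using (h x hx).2
  rw [h2] at h1
  intro v w hvw
  have h3 := congrArg (fun L => L v) h1
  have h4 := congrArg (fun L => L w) h1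
  simp only [ContinuousLinearMap.comp_apply, ContinuousLinearMap.id_apply] at h3 h4
  rw [h3, h4, hvw]

/-- An embedded submanifold has local defining functions. -/
lemma IsSmoothEmbedding.hasDefiningFunctionAt {S : Set M} [ChartedSpace (Euc k) S]
    [IsManifold (𝓡 k) ∞ S] (hS : IsSmoothEmbedding (𝓡 k) (𝓡 n) ∞ (Subtype.val : S → M)) (s : S) :
    ∃ l, k + l = n ∧ HasDefiningFunctionAt n (Euc l) S s := by
  obtain ⟨G, _, _, eqv, d, e, hd, he, hp, hιp, h⟩ := IsImmersion.exists_slice hS.isImmersion s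
  have : FiniteDimensional ℝ (Euc k × G) :=
    FiniteDimensional.of_injective eqv.toLinearMap eqv.injective
  have : FiniteDimensional ℝ G :=
    FiniteDimensional.of_surjective (LinearMap.snd ℝ (Euc k) G) LinearMap.snd_surjective
  let γ : G ≃L[ℝ] Euc (Module.finrank ℝ G) := ContinuousLinearEquiv.ofFinrankEq (by simp)
  have hfr := eqv.toLinearEquiv.finrank_eq
  rw [Module.finrank_prod, finrank_euclideanSpace_fin, finrank_euclideanSpace_fin] at hfr
  refine ⟨Module.finrank ℝ G, hfr, ?_⟩
  -- S carries the subspace topology, so the chart domain is S ∩ W with W open in M; shrinking to W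
  -- excludes other sheets of S.
  obtain ⟨W, hW, hWd⟩ := isOpen_induced_iff.1 d.open_source
  have h1 : ContMDiffOn (𝓡 n) 𝓘(ℝ, Euc k) ∞ (fun x => (eqv.symm (e x)).1) e.source :=
    (contMDiff_iff_contDiff.2 (contDiff_fst.comp eqv.symm.contDiff)).comp_contMDiffOn
      (contMDiffOn_of_mem_maximalAtlas he)
  let L : Euc n →L[ℝ] Euc (Module.finrank ℝ G) := (γ : G →L[ℝ] _).comp
    ((ContinuousLinearMap.snd ℝ (Euc k) G).comp (eqv.symm : Euc n →L[ℝ] Euc k × G))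
  have hsW : s.1 ∈ W := by
    have : s ∈ Subtype.val ⁻¹' W := by rw [hWd]; exact hp
    exact this
  refine ⟨L ∘ e, e.source ∩ (fun x => (eqv.symm (e x)).1) ⁻¹' d.target ∩ W,
    (h1.continuousOn.isOpen_inter_preimage e.open_source d.open_target).inter hW,
    ⟨⟨hιp, ?_⟩, hsW⟩, ?_, ?_, ?_⟩
  · rw [mem_preimage, (h s hp).2, eqv.symm_apply_apply]
    exact d.map_source hp
  · exact (contMDiff_iff_contDiff.2 L.contDiff).comp_contMDiffOn
      ((contMDiffOn_of_mem_maximalAtlas he).mono fun x hx => hx.1.1)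
  · rw [md_comp (I₂ := 𝓘(ℝ, Euc n)) s.1 L.mdifferentiableAt
      ((contMDiffAt_of_mem_maximalAtlas he hιp).mdifferentiableAt (by simp)), md_eq_fderiv,
      L.fderiv]
    have hLs : Function.Surjective L := fun y => ⟨eqv (0, γ.symm y), by simp [L]⟩
    exact hLs.comp fun y => ⟨_, congrArg (fun L => L y) (md_chart_bijective he hιp).1⟩
  · rintro x ⟨⟨hxe, hxd⟩, hxW⟩
    have hL0 : (L ∘ e) x = 0 ↔ (eqv.symm (e x)).2 = 0 := by simp [L]
    rw [hL0]
    constructor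
    · intro hx
      have hxs : (⟨x, hx⟩ : S) ∈ d.source := by rw [← hWd]; exact hxW
      have := (h _ hxs).2
      simp only at this
      rw [this, eqv.symm_apply_apply]
    -- The point of S with the d-coordinates of x has the same e-coordinates as x, so it is x.
    · intro hx
      have h2 := h _ (d.map_target hxd)
      rw [d.right_inv hxd, ← hx, Prod.mk.eta, eqv.apply_symm_apply] at h2
      rw [← e.injOn h2.1 hxe h2.2]
      exact Subtype.mem _

end Submanifold

/-! ### Slices of free torus actions -/

section Slice

variable {n k : ℕ} {N : Type*} [TopologicalSpace N] [ChartedSpace (Euc n) N]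
  [IsManifold (𝓡 n) ∞ N] [MulAction Torus N] [ContMDiffSMul torusModel (𝓡 n) ∞ Torus N]

/-- A slice at `p`: a chart `e` around `p` with values in `ℝ² × ℝᵏ` in which the inverse of `e`
is `(v, y) ↦ expT v • σ y`. -/
lemma exists_slice (hk : k + 2 = n) (p : N) (hp : ∀ t : Torus, t • p = p → t = 1) :
    ∃ (e : OpenPartialHomeomorph N ((ℝ × ℝ) × Euc k)) (σ : Euc k → N) (W : Set (Euc k)),
      p ∈ e.source ∧ e p = 0 ∧ ContMDiffOn (𝓡 n) 𝓘(ℝ, (ℝ × ℝ) × Euc k) ∞ e e.source ∧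
      IsOpen W ∧ ContMDiffOn 𝓘(ℝ, Euc k) (𝓡 n) ∞ σ W ∧
      ∀ a ∈ e.target, a.2 ∈ W ∧ e.symm a = expT a.1 • σ a.2 := by
  set χ := chartAt (Euc n) p with hχ
  have hχa : χ ∈ IsManifold.maximalAtlas (𝓡 n) ∞ N := IsManifold.chart_mem_maximalAtlas p
  have hpχ : p ∈ χ.source := mem_chart_source _ p
  let D₀ : ℝ × ℝ →L[ℝ] Euc n := (md (𝓡 n) 𝓘(ℝ, Euc n) χ p).comp (orbitDeriv n p)
  have hD₀ : Function.Injective D₀ :=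
    (Function.LeftInverse.injective (g := md 𝓘(ℝ, Euc n) (𝓡 n) χ.symm (χ p))
      fun v => congrArg (fun L => L v) (md_chart_bijective hχa hpχ).2).comp
        (orbitDeriv_injective hp)
  have hfr : Module.finrank ℝ (Euc k) = Module.finrank ℝ D₀.rangeᗮ := by
    have h1 := LinearMap.finrank_range_of_inj (f := D₀.toLinearMap) hD₀
    have h2 := Submodule.finrank_add_finrank_orthogonal D₀.range
    rw [finrank_euclideanSpace_fin] at h2 ⊢
    rw [Module.finrank_prod, Module.finrank_self] at h1
    change Module.finrank ℝ D₀.range = _ at h1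
    omega
  -- σ parametrizes, in the chart, the affine subspace through p orthogonal to the orbit directions.
  -- Then (v, y) ↦ expT v • σ y has derivative D₀ v + C y at 0, which is bijective, and its local
  -- inverse is the slice chart.
  let C₀ : Euc k ≃L[ℝ] D₀.rangeᗮ := ContinuousLinearEquiv.ofFinrankEq hfr
  let C : Euc k →L[ℝ] Euc n := D₀.rangeᗮ.subtypeL.comp (C₀ : Euc k →L[ℝ] D₀.rangeᗮ)
  let c : Euc k → Euc n := fun y => χ p + C y
  have hc : ContDiff ℝ ∞ c := contDiff_const.add C.contDiff
  let σ : Euc k → N := χ.symm ∘ c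
  let W := c ⁻¹' χ.target
  have hW : IsOpen W := χ.open_target.preimage hc.continuous
  have hσ : ContMDiffOn 𝓘(ℝ, Euc k) (𝓡 n) ∞ σ W :=
    (contMDiffOn_symm_of_mem_maximalAtlas hχa).comp hc.contMDiff.contMDiffOn fun x hx => hx
  have hc0 : c 0 = χ p := by simp [c]
  have hσ0 : σ 0 = p := by simp only [σ, Function.comp_apply, hc0]; exact χ.left_inv hpχ
  have h0W : (0 : Euc k) ∈ W := by
    rw [mem_preimage, hc0]; exact χ.map_source hpχ
  let A : (ℝ × ℝ) × Euc k → N := fun a => expT a.1 • σ a.2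
  have hA : ContMDiffOn 𝓘(ℝ, (ℝ × ℝ) × Euc k) (𝓡 n) ∞ A (Prod.snd ⁻¹' W) := by
    refine ContMDiff.comp_contMDiffOn (g := fun p : (ℝ × ℝ) × N => expT p.1 • p.2)
      (I' := 𝓘(ℝ, ℝ × ℝ).prod (𝓡 n)) (f := fun a : (ℝ × ℝ) × Euc k => (a.1, σ a.2))
      (contMDiff_expT_smul n) (ContMDiffOn.prodMk ?_ ?_)
    · exact (contMDiff_iff_contDiff.2 contDiff_fst).contMDiffOn
    · exact hσ.comp (contMDiff_iff_contDiff.2 contDiff_snd).contMDiffOn fun x hx => hx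
  have hA0 : A 0 = p := by simp [A, expT_zero, hσ0]
  let O := Prod.snd ⁻¹' W ∩ A ⁻¹' χ.source
  have hO : IsOpen O :=
    hA.continuousOn.isOpen_inter_preimage (hW.preimage continuous_snd) χ.open_source
  have h0O : (0 : (ℝ × ℝ) × Euc k) ∈ O := ⟨h0W, by rw [mem_preimage, hA0]; exact hpχ⟩
  have hg : ContDiffOn ℝ ∞ (χ ∘ A) O := by
    rw [← contMDiffOn_iff_contDiffOn]
    exact (contMDiffOn_of_mem_maximalAtlas hχa).comp (hA.mono inter_subset_left) fun x hx => hx.2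
  have hgd : DifferentiableAt ℝ (χ ∘ A) 0 :=
    (hg.contDiffAt (hO.mem_nhds h0O)).differentiableAt (by simp)
  have hd1 : ∀ v, fderiv ℝ (χ ∘ A) 0 (v, 0) = D₀ v := by
    intro v
    have h1 : HasFDerivAt (fun v : ℝ × ℝ => (v, (0 : Euc k))) (ContinuousLinearMap.inl ℝ _ _) 0 :=
      hasFDerivAt_prodMk_left 0 0
    have h2 := (HasFDerivAt.comp (g := χ ∘ A) (f := fun v : ℝ × ℝ => (v, (0 : Euc k))) 0
      hgd.hasFDerivAt h1).fderiv
    have h3 : (χ ∘ A) ∘ (fun v : ℝ × ℝ => (v, (0 : Euc k))) = χ ∘ fun v => expT v • p := by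
      ext1 v; simp [A, hσ0]
    have h4 : expT 0 • p = p := by rw [expT_zero, one_smul]
    have h5 := md_comp (I₁ := 𝓘(ℝ, ℝ × ℝ)) (I₂ := 𝓡 n) (I₃ := 𝓘(ℝ, Euc n)) (g := χ)
      (f := fun v => expT v • p) 0
      (by rw [h4]; exact (contMDiffAt_of_mem_maximalAtlas hχa hpχ).mdifferentiableAt (by simp))
      ((contMDiff_orbit n p).mdifferentiable (by simp) _)
    rw [h4, md_eq_fderiv] at h5
    rw [h3, h5] at h2
    exact (congrArg (fun L => L v) h2).symm
  have hd2 : ∀ y, fderiv ℝ (χ ∘ A) 0 (0, y) = C y := by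
    intro y
    have h1 : HasFDerivAt (fun y : Euc k => ((0 : ℝ × ℝ), y)) (ContinuousLinearMap.inr ℝ _ _) 0 :=
      hasFDerivAt_prodMk_right 0 0
    have h2 := (HasFDerivAt.comp (g := χ ∘ A) (f := fun y : Euc k => ((0 : ℝ × ℝ), y)) 0
      hgd.hasFDerivAt h1).fderiv
    have h3 : (χ ∘ A) ∘ (fun y : Euc k => ((0 : ℝ × ℝ), y)) =ᶠ[𝓝 0] c := by
      filter_upwards [hW.mem_nhds h0W] with y hy
      simp only [A, σ, Function.comp_apply, expT_zero, one_smul]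
      exact χ.right_inv hy
    rw [h3.fderiv_eq] at h2
    have h4 : fderiv ℝ c 0 = C := (C.hasFDerivAt.const_add _).fderiv
    rw [h4] at h2
    exact (congrArg (fun L => L y) h2).symm
  have hinj : Function.Injective (fderiv ℝ (χ ∘ A) 0) := by
    rw [injective_iff_map_eq_zero]
    rintro ⟨v, y⟩ hvy
    have h1 : fderiv ℝ (χ ∘ A) 0 (v, y) = D₀ v + C y := by
      rw [← hd1, ← hd2, ← map_add]; simp
    rw [h1] at hvy
    have h2 : inner ℝ (D₀ v) (C y) = (0 : ℝ) :=
      (Submodule.mem_orthogonal _ _).1 (C₀ y).2 _ ⟨v, rfl⟩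
    have h3 : C y = - D₀ v := by rw [eq_neg_iff_add_eq_zero, add_comm]; exact hvy
    rw [h3, inner_neg_right, neg_eq_zero, inner_self_eq_zero] at h2
    rw [h2, neg_zero] at h3
    have h4 : v = 0 := hD₀ (h2.trans (map_zero D₀).symm)
    have h5 : y = 0 := C₀.injective (Subtype.ext (h3.trans (by simp)))
    rw [h4, h5]; rfl
  have hbij : Function.Bijective (fderiv ℝ (χ ∘ A) 0) := by
    refine ⟨hinj, (LinearMap.injective_iff_surjective_of_finrank_eq_finrank
      (f := (fderiv ℝ (χ ∘ A) 0).toLinearMap) ?_).1 hinj⟩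
    simp only [Module.finrank_prod, Module.finrank_self, finrank_euclideanSpace_fin]
    omega
  obtain ⟨e, h0e, heO, heA, hes⟩ := exists_openPartialHomeomorph hO hg h0O hbij
  have he0 : e 0 = χ p := by rw [heA, Function.comp_apply, hA0]
  refine ⟨χ.trans e.symm, σ, W, ?_, ?_, ?_, hW, hσ, ?_⟩
  · refine ⟨hpχ, ?_⟩
    change χ p ∈ e.target
    rw [← he0]
    exact e.map_source h0e
  · change e.symm (χ p) = 0
    rw [← he0]
    exact e.left_inv h0e
  · rw [OpenPartialHomeomorph.coe_trans]
    exact (contMDiffOn_iff_contDiffOn.2 hes).comp ((contMDiffOn_of_mem_maximalAtlas hχa).mono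
      (by simp)) fun x hx => hx.2
  · intro a ha
    have hae : a ∈ e.source := ha.1
    refine ⟨(heO hae).1, ?_⟩
    change χ.symm (e a) = A a
    rw [heA]
    exact χ.left_inv (heO hae).2

end Slice

/-! ### Separation of orbits by compactness of the torus -/

section Separation

variable {k : ℕ} {N : Type*} [TopologicalSpace N] [MulAction Torus N] [ContinuousSMul Torus N]

/-- Uniform separation of orbit pieces. -/
lemma exists_separating_nhds [T2Space N] {K : Set Torus} (hK : IsClosed K) {x y : N}
    (h : ∀ t ∈ K, t • x ≠ y) : ∃ U V : Set N, IsOpen U ∧ IsOpen V ∧ x ∈ U ∧ y ∈ V ∧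
      ∀ t ∈ K, ∀ x' ∈ U, ∀ y' ∈ V, t • x' ≠ y' := by
  have hc : Continuous fun a : Torus × N × N => a.1 • a.2.1 :=
    continuous_fst.smul (continuous_fst.comp continuous_snd)
  have ho : IsOpen {a : Torus × N × N | a.1 • a.2.1 ≠ a.2.2} :=
    isOpen_ne_fun hc (continuous_snd.comp continuous_snd)
  obtain ⟨u, v, -, hv, hKu, hxv, huv⟩ := generalized_tube_lemma hK.isCompact
    (isCompact_singleton (x := (x, y))) ho
    (by rintro ⟨t, z⟩ ⟨ht, rfl⟩; exact h t ht)
  obtain ⟨U, V, hU, hV, hxU, hyV, hUV⟩ := isOpen_prod_iff.1 hv x y (hxv rfl)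
  exact ⟨U, V, hU, hV, hxU, hyV, fun t ht x' hx' y' hy' =>
    huv (mk_mem_prod (hKu ht) (hUV (mk_mem_prod hx' hy')))⟩

/-- A local logarithm of the torus. -/
lemma exists_log : ∃ τ : Torus → ℝ × ℝ, ContinuousAt τ 1 ∧ τ 1 = 0 ∧ ∀ t, expT (τ t) = t := by
  refine ⟨fun t => (Complex.arg t.1, Complex.arg t.2), ?_, by simp, fun t => by
    simp [expT, Circle.exp_arg]⟩
  have h : ContinuousAt (fun z : Circle => Complex.arg z) 1 :=
    ContinuousAt.comp (Complex.continuousAt_arg (by simp)) continuous_subtype_val.continuousAt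
  exact (ContinuousAt.comp (x := (1 : Torus)) (g := fun z : Circle => Complex.arg z) h
    continuous_fst.continuousAt).prodMk (ContinuousAt.comp (x := (1 : Torus))
      (g := fun z : Circle => Complex.arg z) h continuous_snd.continuousAt)

/-- Nearby points of a slice lie on different orbits. -/
lemma exists_slice_injective [T2Space N] {p : N} (hp : ∀ t : Torus, t • p = p → t = 1)
    {e : OpenPartialHomeomorph N ((ℝ × ℝ) × Euc k)} {σ : Euc k → N} (hpe : p ∈ e.source)
    (he0 : e p = 0) (he : ∀ a ∈ e.target, e.symm a = expT a.1 • σ a.2) :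
    ∃ B : Set (Euc k), IsOpen B ∧ 0 ∈ B ∧ (∀ y ∈ B, (0, y) ∈ e.target) ∧
      ∀ y ∈ B, ∀ y' ∈ B, ∀ t : Torus, t • σ y = σ y' → y = y' := by
  have h0 : (0 : (ℝ × ℝ) × Euc k) ∈ e.target := he0 ▸ e.map_source hpe
  obtain ⟨τ, hτ, hτ1, hexp⟩ := exists_log
  obtain ⟨V₁, B₁, hV₁, hB₁, h0V₁, h0B₁, hVB⟩ := isOpen_prod_iff.1 e.open_target 0 0 h0
  obtain ⟨T₀, hT₀, hT₀o, h1T₀⟩ := mem_nhds_iff.1 (hτ.preimage_mem_nhds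
    (hV₁.mem_nhds (by rwa [hτ1])))
  -- If t is near 1, then t = expT (τ t) with τ t small, and injectivity of the slice chart decides.
  -- The remaining t form a closed, hence compact, set on which t • p ≠ p, so they are separated
  -- uniformly.
  have hsep : ∀ t ∈ T₀ᶜ, t • p ≠ p := fun t ht h => ht (hp t h ▸ h1T₀)
  obtain ⟨U, V, hU, hV, hpU, hpV, hUV⟩ := exists_separating_nhds hT₀o.isClosed_compl hsep
  have hσ0 : ∀ y ∈ B₁, e.symm (0, y) = σ y := fun y hy => by
    rw [he _ (hVB (mk_mem_prod h0V₁ hy)), expT_zero, one_smul]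
  have hi : Continuous fun y : Euc k => ((0 : ℝ × ℝ), y) := by fun_prop
  have hO : IsOpen (e.target ∩ e.symm ⁻¹' (U ∩ V)) := e.isOpen_inter_preimage_symm (hU.inter hV)
  have hp0 : e.symm (0, 0) = p := by
    have := e.left_inv hpe
    rwa [he0] at this
  refine ⟨B₁ ∩ (fun y => ((0 : ℝ × ℝ), y)) ⁻¹' (e.target ∩ e.symm ⁻¹' (U ∩ V)),
    hB₁.inter (hO.preimage hi), ⟨h0B₁, h0, ?_⟩, fun y hy => hy.2.1, ?_⟩
  · rw [mem_preimage, hp0]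
    exact ⟨hpU, hpV⟩
  · rintro y ⟨hy, -, hyU, -⟩ y' ⟨hy', -, -, hyV⟩ t ht
    rw [hσ0 y hy] at hyU
    rw [hσ0 y' hy'] at hyV
    have htT : t ∈ T₀ := by
      by_contra h
      exact hUV t h _ hyU _ hyV ht
    have ha : (τ t, y) ∈ e.target := hVB (mk_mem_prod (hT₀ htT) hy)
    have hb : ((0 : ℝ × ℝ), y') ∈ e.target := hVB (mk_mem_prod h0V₁ hy')
    have hab : e.symm (τ t, y) = e.symm (0, y') := by
      rw [he _ ha, hσ0 y' hy', hexp, ht]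
    exact (Prod.ext_iff.1 (e.symm.injOn ha hb hab)).2

end Separation

/-! ### Quotients by free torus actions -/

section QuotientTopology

variable {N : Type*} [TopologicalSpace N] [MulAction Torus N] [ContinuousSMul Torus N]
  {s : Setoid N}

lemma quotient_mk_eq_iff {N : Type*} [MulAction Torus N] {s : Setoid N}
    (hs : ∀ x y, s x y ↔ ∃ t : Torus, t • x = y) {x y : N} :
    (Quotient.mk s x = Quotient.mk s y) ↔ ∃ t : Torus, t • x = y :=
  Quotient.eq.trans (hs x y)

lemma quotient_mk_smul {N : Type*} [MulAction Torus N] {s : Setoid N}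
    (hs : ∀ x y, s x y ↔ ∃ t : Torus, t • x = y) (t : Torus) (x : N) :
    Quotient.mk s (t • x) = Quotient.mk s x :=
  ((quotient_mk_eq_iff hs).2 ⟨t, rfl⟩).symm

lemma isOpenMap_quotient_mk (hs : ∀ x y, s x y ↔ ∃ t : Torus, t • x = y) :
    IsOpenMap (Quotient.mk s) := by
  intro U hU
  change IsOpen (Quotient.mk s ⁻¹' (Quotient.mk s '' U))
  have h1 : Quotient.mk s ⁻¹' (Quotient.mk s '' U) = ⋃ t : Torus, (fun x => t • x) ⁻¹' U := by
    ext x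
    simp only [mem_preimage, mem_image, mem_iUnion]
    constructor
    · rintro ⟨y, hy, hyx⟩
      obtain ⟨t, rfl⟩ := (quotient_mk_eq_iff hs).1 hyx
      exact ⟨t⁻¹, by rwa [inv_smul_smul]⟩
    · rintro ⟨t, ht⟩
      exact ⟨_, ht, quotient_mk_smul hs t x⟩
  rw [h1]
  exact isOpen_iUnion fun t => hU.preimage (continuous_const_smul t)

/-- Compactness of the whole torus separates two distinct orbits, and the quotient map is open. -/
lemma t2Space_quotient [T2Space N] (hs : ∀ x y, s x y ↔ ∃ t : Torus, t • x = y) :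
    T2Space (Quotient s) := by
  refine ⟨fun a b => Quotient.inductionOn₂ a b fun x y hxy => ?_⟩
  have h : ∀ t ∈ (univ : Set Torus), t • x ≠ y := fun t _ ht =>
    hxy ((quotient_mk_eq_iff hs).2 ⟨t, ht⟩)
  obtain ⟨U, V, hU, hV, hx, hy, hUV⟩ := exists_separating_nhds isClosed_univ h
  refine ⟨_, _, isOpenMap_quotient_mk hs U hU, isOpenMap_quotient_mk hs V hV,
    mem_image_of_mem _ hx, mem_image_of_mem _ hy, ?_⟩
  rw [Set.disjoint_left]
  rintro _ ⟨x', hx', rfl⟩ ⟨y', hy', hyx⟩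
  obtain ⟨t, ht⟩ := (quotient_mk_eq_iff hs).1 hyx.symm
  exact hUV t (mem_univ t) x' hx' y' hy' ht

end QuotientTopology

section QuotientManifold

variable {n k : ℕ} {N : Type*} [TopologicalSpace N] [ChartedSpace (Euc n) N]
  [IsManifold (𝓡 n) ∞ N] [MulAction Torus N] [ContMDiffSMul torusModel (𝓡 n) ∞ Torus N]
  {s : Setoid N}

/-- A small slice meets each orbit at most once, so π ∘ σ is a homeomorphism onto an open set; its
inverse is the chart. The section σ is kept in the statement: transition maps and descended forms
are computed through it. -/
lemma exists_quotient_chart [T2Space N] (hk : k + 2 = n)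
    (hs : ∀ x y, s x y ↔ ∃ t : Torus, t • x = y)
    (p : N) (hp : ∀ t : Torus, t • p = p → t = 1) :
    ∃ (c : OpenPartialHomeomorph (Quotient s) (Euc k)) (σ : Euc k → N),
      Quotient.mk s p ∈ c.source ∧
      ContMDiffOn (𝓡 n) 𝓘(ℝ, Euc k) ∞ (c ∘ Quotient.mk s) (Quotient.mk s ⁻¹' c.source) ∧
      ContMDiffOn 𝓘(ℝ, Euc k) (𝓡 n) ∞ σ c.target ∧
      ∀ y ∈ c.target, Quotient.mk s (σ y) = c.symm y := by
  have : ContinuousSMul Torus N := ⟨(contMDiff_torus_smul n).continuous⟩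
  obtain ⟨e, σ, W, hpe, he0, hes, hW, hσ, he⟩ := exists_slice hk p hp
  obtain ⟨B, hB, h0B, hBe, hBi⟩ := exists_slice_injective hp hpe he0 fun a ha => (he a ha).2
  have hBW : B ⊆ W := fun y hy => (he _ (hBe y hy)).1
  have hσe : ∀ y ∈ B, e.symm (0, y) = σ y := fun y hy => by
    rw [(he _ (hBe y hy)).2, expT_zero, one_smul]
  let ψ : Euc k → Quotient s := Quotient.mk s ∘ σ
  have hinj : InjOn ψ B := fun y hy y' hy' hyy => by
    obtain ⟨t, ht⟩ := (quotient_mk_eq_iff hs).1 hyy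
    exact hBi y hy y' hy' t ht
  have hcont : ContinuousOn ψ B :=
    continuous_quotient_mk'.comp_continuousOn (hσ.continuousOn.mono hBW)
  have hmk : ∀ x ∈ e.source, Quotient.mk s x = ψ (e x).2 := fun x hx => by
    have h1 := (he _ (e.map_source hx)).2
    rw [e.left_inv hx] at h1
    conv_lhs => rw [h1]
    exact quotient_mk_smul hs _ _
  -- The orbits through σ(B') are those through an open set of N, the product neighbourhood over B';
  -- as π is open, so is ψ.
  have himage : ∀ B' ⊆ B, ψ '' B' = Quotient.mk s '' (e.source ∩ e ⁻¹' (Prod.snd ⁻¹' B')) := by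
    intro B' hB'
    ext q
    constructor
    · rintro ⟨y, hy, rfl⟩
      refine ⟨σ y, ⟨?_, ?_⟩, rfl⟩
      · rw [← hσe y (hB' hy)]
        exact e.map_target (hBe y (hB' hy))
      · rw [mem_preimage, ← hσe y (hB' hy), e.right_inv (hBe y (hB' hy))]
        exact hy
    · rintro ⟨x, ⟨hx, hxB⟩, rfl⟩
      exact ⟨_, hxB, (hmk x hx).symm⟩
  have hopen : IsOpenMap (B.domRestrict ψ) := by
    intro B' hB'
    have h1 : B.domRestrict ψ '' B' = ψ '' (Subtype.val '' B') := by
      rw [← image_comp]; rfl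
    rw [h1, himage _ (Subtype.coe_image_subset B B')]
    exact isOpenMap_quotient_mk hs _ (e.isOpen_inter_preimage
      ((hB.isOpenMap_subtype_val _ hB').preimage continuous_snd))
  let ψe : OpenPartialHomeomorph (Euc k) (Quotient s) :=
    OpenPartialHomeomorph.ofContinuousOpenRestrict (hinj.toPartialEquiv ψ B) hcont hopen hB
  have hψe : ∀ y, ψe y = ψ y := fun y => rfl
  have htarget : ψe.target = ψ '' B := rfl
  refine ⟨ψe.symm, σ, ?_, ?_, hσ.mono hBW, fun y hy => rfl⟩
  · refine ⟨0, h0B, ?_⟩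
    rw [hmk p hpe, he0]
    rfl
  · intro x hx
    obtain ⟨y, hy, hyx⟩ := hx
    -- A point x over the chart domain may lie outside the slice chart; translation by t⁻¹ brings it
    -- to σ y without changing its class.
    obtain ⟨t, ht⟩ := (quotient_mk_eq_iff hs).1 hyx
    refine ContMDiffAt.contMDiffWithinAt ?_
    have htx : t⁻¹ • x = σ y := by rw [← ht, inv_smul_smul]
    have hye : σ y ∈ e.source := by
      rw [← hσe y hy]; exact e.map_target (hBe y hy)
    have hye2 : e (σ y) = (0, y) := by rw [← hσe y hy, e.right_inv (hBe y hy)]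
    have hc : Continuous fun x' : N => t⁻¹ • x' := continuous_const_smul _
    have hO : IsOpen (e.source ∩ e ⁻¹' (Prod.snd ⁻¹' B)) :=
      e.isOpen_inter_preimage (hB.preimage continuous_snd)
    have hev : ψe.symm ∘ Quotient.mk s =ᶠ[𝓝 x] fun x' => (e (t⁻¹ • x')).2 := by
      have hxO : t⁻¹ • x ∈ e.source ∩ e ⁻¹' (Prod.snd ⁻¹' B) := by
        rw [htx]
        exact ⟨hye, by rw [mem_preimage, hye2]; exact hy⟩
      filter_upwards [(hO.preimage hc).mem_nhds hxO] with x' hx'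
      have h1 : Quotient.mk s x' = ψe (e (t⁻¹ • x')).2 := by
        rw [hψe, ← hmk _ hx'.1, quotient_mk_smul hs]
      rw [Function.comp_apply, h1]
      exact ψe.left_inv hx'.2
    refine ContMDiffAt.congr_of_eventuallyEq ?_ hev
    have h1 : ContMDiffAt (𝓡 n) 𝓘(ℝ, (ℝ × ℝ) × Euc k) ∞ e (t⁻¹ • x) := by
      rw [htx]
      exact hes.contMDiffAt (e.open_source.mem_nhds hye)
    exact (contMDiff_iff_contDiff.2 contDiff_snd).contMDiffAt.comp x
      (h1.comp x (contMDiff_smul_left n t⁻¹).contMDiffAt)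

/-- The quotient of a manifold by a free action of the torus. -/
theorem exists_quotient_manifold [T2Space N] (hk : k + 2 = n)
    (hs : ∀ x y, s x y ↔ ∃ t : Torus, t • x = y)
    (hfree : ∀ (p : N) (t : Torus), t • p = p → t = 1) :
    ∃ (_ : ChartedSpace (Euc k) (Quotient s)) (_ : IsManifold (𝓡 k) ∞ (Quotient s)),
      ContMDiff (𝓡 n) (𝓡 k) ∞ (Quotient.mk s) ∧
      (∀ p, Function.Surjective (md (𝓡 n) (𝓡 k) (Quotient.mk s) p)) ∧
      ∀ q : Quotient s, ∃ σ : Euc k → N,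
        ContMDiffOn 𝓘(ℝ, Euc k) (𝓡 n) ∞ σ (extChartAt (𝓡 k) q).target ∧
        ∀ y ∈ (extChartAt (𝓡 k) q).target, Quotient.mk s (σ y) = (extChartAt (𝓡 k) q).symm y := by
  have : ContinuousSMul Torus N := ⟨(contMDiff_torus_smul n).continuous⟩
  choose c σ hpc hcs hσ hσc using fun q : Quotient s =>
    exists_quotient_chart hk hs q.out (hfree q.out)
  simp only [Quotient.out_eq] at hpc
  let cs : ChartedSpace (Euc k) (Quotient s) :=
    { atlas := range c
      chartAt := c
      mem_chart_source := hpc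
      chart_mem_atlas := fun p => mem_range_self p }
  have hman : IsManifold (𝓡 k) ∞ (Quotient s) := by
    apply isManifold_of_contDiffOn
    rintro _ _ ⟨p, rfl⟩ ⟨q, rfl⟩
    -- The transition map from p to q is c q ∘ π ∘ σ p, a composition of smooth maps.
    have h1 : ContDiffOn ℝ ∞ ((c q ∘ Quotient.mk s) ∘ σ p) ((c p).symm ≫ₕ c q).source := by
      rw [← contMDiffOn_iff_contDiffOn]
      refine (hcs q).comp ((hσ p).mono fun y hy => hy.1) fun y hy => ?_
      change Quotient.mk s (σ p y) ∈ (c q).source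
      rw [hσc p y hy.1]
      exact hy.2
    refine h1.congr_mono (fun y hy => ?_) (by simp)
    have hy1 : y ∈ ((c p).symm ≫ₕ c q).source := by simpa using hy
    change c q ((c p).symm y) = c q (Quotient.mk s (σ p y))
    rw [hσc p y hy1.1]
  have hca : ∀ q, c q ∈ IsManifold.maximalAtlas (𝓡 k) ∞ (Quotient s) := fun q =>
    IsManifold.chart_mem_maximalAtlas q
  have hmk : ContMDiff (𝓡 n) (𝓡 k) ∞ (Quotient.mk s) := by
    intro x
    have hopen : IsOpen (Quotient.mk s ⁻¹' (c (Quotient.mk s x)).source) :=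
      (c _).open_source.preimage continuous_quotient_mk'
    have h1 : ContMDiffAt (𝓡 n) (𝓡 k) ∞
        ((c (Quotient.mk s x)).symm ∘ (c (Quotient.mk s x) ∘ Quotient.mk s)) x :=
      (contMDiffAt_symm_of_mem_maximalAtlas (hca _) ((c _).map_source (hpc _))).comp x
        ((hcs _).contMDiffAt (hopen.mem_nhds (hpc _)))
    refine h1.congr_of_eventuallyEq ?_
    filter_upwards [hopen.mem_nhds (hpc (Quotient.mk s x))] with x' hx'
    exact ((c _).left_inv hx').symm
  refine ⟨cs, hman, hmk, fun x => ?_, fun q => ⟨σ q, ?_, fun y hy => ?_⟩⟩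
  · set q := Quotient.mk s x with hq
    have hy : c q q ∈ (c q).target := (c q).map_source (hpc q)
    have hcq : (c q).symm (c q q) = q := (c q).left_inv (hpc q)
    have h1 : Quotient.mk s (σ q (c q q)) = Quotient.mk s x := by rw [hσc q _ hy, hcq]
    -- The section meets the orbit of x, but perhaps not at x. Surjectivity of the derivative at σ
    -- is moved to x by π ∘ t = π.
    obtain ⟨t, ht⟩ := (quotient_mk_eq_iff hs).1 h1
    have h2 : Quotient.mk s ∘ (fun x' : N => t • x') = Quotient.mk s := by
      ext1 x'; exact quotient_mk_smul hs t x'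
    have h3 := md_comp (I₁ := 𝓡 n) (I₂ := 𝓡 n) (I₃ := 𝓡 k) (g := Quotient.mk s)
      (f := fun x' : N => t • x') (σ q (c q q)) (hmk.mdifferentiable (by simp) _)
      ((contMDiff_smul_left n t).mdifferentiable (by simp) _)
    have hσd : MDifferentiableAt 𝓘(ℝ, Euc k) (𝓡 n) (σ q) (c q q) :=
      ((hσ q).contMDiffAt ((c q).open_target.mem_nhds hy)).mdifferentiableAt (by simp)
    have h4 := md_comp (I₁ := 𝓘(ℝ, Euc k)) (I₂ := 𝓡 n) (I₃ := 𝓡 k) (g := Quotient.mk s)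
      (f := σ q) (c q q) (hmk.mdifferentiable (by simp) _) hσd
    have h5 : Quotient.mk s ∘ σ q =ᶠ[𝓝 (c q q)] (c q).symm := by
      filter_upwards [(c q).open_target.mem_nhds hy] with y hy using hσc q y hy
    rw [md_congr h5] at h4
    rw [h2, ht] at h3
    intro w
    have h6 := congrArg (fun L => L w) (md_chart_bijective (hca q) (hpc q)).2
    rw [h4, h3] at h6
    exact ⟨_, h6⟩
  · exact (hσ q).mono (by simp [extChartAt]; rfl)
  · have hy' : y ∈ (chartAt (Euc k) q).target := by simpa [extChartAt] using hy
    exact hσc q y hy'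

end QuotientManifold

/-! ### The linear algebra of the reduction at a point -/

/-- The derivatives `A`, `B` at a point of the inclusion and the projection of a level set, in a
frame of the tangent space, and the values `x₁`, `x₂` of the generating vector fields. -/
structure IsReducedAt (A : Euc 6 →L[ℝ] Euc 7) (B : Euc 6 →L[ℝ] Euc 4) (x₁ x₂ : Euc 7) : Prop where
  injective : Function.Injective A
  exists_eq : ∀ w, phi0 ![x₂, x₁, w] = 0 → ∃ u, A u = w
  surjective : Function.Surjective B
  ker_iff : ∀ u, B u = 0 ↔ A u ∈ Submodule.span ℝ {x₁, x₂}

/-- `e₁`, `e₂` is an orthonormal basis of the oriented plane spanned by `x₁`, `x₂`. -/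
structure IsAdaptedPair (x₁ x₂ e₁ e₂ : Euc 7) : Prop where
  norm₁ : inner ℝ e₁ e₁ = (1 : ℝ)
  norm₂ : inner ℝ e₂ e₂ = (1 : ℝ)
  orth : inner ℝ e₁ e₂ = (0 : ℝ)
  exists_eq : ∃ p p' q r : ℝ, x₁ = p • e₁ + p' • e₂ ∧ x₂ = q • e₁ + r • e₂ ∧ 0 < p * r - p' * q
  exists_eq' : ∃ a b c d : ℝ, 0 < a * d - b * c ∧ e₁ = a • x₁ + b • x₂ ∧ e₂ = c • x₁ + d • x₂

lemma IsAdaptedPair.of_eq {x₁ x₂ e₁ e₂ : Euc 7} (h₁ : inner ℝ e₁ e₁ = (1 : ℝ))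
    (h₂ : inner ℝ e₂ e₂ = (1 : ℝ)) (h₁₂ : inner ℝ e₁ e₂ = (0 : ℝ)) {a b c d : ℝ}
    (hD : 0 < a * d - b * c) (he₁ : e₁ = a • x₁ + b • x₂) (he₂ : e₂ = c • x₁ + d • x₂) :
    IsAdaptedPair x₁ x₂ e₁ e₂ := by
  refine ⟨h₁, h₂, h₁₂, ⟨d / (a * d - b * c), -b / (a * d - b * c), -c / (a * d - b * c),
    a / (a * d - b * c), ?_, ?_, ?_⟩, a, b, c, d, hD, he₁, he₂⟩
  · rw [he₁, he₂]
    have h1 : x₁ = ((a * d - b * c) / (a * d - b * c)) • x₁ := by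
      rw [div_self hD.ne', one_smul]
    conv_lhs => rw [h1]
    module
  · rw [he₁, he₂]
    have h1 : x₂ = ((a * d - b * c) / (a * d - b * c)) • x₂ := by
      rw [div_self hD.ne', one_smul]
    conv_lhs => rw [h1]
    module
  · have h1 : d / (a * d - b * c) * (a / (a * d - b * c)) -
        -b / (a * d - b * c) * (-c / (a * d - b * c)) = 1 / (a * d - b * c) := by
      field_simp
    rw [h1]
    positivity

lemma exists_isAdaptedPair {x₁ x₂ : Euc 7} (h : LinearIndependent ℝ ![x₁, x₂]) :
    ∃ e₁ e₂, IsAdaptedPair x₁ x₂ e₁ e₂ := by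
  have hx₁ : x₁ ≠ 0 := by simpa using h.ne_zero 0
  have hn₁ : 0 < ‖x₁‖ := norm_pos_iff.2 hx₁
  set e₁ := ‖x₁‖⁻¹ • x₁ with he₁
  have h₁ : inner ℝ e₁ e₁ = (1 : ℝ) := by
    rw [he₁, inner_smul_left, inner_smul_right, real_inner_self_eq_norm_sq]
    simp only [conj_trivial]
    field_simp
  set s : ℝ := inner ℝ e₁ x₂
  set y := x₂ - s • e₁ with hy
  have hy0 : y ≠ 0 := by
    intro h0
    have h1 := LinearIndependent.pair_iff.1 h (s * ‖x₁‖⁻¹) (-1) (by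
      rw [sub_eq_zero] at h0
      rw [h0, he₁, smul_smul]
      module)
    norm_num at h1
  have hn : 0 < ‖y‖ := norm_pos_iff.2 hy0
  have hey : inner ℝ e₁ y = (0 : ℝ) := by
    rw [hy, inner_sub_right, inner_smul_right, h₁]
    simp [s]
  refine ⟨e₁, ‖y‖⁻¹ • y, IsAdaptedPair.of_eq (a := ‖x₁‖⁻¹) (b := 0)
    (c := -(‖y‖⁻¹ * s * ‖x₁‖⁻¹)) (d := ‖y‖⁻¹) h₁ ?_ ?_ ?_ ?_ ?_⟩
  · rw [inner_smul_left, inner_smul_right, real_inner_self_eq_norm_sq]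
    simp only [conj_trivial]
    field_simp
  · rw [inner_smul_right, hey, mul_zero]
  · rw [zero_mul, sub_zero]
    positivity
  · rw [he₁]
    module
  · rw [hy, he₁]
    module

lemma IsAdaptedPair.span_eq {x₁ x₂ e₁ e₂ : Euc 7} (h : IsAdaptedPair x₁ x₂ e₁ e₂) :
    Submodule.span ℝ {x₁, x₂} = Submodule.span ℝ {e₁, e₂} := by
  obtain ⟨p, p', q, r, hx₁, hx₂, -⟩ := h.exists_eq
  obtain ⟨a, b, c, d, -, he₁, he₂⟩ := h.exists_eq'
  apply le_antisymm
  · rw [Submodule.span_le]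
    rintro _ (rfl | rfl)
    · exact Submodule.mem_span_pair.2 ⟨p, p', hx₁.symm⟩
    · exact Submodule.mem_span_pair.2 ⟨q, r, hx₂.symm⟩
  · rw [Submodule.span_le]
    rintro _ (rfl | rfl)
    · exact Submodule.mem_span_pair.2 ⟨a, b, he₁.symm⟩
    · exact Submodule.mem_span_pair.2 ⟨c, d, he₂.symm⟩

/-- Here x₂ × x₁ = -D e₁ × e₂ with D the determinant of the change of basis. Applied to df, it shows
that e₃ spans the normal direction of N. -/
lemma IsAdaptedPair.phi0_eq {x₁ x₂ e₁ e₂ : Euc 7} (h : IsAdaptedPair x₁ x₂ e₁ e₂) :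
    ∃ D : ℝ, 0 < D ∧ ∀ w, phi0 ![x₂, x₁, w] = -(D * inner ℝ (cross0 e₁ e₂) w) := by
  obtain ⟨p, p', q, r, hx₁, hx₂, hD⟩ := h.exists_eq
  refine ⟨_, hD, fun w => ?_⟩
  rw [← inner_cross0, hx₁, hx₂, cross0_add_left, cross0_add_right, cross0_add_right,
    cross0_smul_left, cross0_smul_left, cross0_smul_left, cross0_smul_left, cross0_smul_right,
    cross0_smul_right, cross0_smul_right, cross0_smul_right, cross0_self, cross0_self,
    cross0_swap e₂ e₁]
  simp only [inner_add_left, inner_smul_left, inner_neg_left, inner_zero_left, conj_trivial]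
  ring

namespace IsReducedAt

variable {A : Euc 6 →L[ℝ] Euc 7} {B : Euc 6 →L[ℝ] Euc 4} {x₁ x₂ e₁ e₂ : Euc 7}

/-- The transverse space is orthogonal to e₃, hence inside the range of A. Its preimage K has
dimension 4 and meets ker B trivially, as A(ker B) lies in the span of e₁, e₂. So B restricts to an
isomorphism on K, and ℓ is its inverse, the horizontal lift. -/
lemma exists_lift (h : IsReducedAt A B x₁ x₂) (he : IsAdaptedPair x₁ x₂ e₁ e₂) :
    ∃ ℓ : Euc 4 →ₗ[ℝ] Euc 6, (∀ x, B (ℓ x) = x) ∧ (∀ x, A (ℓ x) ∈ transverse e₁ e₂) ∧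
      ∀ w ∈ transverse e₁ e₂, ∃ u, A u = w ∧ ℓ (B u) = u := by
  let T := transverse e₁ e₂
  have hTr : ∀ w ∈ T, ∃ u, A u = w := fun w hw => by
    obtain ⟨D, -, hD⟩ := he.phi0_eq
    refine h.exists_eq w ?_
    rw [hD, real_inner_comm, (mem_transverse.1 hw).2.2, mul_zero, neg_zero]
  let K : Submodule ℝ (Euc 6) := T.comap A.toLinearMap
  have hker : ∀ u ∈ K, B u = 0 → u = 0 := by
    intro u hu hBu
    have h1 := (h.ker_iff u).1 hBu
    rw [he.span_eq] at h1
    obtain ⟨a, b, hab⟩ := Submodule.mem_span_pair.1 h1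
    have h2 := mem_transverse.1 (show A u ∈ T from hu)
    have h3 : inner ℝ (A u) (A u) = (0 : ℝ) := by
      nth_rw 2 [← hab]
      rw [inner_add_right, inner_smul_right, inner_smul_right, h2.1, h2.2.1]
      simp
    exact h.injective ((inner_self_eq_zero.1 h3).trans (map_zero A).symm)
  let BK : K →ₗ[ℝ] Euc 4 := B.toLinearMap ∘ₗ K.subtype
  have hBKi : Function.Injective BK := by
    rw [injective_iff_map_eq_zero]
    exact fun u hu => Subtype.ext (hker u u.2 hu)
  have hKfr : Module.finrank ℝ K = 4 := by
    let AK : K →ₗ[ℝ] T := (A.toLinearMap ∘ₗ K.subtype).codRestrict T fun u => u.2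
    have hAK : Function.Bijective AK := by
      constructor
      · intro u v huv
        exact Subtype.ext (h.injective (congrArg Subtype.val huv))
      · rintro ⟨w, hw⟩
        obtain ⟨u, rfl⟩ := hTr w hw
        exact ⟨⟨u, hw⟩, rfl⟩
    rw [(LinearEquiv.ofBijective AK hAK).finrank_eq]
    exact finrank_transverse he.norm₁ he.norm₂ he.orth
  have hBKs : Function.Surjective BK := by
    refine (LinearMap.injective_iff_surjective_of_finrank_eq_finrank ?_).1 hBKi
    rw [hKfr, finrank_euclideanSpace_fin]
  let E := LinearEquiv.ofBijective BK ⟨hBKi, hBKs⟩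
  refine ⟨K.subtype ∘ₗ E.symm.toLinearMap, fun x => E.apply_symm_apply x,
    fun x => (E.symm x).2, fun w hw => ?_⟩
  obtain ⟨u, rfl⟩ := hTr w hw
  exact ⟨u, rfl, congrArg Subtype.val (E.symm_apply_apply ⟨u, hw⟩)⟩

/-- The forms and the complex structure on the quotient at a point. -/
lemma exists_data (h : IsReducedAt A B x₁ x₂) (he : IsAdaptedPair x₁ x₂ e₁ e₂)
    {ϖ η₁ η₂ : Euc 4 [⋀^Fin 2]→L[ℝ] ℝ}
    (hϖ : ∀ x y, ϖ ![B x, B y] = starPhi0 ![x₂, x₁, A x, A y])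
    (hη₁ : ∀ x y, η₁ ![B x, B y] = phi0 ![x₁, A x, A y])
    (hη₂ : ∀ x y, η₂ ![B x, B y] = phi0 ![x₂, A x, A y]) :
    ∃ (J : Euc 4 →L[ℝ] Euc 4) (ℓ : Euc 4 →ₗ[ℝ] Euc 6), IsTransverseTriple ϖ η₁ η₂ J ∧
      (∀ x, B (ℓ x) = x) ∧ (∀ x, A (ℓ x) ∈ transverse e₁ e₂) ∧
      (∀ x, A (ℓ (J x)) = cross0 (A (ℓ x)) (cross0 e₁ e₂)) ∧
      ∀ w ∈ transverse e₁ e₂, ∃ u, A u = w ∧ ℓ (B u) = u := by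
  obtain ⟨ℓ, hB, hT, hw⟩ := h.exists_lift he
  obtain ⟨p, p', q, r, hx₁, hx₂, hD⟩ := he.exists_eq
  obtain ⟨J, hJ, hJl⟩ := exists_isTransverseTriple he.norm₁ he.norm₂ he.orth hx₁ hx₂ hD
    (A.toLinearMap ∘ₗ ℓ) (h.injective.comp (Function.LeftInverse.injective hB)) hT
    (ϖ := ϖ) (η₁ := η₁) (η₂ := η₂)
    (fun x y => by rw [← hB x, ← hB y, hϖ]; simp [hB])
    (fun x y => by rw [← hB x, ← hB y, hη₁]; simp [hB])
    (fun x y => by rw [← hB x, ← hB y, hη₂]; simp [hB])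
  exact ⟨J, ℓ, hJ, hB, hT, hJl, hw⟩

/-- The preimage of a plane is calibrated if and only if the plane is a complex line. -/
lemma calibrated_iff (h : IsReducedAt A B x₁ x₂) (he : IsAdaptedPair x₁ x₂ e₁ e₂)
    {J : Euc 4 →L[ℝ] Euc 4} {ℓ : Euc 4 →ₗ[ℝ] Euc 6} (hB : ∀ x, B (ℓ x) = x)
    (hT : ∀ x, A (ℓ x) ∈ transverse e₁ e₂)
    (hJ : ∀ x, A (ℓ (J x)) = cross0 (A (ℓ x)) (cross0 e₁ e₂))
    (Y : Submodule ℝ (Euc 4)) (hY : Module.finrank ℝ Y = 2) :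
    (∀ u : Fin 4 → Euc 7, (∀ i, ∃ w, B w ∈ Y ∧ A w = u i) →
      (∀ i j, inner ℝ (u i) (u j) = if i = j then (1 : ℝ) else 0) → |starPhi0 u| = 1) ↔
    ∀ y ∈ Y, J y ∈ Y := by
  rw [← G2Reduction.calibrated_iff he.norm₁ he.norm₂ he.orth (A.toLinearMap ∘ₗ ℓ)
    (h.injective.comp (Function.LeftInverse.injective hB)) hT hJ Y hY]
  have key : ∀ v : Euc 7, (∃ w, B w ∈ Y ∧ A w = v) ↔
      v ∈ Submodule.span ℝ {e₁, e₂} ⊔ Y.map (A.toLinearMap ∘ₗ ℓ) := by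
    intro v
    rw [← he.span_eq, Submodule.mem_sup]
    constructor
    · rintro ⟨w, hw, rfl⟩
      refine ⟨A (w - ℓ (B w)), (h.ker_iff _).1 (by rw [map_sub, hB, sub_self]), A (ℓ (B w)),
        ⟨B w, hw, rfl⟩, by rw [← map_add, sub_add_cancel]⟩
    · rintro ⟨y, hy, _, ⟨z, hz, rfl⟩, rfl⟩
      have h1 : phi0 ![x₂, x₁, y] = 0 := by
        obtain ⟨a, b, rfl⟩ := Submodule.mem_span_pair.1 hy
        rw [← inner_cross0, inner_add_right, inner_smul_right, inner_smul_right,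
          inner_cross0_self_left, inner_cross0_self_right]
        simp
      obtain ⟨u, rfl⟩ := h.exists_eq y h1
      refine ⟨u + ℓ z, ?_, ?_⟩
      · rw [map_add, (h.ker_iff u).2 hy, hB, zero_add]
        exact hz
      · rw [map_add]
        rfl
  simp only [key]

end IsReducedAt

/-! ### Frames of a `G₂`-form -/

section Frame

variable {M : Type*} [TopologicalSpace M] [ChartedSpace (Euc 7) M] {φ : DForm 7 M 3 ℝ}

/-- The frame of a `G₂`-form, as a map of the model space. -/
def frameAt (φ : DForm 7 M 3 ℝ) (m : M) : Euc 7 ≃L[ℝ] Euc 7 := g2Frame φ m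

lemma formAt_eq_phi0 (h : ∀ m, ∃ σ, IsG2Frame φ m σ) (m : M) :
    formAt φ m = phi0.compContinuousLinearMap (frameAt φ m : Euc 7 →L[ℝ] Euc 7) := by
  have h1 : IsG2Frame φ m (g2Frame φ m) := by
    have h2 : g2Frame φ m = (h m).choose := dif_pos (h m)
    rw [h2]
    exact (h m).choose_spec
  exact h1.symm

lemma formAt_g2Star (φ : DForm 7 M 3 ℝ) (m : M) : formAt (g2Star φ) m =
    starPhi0.compContinuousLinearMap (frameAt φ m : Euc 7 →L[ℝ] Euc 7) := rfl

lemma frameAt_g2Cross (φ : DForm 7 M 3 ℝ) (m : M) (u v : Euc 7) :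
    frameAt φ m (g2Cross φ m u v) = cross0 (frameAt φ m u) (frameAt φ m v) :=
  (frameAt φ m).apply_symm_apply _

variable [MulAction Torus M] [ContMDiffSMul torusModel (𝓡 7) ∞ Torus M]

/-- The derivatives of the action are invertible. -/
lemma exists_md_smul_equiv {n : ℕ} {M : Type*} [TopologicalSpace M] [ChartedSpace (Euc n) M]
    [MulAction Torus M] [ContMDiffSMul torusModel (𝓡 n) ∞ Torus M] (t : Torus) (m : M) :
    ∃ B : Euc n ≃L[ℝ] Euc n, (B : Euc n →L[ℝ] Euc n) =
      md (𝓡 n) (𝓡 n) (fun m : M => t • m) m := by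
  have hd : ∀ t : Torus, MDifferentiable (𝓡 n) (𝓡 n) (fun m : M => t • m) := fun t =>
    (contMDiff_smul_left n t).mdifferentiable (by simp)
  have h1 := md_comp (g := fun m : M => t⁻¹ • m) (f := fun m : M => t • m) m (hd _ _) (hd _ _)
  have h2 : (fun m : M => t⁻¹ • m) ∘ (fun m : M => t • m) = fun m => m := by
    ext1 m; exact inv_smul_smul t m
  rw [h2, md_id] at h1
  have hinj : Function.Injective (md (𝓡 n) (𝓡 n) (fun m : M => t • m) m) :=
    Function.LeftInverse.injective fun v => (congrArg (fun L => L v) h1).symm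
  exact exists_equiv_of_bijective _ ⟨hinj, LinearMap.surjective_of_injective
    (f := (md (𝓡 n) (𝓡 n) (fun m : M => t • m) m).toLinearMap) hinj⟩

/-- The frame at t • m composed with the derivative of t and the frame at m both identify φ at m
with φ₀, so they induce the same dual form. No regularity of the frames in m is needed. -/
lemma PreservesForm.g2Star (h : ∀ m, ∃ σ, IsG2Frame φ m σ) (hT : PreservesForm φ) :
    PreservesForm (g2Star φ) := by
  intro t
  ext1 m
  change formAt (formPullback 7 7 (fun m : M => t • m) (G2Reduction.g2Star φ)) m =
    formAt (G2Reduction.g2Star φ) m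
  obtain ⟨B, hB⟩ := exists_md_smul_equiv (n := 7) t m
  have h1 := hT.formAt_smul t m
  rw [formAt_eq_phi0 h, formAt_eq_phi0 h, ← hB] at h1
  have h2 := starPhi0_comp_eq_of_phi0_comp_eq (B.trans (frameAt φ (t • m))) (frameAt φ m) h1
  rw [formAt_formPullback, formAt_g2Star, formAt_g2Star, ← h2, ← hB]
  rfl

end Frame

/-! ### The reduced space -/

section Reduction

variable {M : Type*} [TopologicalSpace M] [ChartedSpace (Euc 7) M]
  [MulAction Torus M] {φ : DForm 7 M 3 ℝ} {v₁ v₂ : ℝ × ℝ} {f : M → ℝ}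

/-- The value at `m`, in the frame of the `G₂`-form, of the vector field generated by `v`. -/
def genAt (φ : DForm 7 M 3 ℝ) (m : M) : ℝ × ℝ →L[ℝ] Euc 7 :=
  (frameAt φ m : Euc 7 →L[ℝ] Euc 7).comp (orbitDeriv 7 m)

lemma exists_eq_of_linearIndependent (hv : LinearIndependent ℝ ![v₁, v₂]) (v : ℝ × ℝ) :
    ∃ a b : ℝ, v = a • v₁ + b • v₂ := by
  have h := hv.span_eq_top_of_card_eq_finrank (by simp)
  have h1 : v ∈ Submodule.span ℝ (Set.range ![v₁, v₂]) := h ▸ Submodule.mem_top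
  rw [Matrix.range_cons, Matrix.range_cons, Matrix.range_empty, union_empty,
    singleton_union, Submodule.mem_span_pair] at h1
  obtain ⟨a, b, hab⟩ := h1
  exact ⟨a, b, hab.symm⟩

lemma phi0_genAt (hv : LinearIndependent ℝ ![v₁, v₂]) (m : M) (v : ℝ × ℝ) :
    phi0 ![genAt φ m v₂, genAt φ m v₁, genAt φ m v] = 0 := by
  obtain ⟨a, b, rfl⟩ := exists_eq_of_linearIndependent hv v
  rw [← inner_cross0, map_add, map_smul, map_smul, inner_add_right, inner_smul_right,
    inner_smul_right, inner_cross0_self_left, inner_cross0_self_right]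
  simp

variable [ContMDiffSMul torusModel (𝓡 7) ∞ Torus M]

lemma interiorProduct_flowField_apply_three (α : DForm 7 M 3 ℝ) (m : M) (w : Euc 7) :
    formAt (interiorProduct (flowField v₁) (interiorProduct (flowField v₂) α)) m ![w] =
      formAt α m ![orbitDeriv 7 m v₂, orbitDeriv 7 m v₁, w] := by
  rw [formAt_interiorProduct_flowField, formAt_interiorProduct_flowField]
  rfl

lemma IsDifferentialOf.md_eq
    (h : IsDifferentialOf (interiorProduct (flowField v₁) (interiorProduct (flowField v₂) φ)) f)
    (hφ : ∀ m, ∃ σ, IsG2Frame φ m σ) (m : M) (w : Euc 7) :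
    md (𝓡 7) 𝓘(ℝ, ℝ) f m w = phi0 ![genAt φ m v₂, genAt φ m v₁, frameAt φ m w] := by
  have h1 : md (𝓡 7) 𝓘(ℝ, ℝ) f m w =
      formAt (interiorProduct (flowField v₁) (interiorProduct (flowField v₂) φ)) m ![w] := h m w
  rw [h1, interiorProduct_flowField_apply_three, formAt_eq_phi0 hφ,
    ContinuousAlternatingMap.compContinuousLinearMap_apply]
  congr 1
  ext i
  fin_cases i <;> rfl

lemma IsDifferentialOf.invariant
    (h : IsDifferentialOf (interiorProduct (flowField v₁) (interiorProduct (flowField v₂) φ)) f)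
    (hφ : ∀ m, ∃ σ, IsG2Frame φ m σ) (hv : LinearIndependent ℝ ![v₁, v₂])
    (hf : ContMDiff (𝓡 7) 𝓘(ℝ, ℝ) ∞ f) (t : Torus) (m : M) : f (t • m) = f m := by
  refine invariant_of_md_orbitDeriv (n := 7) (hf.mdifferentiable (by simp)) (fun m v => ?_) t m
  rw [h.md_eq hφ]
  exact phi0_genAt hv m v

variable [IsManifold (𝓡 7) ∞ M]

lemma genAt_injective {m : M} (hm : ∀ t : Torus, t • m = m → t = 1) :
    Function.Injective (genAt φ m) :=
  (frameAt φ m).injective.comp (orbitDeriv_injective hm)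

lemma exists_isAdaptedPair_genAt {m : M} (hm : ∀ t : Torus, t • m = m → t = 1)
    (hv : LinearIndependent ℝ ![v₁, v₂]) :
    ∃ e₁ e₂, IsAdaptedPair (genAt φ m v₁) (genAt φ m v₂) e₁ e₂ := by
  apply exists_isAdaptedPair
  have h := hv.map' (genAt φ m).toLinearMap (LinearMap.ker_eq_bot.2 (genAt_injective hm))
  have h1 : ⇑(genAt φ m).toLinearMap ∘ ![v₁, v₂] = ![genAt φ m v₁, genAt φ m v₂] := by
    ext1 i
    fin_cases i <;> rfl
  rwa [h1] at h

lemma IsDifferentialOf.md_surjective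
    (h : IsDifferentialOf (interiorProduct (flowField v₁) (interiorProduct (flowField v₂) φ)) f)
    (hφ : ∀ m, ∃ σ, IsG2Frame φ m σ) (hv : LinearIndependent ℝ ![v₁, v₂])
    {m : M} (hm : ∀ t : Torus, t • m = m → t = 1) :
    Function.Surjective (md (𝓡 7) 𝓘(ℝ, ℝ) f m) := by
  obtain ⟨e₁, e₂, he⟩ := exists_isAdaptedPair_genAt (φ := φ) hm hv
  obtain ⟨D, hD, hDw⟩ := he.phi0_eq
  intro y
  -- df is -D ⟨e₃, ·⟩ in the frame, so it takes the value y on -(y / D) e₃.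
  refine ⟨(frameAt φ m).symm ((-(y / D)) • cross0 e₁ e₂), ?_⟩
  rw [h.md_eq hφ, ContinuousLinearEquiv.apply_symm_apply, hDw, inner_smul_right,
    inner_e3_self he.norm₁ he.norm₂ he.orth]
  field_simp

lemma hasDefiningFunctionAt_levelSet {n : ℕ} {M : Type*} [TopologicalSpace M]
    [ChartedSpace (Euc n) M] {f : M → ℝ} (hf : ContMDiff (𝓡 n) 𝓘(ℝ, ℝ) ∞ f) (c : ℝ) {p : M}
    (hs : Function.Surjective (md (𝓡 n) 𝓘(ℝ, ℝ) f p)) :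
    HasDefiningFunctionAt n ℝ (f ⁻¹' {c}) p := by
  have h1 : HasFDerivAt (fun y : ℝ => y - c) (ContinuousLinearMap.id ℝ ℝ) (f p) :=
    (hasFDerivAt_id _).sub_const c
  refine ⟨(fun y => y - c) ∘ f, univ, isOpen_univ, mem_univ p, ?_, ?_, fun x _ => ?_⟩
  · exact ((contMDiff_iff_contDiff.2 (contDiff_id.sub contDiff_const)).comp hf).contMDiffOn
  · rw [md_comp (I₂ := 𝓘(ℝ, ℝ)) p h1.differentiableAt.mdifferentiableAt
      (hf.mdifferentiable (by simp) p), md_eq_fderiv, h1.fderiv, ContinuousLinearMap.id_comp]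
    exact hs
  · simp [sub_eq_zero]

/-- `N` is the level set `f = c` of the multi-moment map, and `N / T²` its quotient manifold. -/
structure IsReduction (φ : DForm 7 M 3 ℝ) (v₁ v₂ : ℝ × ℝ) (f : M → ℝ) (c : ℝ) (N : Set M)
    [ChartedSpace (Euc 6) N] [MulAction Torus N] [ChartedSpace (Euc 4) (OrbitSpace N)] :
    Prop where
  exists_frame : ∀ m, ∃ σ, IsG2Frame φ m σ
  preserves : PreservesForm φ
  indep : LinearIndependent ℝ ![v₁, v₂]
  contMDiff_map : ContMDiff (𝓡 7) 𝓘(ℝ, ℝ) ∞ f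
  isDifferentialOf :
    IsDifferentialOf (interiorProduct (flowField v₁) (interiorProduct (flowField v₂) φ)) f
  mem_iff : ∀ m, m ∈ N ↔ f m = c
  free : ∀ m ∈ N, ∀ t : Torus, t • m = m → t = 1
  coe_smul : ∀ (t : Torus) (m : N), ((t • m : N) : M) = t • (m : M)
  embedding : IsSmoothEmbedding (𝓡 6) (𝓡 7) ∞ (Subtype.val : N → M)
  contMDiff_proj : ContMDiff (𝓡 6) (𝓡 4) ∞ (proj N)
  md_proj_surjective : ∀ p, Function.Surjective (md (𝓡 6) (𝓡 4) (proj N) p)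
  exists_section : ∀ q : OrbitSpace N, ∃ σ : Euc 4 → N,
    ContMDiffOn 𝓘(ℝ, Euc 4) (𝓡 6) ∞ σ (extChartAt (𝓡 4) q).target ∧
    ∀ y ∈ (extChartAt (𝓡 4) q).target, proj N (σ y) = (extChartAt (𝓡 4) q).symm y

/-- The action on an invariant subset. -/
@[reducible]
def invariantAction {M : Type*} [MulAction Torus M] {N : Set M}
    (hN : ∀ (t : Torus), ∀ m ∈ N, t • m ∈ N) : MulAction Torus N where
  smul t m := ⟨t • m.1, hN t m.1 m.2⟩
  one_smul m := Subtype.ext (one_smul Torus m.1)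
  mul_smul s t m := Subtype.ext (mul_smul s t m.1)

lemma exists_isReduction [T2Space M] [SecondCountableTopology M]
    (hφ : ∀ m, ∃ σ, IsG2Frame φ m σ)
    (hT : PreservesForm φ) (hv : LinearIndependent ℝ ![v₁, v₂])
    (hf : ContMDiff (𝓡 7) 𝓘(ℝ, ℝ) ∞ f)
    (hd : IsDifferentialOf (interiorProduct (flowField v₁) (interiorProduct (flowField v₂) φ)) f)
    (c : ℝ) {N : Set M} (hN : N = f ⁻¹' {c})
    (hfree : ∀ m ∈ N, ∀ t : Torus, t • m = m → t = 1) :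
    ∃ (_ : ChartedSpace (Euc 6) N) (_ : IsManifold (𝓡 6) ∞ N) (_ : MulAction Torus N)
      (_ : ContMDiffSMul torusModel (𝓡 6) ∞ Torus N)
      (_ : ChartedSpace (Euc 4) (OrbitSpace N)) (_ : IsManifold (𝓡 4) ∞ (OrbitSpace N)),
      T2Space (OrbitSpace N) ∧ SecondCountableTopology (OrbitSpace N) ∧
      IsSubmersion (𝓡 6) (𝓡 4) ∞ (proj N) ∧ IsReduction φ v₁ v₂ f c N := by
  obtain ⟨cs, hman, hemb⟩ := exists_isSmoothEmbedding_of_hasDefiningFunctionAt (k := 6) (G := ℝ)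
    (n := 7) (by simp) (L := N) fun p hp => by
      rw [hN]
      exact hasDefiningFunctionAt_levelSet hf c (hd.md_surjective hφ hv (hfree p hp))
  have hinv : ∀ (t : Torus), ∀ m ∈ N, t • m ∈ N := fun t m hm => by
    rw [hN, mem_preimage, mem_singleton_iff] at hm ⊢
    rw [hd.invariant hφ hv hf, hm]
  let act : MulAction Torus N := invariantAction hinv
  have hsm : ContMDiffSMul torusModel (𝓡 6) ∞ Torus N := by
    refine ⟨?_⟩
    rw [ContMDiff.iff_comp_isImmersion hemb.isImmersion]
    have h1 : ContMDiff (torusModel.prod (𝓡 6)) (𝓡 7) ∞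
        (fun p : Torus × N => p.1 • (p.2 : M)) :=
      (contMDiff_torus_smul 7).comp (contMDiff_fst.prodMk (hemb.contMDiff.comp contMDiff_snd))
    exact ⟨h1.continuous.subtype_mk _, h1⟩
  have hfreeN : ∀ (p : N) (t : Torus), t • p = p → t = 1 := fun p t h =>
    hfree p p.2 t (congrArg Subtype.val h)
  have hs : ∀ x y : N, ((MulAction.orbitRel Torus M).comap (Subtype.val : N → M)) x y ↔
      ∃ t : Torus, t • x = y := by
    intro x y
    rw [Setoid.comap_rel]
    change x.1 ∈ MulAction.orbit Torus y.1 ↔ _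
    constructor
    · rintro ⟨t, ht⟩
      refine ⟨t⁻¹, Subtype.ext ?_⟩
      change t⁻¹ • x.1 = y.1
      rw [← ht, inv_smul_smul]
    · rintro ⟨t, rfl⟩
      exact ⟨t⁻¹, inv_smul_smul t x.1⟩
  have hcont : ContinuousSMul Torus N := ⟨(contMDiff_torus_smul 6).continuous⟩
  obtain ⟨csQ, hmanQ, hproj, hsurj, hsec⟩ := exists_quotient_manifold (n := 6) (k := 4)
    (by norm_num) hs hfreeN
  refine ⟨cs, hman, act, hsm, csQ, hmanQ, t2Space_quotient hs, ?_, ?_, ?_⟩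
  · exact Topology.IsQuotientMap.secondCountableTopology isQuotientMap_quotient_mk'
      (isOpenMap_quotient_mk hs)
  · exact isSubmersion_of_md_surjective (K := Euc 2)
      (ContinuousLinearEquiv.ofFinrankEq (by simp)) hproj hsurj
  · exact ⟨hφ, hT, hv, hf, hd, fun m => by rw [hN]; rfl, hfree, fun t m => rfl, hemb, hproj, hsurj,
      hsec⟩

end Reduction

/-! ### 2-forms under linear maps -/

lemma comp_two {E F : Type*} [NormedAddCommGroup E] [NormedSpace ℝ E] [NormedAddCommGroup F]
    [NormedSpace ℝ F] (η : F [⋀^Fin 2]→L[ℝ] ℝ) (A : E →L[ℝ] F) (x y : E) :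
    η.compContinuousLinearMap A ![x, y] = η ![A x, A y] := by
  rw [ContinuousAlternatingMap.compContinuousLinearMap_apply]
  congr 1
  ext1 i
  fin_cases i <;> rfl

lemma alternating_two_ext {E : Type*} [NormedAddCommGroup E] [NormedSpace ℝ E]
    {η θ : E [⋀^Fin 2]→L[ℝ] ℝ} (h : ∀ x y, η ![x, y] = θ ![x, y]) : η = θ := by
  ext w
  have hw : w = ![w 0, w 1] := by
    ext1 i
    fin_cases i <;> rfl
  rw [hw]
  exact h _ _

lemma compContinuousLinearMap_cancel {E F : Type*} [NormedAddCommGroup E] [NormedSpace ℝ E]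
    [NormedAddCommGroup F] [NormedSpace ℝ F] {η θ : F [⋀^Fin 2]→L[ℝ] ℝ} {A : E →L[ℝ] F}
    (hA : Function.Surjective A)
    (h : η.compContinuousLinearMap A = θ.compContinuousLinearMap A) : η = θ := by
  refine alternating_two_ext fun x y => ?_
  obtain ⟨u, rfl⟩ := hA x
  obtain ⟨v, rfl⟩ := hA y
  rw [← comp_two, h, comp_two]

lemma map_two_eq_of_sub {E : Type*} [NormedAddCommGroup E] [NormedSpace ℝ E]
    {η : E [⋀^Fin 2]→L[ℝ] ℝ} {x x' y y' : E} (hx : ∀ z, η ![x - x', z] = 0)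
    (hy : ∀ z, η ![y - y', z] = 0) : η ![x, y] = η ![x', y'] := by
  simp only [← flat_apply, map_sub, sub_apply, sub_eq_zero] at hx hy
  rw [← flat_apply, hx, flat_apply, vecCons_two_swap, ← flat_apply, hy, flat_apply,
    vecCons_two_swap, neg_neg]

/-! ### The derivatives of the inclusion and of the projection -/

namespace IsReduction

variable {M : Type*} [TopologicalSpace M] [ChartedSpace (Euc 7) M] [IsManifold (𝓡 7) ∞ M]
  [MulAction Torus M] [ContMDiffSMul torusModel (𝓡 7) ∞ Torus M] {φ : DForm 7 M 3 ℝ}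
  {v₁ v₂ : ℝ × ℝ} {f : M → ℝ} {c : ℝ} {N : Set M}
  [ChartedSpace (Euc 6) N] [IsManifold (𝓡 6) ∞ N] [MulAction Torus N]
  [ContMDiffSMul torusModel (𝓡 6) ∞ Torus N]
  [ChartedSpace (Euc 4) (OrbitSpace N)] [IsManifold (𝓡 4) ∞ (OrbitSpace N)]

lemma mdifferentiable_val (h : IsReduction φ v₁ v₂ f c N) :
    MDifferentiable (𝓡 6) (𝓡 7) (Subtype.val : N → M) :=
  h.embedding.contMDiff.mdifferentiable (by simp)

lemma mdifferentiable_proj (h : IsReduction φ v₁ v₂ f c N) :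
    MDifferentiable (𝓡 6) (𝓡 4) (proj N) :=
  h.contMDiff_proj.mdifferentiable (by simp)

lemma free_coe (h : IsReduction φ v₁ v₂ f c N) (m : N) (t : Torus) (ht : t • m = m) : t = 1 :=
  h.free m m.2 t (by rw [← h.coe_smul, ht])

lemma proj_smul (h : IsReduction φ v₁ v₂ f c N) (t : Torus) (m : N) :
    proj N (t • m) = proj N m := by
  refine Quotient.sound ?_
  change ((t • m : N) : M) ∈ MulAction.orbit Torus (m : M)
  rw [h.coe_smul]
  exact ⟨t, rfl⟩

lemma exists_smul_eq (h : IsReduction φ v₁ v₂ f c N) {x y : N} (hxy : proj N x = proj N y) :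
    ∃ t : Torus, t • y = x := by
  have h1 : (x : M) ∈ MulAction.orbit Torus (y : M) := Quotient.exact hxy
  obtain ⟨t, ht⟩ := h1
  exact ⟨t, Subtype.ext ((h.coe_smul t y).trans ht)⟩

lemma md_val_orbitDeriv (h : IsReduction φ v₁ v₂ f c N) (m : N) (v : ℝ × ℝ) :
    md (𝓡 6) (𝓡 7) (Subtype.val : N → M) m (orbitDeriv 6 m v) = orbitDeriv 7 (m : M) v := by
  have h1 := md_comp (I₁ := 𝓘(ℝ, ℝ × ℝ)) (I₂ := 𝓡 6) (I₃ := 𝓡 7) (g := (Subtype.val : N → M))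
    (f := fun w => expT w • m) 0 (h.mdifferentiable_val _)
    ((contMDiff_orbit 6 m).mdifferentiable (by simp) _)
  have h2 : (Subtype.val : N → M) ∘ (fun w => expT w • m) = fun w => expT w • (m : M) := by
    ext1 w; exact h.coe_smul _ _
  have h3 : expT 0 • m = m := by rw [expT_zero, one_smul]
  rw [h2, h3] at h1
  exact (congrArg (fun L => L v) h1).symm

lemma md_proj_orbitDeriv (h : IsReduction φ v₁ v₂ f c N) (m : N) (v : ℝ × ℝ) :
    md (𝓡 6) (𝓡 4) (proj N) m (orbitDeriv 6 m v) = 0 := by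
  have h1 := md_comp (I₁ := 𝓘(ℝ, ℝ × ℝ)) (I₂ := 𝓡 6) (I₃ := 𝓡 4) (g := proj N)
    (f := fun w => expT w • m) 0 (h.mdifferentiable_proj _)
    ((contMDiff_orbit 6 m).mdifferentiable (by simp) _)
  have h2 : proj N ∘ (fun w => expT w • m) = fun _ => proj N m := by
    ext1 w; exact h.proj_smul _ _
  have h3 : expT 0 • m = m := by rw [expT_zero, one_smul]
  rw [h2, h3, md_const] at h1
  exact (congrArg (fun L => L v) h1).symm

lemma exists_eq_orbitDeriv (h : IsReduction φ v₁ v₂ f c N) (m : N) {u : Euc 6}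
    (hu : md (𝓡 6) (𝓡 4) (proj N) m u = 0) : ∃ v, orbitDeriv 6 m v = u := by
  set B := (md (𝓡 6) (𝓡 4) (proj N) m).toLinearMap
  have h1 := LinearMap.finrank_range_add_finrank_ker B
  have h2 : LinearMap.range B = ⊤ := LinearMap.range_eq_top.2 (h.md_proj_surjective m)
  have h3 := LinearMap.finrank_range_of_inj (f := (orbitDeriv 6 m).toLinearMap)
    (orbitDeriv_injective (h.free_coe m))
  have h4 : LinearMap.range (orbitDeriv 6 m).toLinearMap ≤ LinearMap.ker B := by
    rintro _ ⟨v, rfl⟩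
    exact h.md_proj_orbitDeriv m v
  have h5 : LinearMap.range (orbitDeriv 6 m).toLinearMap = LinearMap.ker B := by
    refine Submodule.eq_of_le_of_finrank_eq h4 ?_
    have h6 : 4 + Module.finrank ℝ (LinearMap.ker B) = 6 := by
      rw [h2, finrank_top] at h1
      simpa using h1
    have h7 : Module.finrank ℝ (LinearMap.range (orbitDeriv 6 m).toLinearMap) = 2 := by
      simpa using h3
    have h8 : Module.finrank ℝ (LinearMap.ker B) = 2 := by omega
    exact h7.trans h8.symm
  have h6 : u ∈ LinearMap.ker B := hu
  rw [← h5] at h6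
  exact h6

lemma md_map_md_val (h : IsReduction φ v₁ v₂ f c N) (m : N) (u : Euc 6) :
    md (𝓡 7) 𝓘(ℝ, ℝ) f (m : M) (md (𝓡 6) (𝓡 7) (Subtype.val : N → M) m u) = 0 := by
  have h1 := md_comp (I₁ := 𝓡 6) (I₂ := 𝓡 7) (I₃ := 𝓘(ℝ, ℝ)) (g := f)
    (f := (Subtype.val : N → M)) m (h.contMDiff_map.mdifferentiable (by simp) _)
    (h.mdifferentiable_val _)
  have h2 : f ∘ (Subtype.val : N → M) = fun _ => c := by
    ext1 x; exact (h.mem_iff x).1 x.2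
  rw [h2, md_const] at h1
  exact (congrArg (fun L => L u) h1).symm

lemma exists_md_val_eq (h : IsReduction φ v₁ v₂ f c N) (m : N) {w : Euc 7}
    (hw : md (𝓡 7) 𝓘(ℝ, ℝ) f (m : M) w = 0) :
    ∃ u, md (𝓡 6) (𝓡 7) (Subtype.val : N → M) m u = w := by
  set F := (md (𝓡 7) 𝓘(ℝ, ℝ) f (m : M)).toLinearMap
  set A := (md (𝓡 6) (𝓡 7) (Subtype.val : N → M) m).toLinearMap
  have h1 := LinearMap.finrank_range_add_finrank_ker F
  have h2 : LinearMap.range F = ⊤ := LinearMap.range_eq_top.2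
    (h.isDifferentialOf.md_surjective h.exists_frame h.indep (h.free m m.2))
  have h3 := LinearMap.finrank_range_of_inj (f := A)
    (IsImmersion.md_injective h.embedding.isImmersion m)
  have h5 : LinearMap.range A = LinearMap.ker F := by
    refine Submodule.eq_of_le_of_finrank_eq ?_ ?_
    · rintro _ ⟨v, rfl⟩
      exact h.md_map_md_val m v
    · rw [h2, finrank_top, finrank_euclideanSpace_fin, Module.finrank_self] at h1
      rw [h3, finrank_euclideanSpace_fin]
      omega
  have h6 : w ∈ LinearMap.ker F := hw
  rw [← h5] at h6
  exact h6

/-- The derivative of the inclusion, in the frame of the `G₂`-form. -/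
def valAt (φ : DForm 7 M 3 ℝ) (m : N) : Euc 6 →L[ℝ] Euc 7 :=
  (frameAt φ (m : M) : Euc 7 →L[ℝ] Euc 7).comp (md (𝓡 6) (𝓡 7) (Subtype.val : N → M) m)

lemma valAt_orbitDeriv (h : IsReduction φ v₁ v₂ f c N) (m : N) (v : ℝ × ℝ) :
    valAt φ m (orbitDeriv 6 m v) = genAt φ (m : M) v :=
  congrArg (frameAt φ (m : M)) (h.md_val_orbitDeriv m v)

lemma phi0_valAt (h : IsReduction φ v₁ v₂ f c N) (m : N) (u : Euc 6) :
    phi0 ![genAt φ (m : M) v₂, genAt φ (m : M) v₁, valAt φ m u] = 0 := by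
  rw [← h.md_map_md_val m u, h.isDifferentialOf.md_eq h.exists_frame]
  rfl

lemma isReducedAt (h : IsReduction φ v₁ v₂ f c N) (m : N) :
    IsReducedAt (valAt φ m) (md (𝓡 6) (𝓡 4) (proj N) m) (genAt φ (m : M) v₁)
      (genAt φ (m : M) v₂) where
  injective := (frameAt φ (m : M)).injective.comp
    (IsImmersion.md_injective h.embedding.isImmersion m)
  exists_eq w hw := by
    obtain ⟨u, hu⟩ := h.exists_md_val_eq m (w := (frameAt φ (m : M)).symm w) (by
      rw [h.isDifferentialOf.md_eq h.exists_frame, ContinuousLinearEquiv.apply_symm_apply, hw])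
    refine ⟨u, ?_⟩
    exact (congrArg (frameAt φ (m : M)) hu).trans ((frameAt φ (m : M)).apply_symm_apply w)
  surjective := h.md_proj_surjective m
  ker_iff u := by
    have hinj : Function.Injective (valAt φ m) := (frameAt φ (m : M)).injective.comp
      (IsImmersion.md_injective h.embedding.isImmersion m)
    rw [Submodule.mem_span_pair]
    constructor
    · intro hu
      obtain ⟨v, rfl⟩ := h.exists_eq_orbitDeriv m hu
      obtain ⟨a, b, rfl⟩ := exists_eq_of_linearIndependent h.indep v
      exact ⟨a, b, by rw [h.valAt_orbitDeriv, map_add, map_smul, map_smul]⟩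
    · rintro ⟨a, b, hab⟩
      have h1 : u = orbitDeriv 6 m (a • v₁ + b • v₂) := hinj (by
        rw [h.valAt_orbitDeriv, map_add, map_smul, map_smul, hab])
      rw [h1, h.md_proj_orbitDeriv]

/-! ### Descent of forms -/

/-- Invariant horizontal forms descend to the quotient. -/
lemma exists_descent (h : IsReduction φ v₁ v₂ f c N) {α : DForm 7 M 2 ℝ} (hα : PreservesForm α)
    (hor : ∀ (m : N) v u, formAt α (m : M)
      ![orbitDeriv 7 (m : M) v, md (𝓡 6) (𝓡 7) (Subtype.val : N → M) m u] = 0) :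
    ∃ β : DForm 4 (OrbitSpace N) 2 ℝ,
      formPullback 6 4 (proj N) β = formPullback 6 7 (Subtype.val : N → M) α := by
  have hRi : ∀ m : N, ∃ L : Euc 4 →L[ℝ] Euc 6, ∀ x, md (𝓡 6) (𝓡 4) (proj N) m (L x) = x := by
    intro m
    obtain ⟨g, hg⟩ := (md (𝓡 6) (𝓡 4) (proj N) m).toLinearMap.exists_rightInverse_of_surjective
      (LinearMap.range_eq_top.2 (h.md_proj_surjective m))
    exact ⟨LinearMap.toContinuousLinearMap g, fun x => congrArg (fun L => L x) hg⟩
  choose L hL using hRi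
  let ρ : ∀ m : N, Euc 6 [⋀^Fin 2]→L[ℝ] ℝ := fun m =>
    (formAt α (m : M)).compContinuousLinearMap (md (𝓡 6) (𝓡 7) (Subtype.val : N → M) m)
  -- The form at q is defined at one representative of q through one right inverse of dπ;
  -- horizontality removes the dependence on the right inverse, invariance the dependence on the
  -- representative.
  let β : OrbitSpace N → Euc 4 [⋀^Fin 2]→L[ℝ] ℝ := fun q =>
    (ρ q.out).compContinuousLinearMap (L q.out)
  have hρ : ∀ m v u, ρ m ![orbitDeriv 6 m v, u] = 0 := fun m v u => by
    rw [comp_two, h.md_val_orbitDeriv]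
    exact hor m v u
  have key : ∀ (m : N), (β (proj N m)).compContinuousLinearMap (md (𝓡 6) (𝓡 4) (proj N) m) =
      ρ m := by
    intro m
    have hq : proj N (proj N m).out = proj N m := Quotient.out_eq _
    obtain ⟨t, ht⟩ := h.exists_smul_eq hq.symm
    set m₀ := (proj N m).out
    have h0 : (β (proj N m)).compContinuousLinearMap (md (𝓡 6) (𝓡 4) (proj N) m₀) = ρ m₀ := by
      -- L (dπ x) - x is in the kernel of dπ, hence tangent to the orbit, and such vectors are
      -- killed by the form.
      have hsub : ∀ x z, ρ m₀ ![L m₀ (md (𝓡 6) (𝓡 4) (proj N) m₀ x) - x, z] = 0 := by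
        intro x z
        obtain ⟨v, hv⟩ := h.exists_eq_orbitDeriv m₀
          (u := L m₀ (md (𝓡 6) (𝓡 4) (proj N) m₀ x) - x) (by rw [map_sub, hL, sub_self])
        rw [← hv]
        exact hρ m₀ v z
      refine alternating_two_ext fun x y => ?_
      rw [comp_two, comp_two]
      exact map_two_eq_of_sub (hsub x) (hsub y)
    -- An arbitrary point m is t • m₀, and the derivative B of t on N intertwines both dπ and the
    -- restricted form.
    obtain ⟨B, hB⟩ := exists_md_smul_equiv (n := 6) t m₀
    have hd := (contMDiff_smul_left 6 t).mdifferentiable (by simp) m₀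
    have h1 := md_comp (I₁ := 𝓡 6) (I₂ := 𝓡 6) (I₃ := 𝓡 4) (g := proj N)
      (f := fun x : N => t • x) m₀ (h.mdifferentiable_proj _) hd
    have h2 : proj N ∘ (fun x : N => t • x) = proj N := by
      ext1 x; exact h.proj_smul t x
    have h3 := md_comp (I₁ := 𝓡 6) (I₂ := 𝓡 6) (I₃ := 𝓡 7) (g := (Subtype.val : N → M))
      (f := fun x : N => t • x) m₀ (h.mdifferentiable_val _) hd
    have h4 : (Subtype.val : N → M) ∘ (fun x : N => t • x) =
        (fun x : M => t • x) ∘ (Subtype.val : N → M) := by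
      ext1 x; exact h.coe_smul t x
    rw [h4, md_comp (I₂ := 𝓡 7) m₀ ((contMDiff_smul_left 7 t).mdifferentiable (by simp) _)
      (h.mdifferentiable_val _)] at h3
    have h5 : (ρ (t • m₀)).compContinuousLinearMap (B : Euc 6 →L[ℝ] Euc 6) = ρ m₀ := by
      refine alternating_two_ext fun x y => ?_
      have h6 := hα.formAt_smul t (m₀ : M)
      have h7 : ∀ x, md (𝓡 6) (𝓡 7) (Subtype.val : N → M) (t • m₀) (B x) =
          md (𝓡 7) (𝓡 7) (fun x : M => t • x) m₀
            (md (𝓡 6) (𝓡 7) (Subtype.val : N → M) m₀ x) := fun x => by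
        have := congrArg (fun L => L x) h3
        rw [← hB] at this
        exact this.symm
      rw [comp_two, comp_two, comp_two, ← h6, comp_two]
      simp only [ContinuousLinearEquiv.coe_coe]
      rw [h7, h7, h.coe_smul]
    rw [h2, ← hB] at h1
    rw [ht] at h1 h5
    refine compContinuousLinearMap_cancel (A := (B : Euc 6 →L[ℝ] Euc 6)) B.surjective ?_
    rw [h5, ← h0, h1]
    rfl
  refine ⟨β, ?_⟩
  ext1 m
  exact key m

lemma formPullback_proj_injective (h : IsReduction φ v₁ v₂ f c N)
    {β β' : DForm 4 (OrbitSpace N) 2 ℝ}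
    (hβ : formPullback 6 4 (proj N) β = formPullback 6 4 (proj N) β') : β = β' := by
  ext1 q
  obtain ⟨m, rfl⟩ := Quotient.exists_rep q
  exact compContinuousLinearMap_cancel (h.md_proj_surjective m) (congrFun hβ m)

lemma formAt_descent {α : DForm 7 M 2 ℝ} {β : DForm 4 (OrbitSpace N) 2 ℝ}
    (hβ : formPullback 6 4 (proj N) β = formPullback 6 7 (Subtype.val : N → M) α) (m : N)
    (x y : Euc 6) :
    formAt β (proj N m) ![md (𝓡 6) (𝓡 4) (proj N) m x, md (𝓡 6) (𝓡 4) (proj N) m y] =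
      formAt α (m : M) ![md (𝓡 6) (𝓡 7) (Subtype.val : N → M) m x,
        md (𝓡 6) (𝓡 7) (Subtype.val : N → M) m y] := by
  have h1 : formAt (formPullback 6 4 (proj N) β) m =
      formAt (formPullback 6 7 (Subtype.val : N → M) α) m := by rw [hβ]
  rw [formAt_formPullback, formAt_formPullback] at h1
  rw [← comp_two, h1, comp_two]

/-- Through a local section σ the chart expression of β is the pullback of α by the smooth map σ
followed by the inclusion into M. So β inherits smoothness and closedness from M without exterior
derivatives on N. -/
lemma isClosedForm_descent (h : IsReduction φ v₁ v₂ f c N) {α : DForm 7 M 2 ℝ}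
    (hα : IsClosedForm α) {β : DForm 4 (OrbitSpace N) 2 ℝ}
    (hβ : formPullback 6 4 (proj N) β = formPullback 6 7 (Subtype.val : N → M) α) :
    IsClosedForm β := by
  apply isClosedForm_of_chartRep
  intro q y hy
  obtain ⟨σ, hσ, hσp⟩ := h.exists_section q
  have hopen := (isOpen_extChartAt_target (I := 𝓡 4) q)
  have hσy : ∀ z ∈ (extChartAt (𝓡 4) q).target, ContMDiffAt 𝓘(ℝ, Euc 4) (𝓡 6) ∞ σ z :=
    fun z hz => hσ.contMDiffAt (hopen.mem_nhds hz)
  have hev : chartRep β q =ᶠ[𝓝 y] pullRep α ((Subtype.val : N → M) ∘ σ) := by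
    filter_upwards [hopen.mem_nhds hy] with z hz
    have hσd := (hσy z hz).mdifferentiableAt (by simp)
    rw [← pullRep_formPullback α hσd (h.mdifferentiable_val _), ← hβ,
      pullRep_formPullback β hσd (h.mdifferentiable_proj _), chartRep_eq_pullRep, pullRep, pullRep]
    have h1 : (extChartAt (𝓡 4) q).symm =ᶠ[𝓝 z] proj N ∘ σ := by
      filter_upwards [hopen.mem_nhds hz] with w hw using (hσp w hw).symm
    rw [md_congr h1, h1.self_of_nhds]
  have hg : ContMDiffAt 𝓘(ℝ, Euc 4) (𝓡 7) ∞ ((Subtype.val : N → M) ∘ σ) y :=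
    h.embedding.contMDiff.contMDiffAt.comp y (hσy y hy)
  refine ⟨(hα.1.contDiffAt_pullRep hg).congr_of_eventuallyEq hev, ?_⟩
  rw [hev.extDeriv_eq, hα.extDeriv_pullRep hg]

end IsReduction

/-! ### Almost complex structures from triples of forms -/

section Triple

variable {Q : Type*} [TopologicalSpace Q] [ChartedSpace (Euc 4) Q] [IsManifold (𝓡 4) ∞ Q]
  {ϖ η₁ η₂ : DForm 4 Q 2 ℝ}

/-- The complex structure determined by `η₁` and `η₂`. -/
def tripleJ (η₁ η₂ : DForm 4 Q 2 ℝ) (q : Q) : TangentSpace (𝓡 4) q →L[ℝ] TangentSpace (𝓡 4) q :=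
  quotientJ (formAt η₁ q, formAt η₂ q)

/-- The complex structure, as an endomorphism of the model space. -/
def tripleJAt (η₁ η₂ : DForm 4 Q 2 ℝ) (q : Q) : Euc 4 →L[ℝ] Euc 4 :=
  quotientJ (formAt η₁ q, formAt η₂ q)

/-- The pointwise condition on the three forms. -/
def AreTransverse (ϖ η₁ η₂ : DForm 4 Q 2 ℝ) : Prop :=
  ∀ q, IsTransverseTriple (formAt ϖ q) (formAt η₁ q) (formAt η₂ q) (tripleJAt η₁ η₂ q)

lemma AreTransverse.isSymplectic (h : AreTransverse ϖ η₁ η₂) (hϖ : IsClosedForm ϖ) :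
    IsSymplectic ϖ :=
  ⟨hϖ, fun q u hu => (h q).nondeg_omega u hu⟩

lemma AreTransverse.isCompatible (h : AreTransverse ϖ η₁ η₂) :
    IsCompatible ϖ (tripleJ η₁ η₂) :=
  fun q u => ⟨fun v => (h q).compat u v, fun hu => (h q).pos u hu⟩

/-- The pointwise relations pass to the chart, so by uniqueness the coordinate matrix of J is
`quotientJ` of the chart expressions of η₁ and η₂. This yields smoothness of J. -/
lemma AreTransverse.chart (h : AreTransverse ϖ η₁ η₂) (x : Q) {q : Q}
    (hq : q ∈ (chartAt (Euc 4) x).source) :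
    IsTransverseTriple (chartRep ϖ x (extChartAt (𝓡 4) x q)) (chartRep η₁ x (extChartAt (𝓡 4) x q))
      (chartRep η₂ x (extChartAt (𝓡 4) x q))
      ((md (𝓡 4) 𝓘(ℝ, Euc 4) (extChartAt (𝓡 4) x) q).comp ((tripleJAt η₁ η₂ q).comp
        (md 𝓘(ℝ, Euc 4) (𝓡 4) (extChartAt (𝓡 4) x).symm (extChartAt (𝓡 4) x q)))) := by
  have hb := md_chart_bijective (IsManifold.chart_mem_maximalAtlas (n := ∞) (I := 𝓡 4) x) hq
  have hl : (extChartAt (𝓡 4) x).symm (extChartAt (𝓡 4) x q) = q :=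
    (extChartAt (𝓡 4) x).left_inv (by rwa [extChartAt_source])
  have h1 := (h q).pullback
    (md 𝓘(ℝ, Euc 4) (𝓡 4) (extChartAt (𝓡 4) x).symm (extChartAt (𝓡 4) x q))
    (md (𝓡 4) 𝓘(ℝ, Euc 4) (extChartAt (𝓡 4) x) q)
    (fun v => congrArg (fun L => L v) hb.2) (fun v => congrArg (fun L => L v) hb.1)
  rw [chartRep_eq_pullRep, chartRep_eq_pullRep, chartRep_eq_pullRep, pullRep, pullRep, pullRep, hl]
  exact h1

lemma contMDiffAt_extChartAt_comp_right {G : Type*} [NormedAddCommGroup G] [NormedSpace ℝ G]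
    {g : Euc 4 → G} (x : Q) (hg : ContDiffAt ℝ ∞ g (extChartAt (𝓡 4) x x)) :
    ContMDiffAt (𝓡 4) 𝓘(ℝ, G) ∞ (fun q => g (extChartAt (𝓡 4) x q)) x :=
  (contMDiffAt_iff_contDiffAt.2 hg).comp x contMDiffAt_extChartAt

lemma AreTransverse.isAlmostComplex (h : AreTransverse ϖ η₁ η₂) (h₁ : IsSmoothForm η₁)
    (h₂ : IsSmoothForm η₂) : IsAlmostComplex (tripleJ η₁ η₂) := by
  refine ⟨fun x => ?_, fun q u => (h q).sq u⟩
  rw [contMDiffAt_hom_bundle]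
  refine ⟨contMDiffAt_id, ?_⟩
  have hx := mem_extChartAt_target (I := 𝓡 4) x
  have h3 : ContDiffAt ℝ ∞ (fun y => quotientJ (chartRep η₁ x y, chartRep η₂ x y))
      (extChartAt (𝓡 4) x x) :=
    ContDiffAt.comp _ (g := quotientJ)
      (h.chart x (mem_chart_source _ x)).contDiffAt_quotientJ
      ((h₁.contDiffAt_chartRep hx).prodMk (h₂.contDiffAt_chartRep hx))
  refine (contMDiffAt_extChartAt_comp_right x h3).congr_of_eventuallyEq ?_
  filter_upwards [(chartAt (Euc 4) x).open_source.mem_nhds (mem_chart_source _ x)] with q hq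
  rw [((h.chart x hq).quotient_eq).2.1]
  simp only [ContinuousLinearMap.inCoordinates]
  rw [TangentBundle.continuousLinearMapAt_trivializationAt hq,
    TangentBundle.symmL_trivializationAt hq]
  simp only [mfld_simps, mfderivWithin_univ]
  rfl

/-- The form `η₁(J·, ·)`, written in terms of `η₁` and `η₂`. -/
def rotatedForm (η : (Euc 4 [⋀^Fin 2]→L[ℝ] ℝ) × (Euc 4 [⋀^Fin 2]→L[ℝ] ℝ)) :
    Euc 4 [⋀^Fin 2]→L[ℝ] ℝ :=
  (quotientIm η)⁻¹ • (quotientRe η • η.1 - η.2)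

/-- The complex form `η₁ - i η₁(J·, ·)`. -/
def complexForm (η : (Euc 4 [⋀^Fin 2]→L[ℝ] ℝ) × (Euc 4 [⋀^Fin 2]→L[ℝ] ℝ)) :
    Euc 4 [⋀^Fin 2]→L[ℝ] ℂ :=
  Complex.ofRealCLM.compContinuousAlternatingMap η.1 -
    (Complex.I • Complex.ofRealCLM).compContinuousAlternatingMap (rotatedForm η)

lemma complexForm_apply (η : (Euc 4 [⋀^Fin 2]→L[ℝ] ℝ) × (Euc 4 [⋀^Fin 2]→L[ℝ] ℝ))
    (w : Fin 2 → Euc 4) : complexForm η w = η.1 w - Complex.I * rotatedForm η w := rfl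

lemma IsTransverseTriple.rotatedForm_apply {ϖ η₁ η₂ : Euc 4 [⋀^Fin 2]→L[ℝ] ℝ}
    {J : Euc 4 →L[ℝ] Euc 4} (h : IsTransverseTriple ϖ η₁ η₂ J) (x y : Euc 4) :
    rotatedForm (η₁, η₂) ![x, y] = η₁ ![J x, y] := by
  obtain ⟨hb, -, hrel⟩ := h.quotient_eq
  have h1 : rotatedForm (η₁, η₂) ![x, y] = (quotientIm (η₁, η₂))⁻¹ *
    (quotientRe (η₁, η₂) * η₁ ![x, y] - η₂ ![x, y]) := rfl
  rw [h1, hrel]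
  field_simp
  ring

lemma IsTransverseTriple.contDiffAt_complexForm {ϖ η₁ η₂ : Euc 4 [⋀^Fin 2]→L[ℝ] ℝ}
    {J : Euc 4 →L[ℝ] Euc 4} (h : IsTransverseTriple ϖ η₁ η₂ J) :
    ContDiffAt ℝ ∞ complexForm (η₁, η₂) := by
  have h1 : ContDiffAt ℝ ∞ rotatedForm (η₁, η₂) :=
    (h.contDiffAt_quotientIm.inv h.quotient_eq.1.ne').smul
      ((h.contDiffAt_quotientRe.smul contDiffAt_fst).sub contDiffAt_snd)
  have h2 : ∀ L : ℝ →L[ℝ] ℂ, ContDiff ℝ ∞ fun η : Euc 4 [⋀^Fin 2]→L[ℝ] ℝ =>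
      L.compContinuousAlternatingMap η := fun L =>
    (ContinuousLinearMap.compContinuousAlternatingMapCLM ℝ (Euc 4) ℝ ℂ (ι := Fin 2) L).contDiff
  exact ((h2 _).contDiffAt.comp _ contDiffAt_fst).sub ((h2 _).contDiffAt.comp _ h1)

/-- For Ω = η₁ - i η₁(J·, ·), J² = -1 gives Ω(Ju, v) = i Ω(u, v). The real part η₁ is nondegenerate,
so Ω vanishes nowhere. -/
lemma AreTransverse.hasTrivialCanonicalBundle (h : AreTransverse ϖ η₁ η₂) (h₁ : IsSmoothForm η₁)
    (h₂ : IsSmoothForm η₂) : HasTrivialCanonicalBundle (tripleJ η₁ η₂) := by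
  let Ω : DForm 4 Q 2 ℂ := fun q => complexForm (formAt η₁ q, formAt η₂ q)
  have hΩ : ∀ q (u v : Euc 4), formAt Ω q ![u, v] =
      formAt η₁ q ![u, v] - Complex.I * formAt η₁ q ![tripleJAt η₁ η₂ q u, v] := fun q u v => by
    rw [← (h q).rotatedForm_apply]
    rfl
  refine ⟨Ω, fun x y hy => ?_, fun q hq => ?_, fun q u v => ?_⟩
  · have hy' : (extChartAt (𝓡 4) x).symm y ∈ (chartAt (Euc 4) x).source := by
      rw [← extChartAt_source (𝓡 4)]
      exact (extChartAt (𝓡 4) x).map_target hy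
    have h3 := h.chart x hy'
    rw [(extChartAt (𝓡 4) x).right_inv hy] at h3
    refine ((ContDiffAt.comp y (g := complexForm) h3.contDiffAt_complexForm
      ((h₁.contDiffAt_chartRep hy).prodMk (h₂.contDiffAt_chartRep hy))).congr_of_eventuallyEq
        ?_).contDiffWithinAt
    filter_upwards [(isOpen_extChartAt_target x).mem_nhds hy] with z hz
    have hz' : (extChartAt (𝓡 4) x).symm z ∈ (chartAt (Euc 4) x).source := by
      rw [← extChartAt_source (𝓡 4)]
      exact (extChartAt (𝓡 4) x).map_target hz
    have h4 := h.chart x hz'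
    rw [(extChartAt (𝓡 4) x).right_inv hz] at h4
    have hb := md_chart_bijective (IsManifold.chart_mem_maximalAtlas (n := ∞) (I := 𝓡 4) x) hz'
    have hr : extChartAt (𝓡 4) x ((extChartAt (𝓡 4) x).symm z) = z :=
      (extChartAt (𝓡 4) x).right_inv hz
    set q := (extChartAt (𝓡 4) x).symm z with hq
    set A := md 𝓘(ℝ, Euc 4) (𝓡 4) (extChartAt (𝓡 4) x).symm z with hA
    ext w
    have hw : w = ![w 0, w 1] := by
      ext1 i
      fin_cases i <;> rfl
    rw [hw]
    have h5 : ∀ {F : Type} [NormedAddCommGroup F] [NormedSpace ℝ F] (α : DForm 4 Q 2 F)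
        (u v : Euc 4),
        chartRep α x z ![u, v] = formAt α q ![A u, A v] := by
      intro F _ _ α u v
      rw [chartRep_eq_pullRep, pullRep, ContinuousAlternatingMap.compContinuousLinearMap_apply]
      congr 1
      ext1 i
      fin_cases i <;> rfl
    have h6 : A (md (𝓡 4) 𝓘(ℝ, Euc 4) (extChartAt (𝓡 4) x) q
        (tripleJAt η₁ η₂ q (A (w 0)))) = tripleJAt η₁ η₂ q (A (w 0)) := by
      have := congrArg (fun L => L (tripleJAt η₁ η₂ q (A (w 0)))) hb.2
      have h7 : chartAt (Euc 4) x q = z := hr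
      rw [h7] at this
      exact this
    rw [h5, hΩ, Function.comp_apply, complexForm_apply, h4.rotatedForm_apply, h5, h5]
    simp only [ContinuousLinearMap.comp_apply]
    rw [h6]
  · obtain ⟨x, hx⟩ := exists_ne (0 : Euc 4)
    obtain ⟨y, hy⟩ := (h q).nondeg x hx
    have h3 := hΩ q x y
    have h4 : formAt Ω q ![x, y] = 0 := by
      have : formAt Ω q = 0 := hq
      rw [this]
      rfl
    rw [h4] at h3
    apply hy
    have h5 := congrArg Complex.re h3
    simpa using h5.symm
  · have key : ∀ u v : Euc 4, formAt Ω q ![tripleJAt η₁ η₂ q u, v] =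
        Complex.I * formAt Ω q ![u, v] := by
      intro u v
      have h5 : formAt η₁ q ![-u, v] = - formAt η₁ q ![u, v] := by
        rw [← flat_apply, ← flat_apply, map_neg]
        rfl
      rw [hΩ, hΩ, (h q).sq, h5]
      push_cast
      linear_combination (formAt η₁ q ![tripleJAt η₁ η₂ q u, v] : ℂ) * Complex.I_mul_I
    exact key u v

end Triple

/-! ### The forms on the quotient -/

lemma starPhi0_linearCombination (x₁ x₂ z : Euc 7) (a b : ℝ) :
    starPhi0 ![x₂, x₁, a • x₁ + b • x₂, z] = 0 := by
  have h1 : starPhi0 ![x₂, x₁, x₁, z] = 0 :=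
    starPhi0.map_eq_zero_of_eq _ (i := 1) (j := 2) rfl (by decide)
  have h2 : starPhi0 ![x₂, x₁, x₂, z] = 0 :=
    starPhi0.map_eq_zero_of_eq _ (i := 0) (j := 2) rfl (by decide)
  have h3 : ∀ y, starPhi0 ![x₂, x₁, y, z] =
      flat ((starPhi0.curryLeft x₂).curryLeft x₁) y z := fun y => by
    rw [flat_apply, ContinuousAlternatingMap.curryLeft_apply_apply,
      ContinuousAlternatingMap.curryLeft_apply_apply]
  rw [h3] at h1 h2
  rw [h3, map_add, map_smul, map_smul, add_apply, smul_apply, smul_apply, h1, h2]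
  simp

namespace IsReduction

variable {M : Type*} [TopologicalSpace M] [ChartedSpace (Euc 7) M] [IsManifold (𝓡 7) ∞ M]
  [MulAction Torus M] [ContMDiffSMul torusModel (𝓡 7) ∞ Torus M] {φ : DForm 7 M 3 ℝ}
  {v₁ v₂ : ℝ × ℝ} {f : M → ℝ} {c : ℝ} {N : Set M}
  [ChartedSpace (Euc 6) N] [IsManifold (𝓡 6) ∞ N] [MulAction Torus N]
  [ContMDiffSMul torusModel (𝓡 6) ∞ Torus N]
  [ChartedSpace (Euc 4) (OrbitSpace N)] [IsManifold (𝓡 4) ∞ (OrbitSpace N)]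

lemma frameAt_orbitDeriv (m : M) (v : ℝ × ℝ) :
    frameAt φ m (orbitDeriv 7 m v) = genAt φ m v := rfl

lemma frameAt_md_val (m : N) (u : Euc 6) :
    frameAt φ (m : M) (md (𝓡 6) (𝓡 7) (Subtype.val : N → M) m u) = valAt φ m u := rfl

lemma formAt_interiorProduct_phi (h : IsReduction φ v₁ v₂ f c N) (v : ℝ × ℝ) (m : M)
    (x y : Euc 7) : formAt (interiorProduct (flowField v) φ) m ![x, y] =
      phi0 ![genAt φ m v, frameAt φ m x, frameAt φ m y] := by
  rw [formAt_interiorProduct_flowField, formAt_eq_phi0 h.exists_frame,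
    ContinuousAlternatingMap.curryLeft_apply_apply,
    ContinuousAlternatingMap.compContinuousLinearMap_apply]
  congr 1
  ext1 i
  fin_cases i <;> rfl

lemma formAt_interiorProduct_star (v w : ℝ × ℝ) (m : M) (x y : Euc 7) :
    formAt (interiorProduct (flowField v) (interiorProduct (flowField w) (g2Star φ))) m ![x, y] =
      starPhi0 ![genAt φ m w, genAt φ m v, frameAt φ m x, frameAt φ m y] := by
  rw [formAt_interiorProduct_flowField, formAt_interiorProduct_flowField, formAt_g2Star,
    ContinuousAlternatingMap.curryLeft_apply_apply, ContinuousAlternatingMap.curryLeft_apply_apply,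
    ContinuousAlternatingMap.compContinuousLinearMap_apply]
  congr 1
  ext1 i
  fin_cases i <;> rfl

/-- The cross product of two generating fields is a multiple of X₂ × X₁, the gradient of f, which is
normal to N. So i_X φ restricted to N is horizontal. -/
lemma phi0_genAt_valAt (h : IsReduction φ v₁ v₂ f c N) (v w : ℝ × ℝ) (m : N) (u : Euc 6) :
    phi0 ![genAt φ (m : M) v, genAt φ (m : M) w, valAt φ m u] = 0 := by
  have h1 := h.phi0_valAt m u
  obtain ⟨a, b, rfl⟩ := exists_eq_of_linearIndependent h.indep v
  obtain ⟨a', b', rfl⟩ := exists_eq_of_linearIndependent h.indep w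
  rw [← inner_cross0] at h1 ⊢
  simp only [map_add, map_smul, cross0_add_left, cross0_add_right, cross0_smul_left,
    cross0_smul_right, cross0_self, inner_add_left, inner_smul_left, inner_zero_left, h1,
    cross0_swap (genAt φ (m : M) v₁) (genAt φ (m : M) v₂), inner_neg_left]
  simp

lemma starPhi0_genAt (h : IsReduction φ v₁ v₂ f c N) (v : ℝ × ℝ) (m : M) (x : Euc 7) :
    starPhi0 ![genAt φ m v₂, genAt φ m v₁, genAt φ m v, x] = 0 := by
  obtain ⟨a, b, rfl⟩ := exists_eq_of_linearIndependent h.indep v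
  rw [map_add, map_smul, map_smul]
  exact starPhi0_linearCombination _ _ _ a b

lemma exists_descent_phi (h : IsReduction φ v₁ v₂ f c N) (v : ℝ × ℝ) :
    ∃ β : DForm 4 (OrbitSpace N) 2 ℝ, formPullback 6 4 (proj N) β =
      formPullback 6 7 (Subtype.val : N → M) (interiorProduct (flowField v) φ) := by
  refine h.exists_descent (h.preserves.interiorProduct v) fun m w u => ?_
  rw [h.formAt_interiorProduct_phi, frameAt_orbitDeriv, frameAt_md_val]
  exact h.phi0_genAt_valAt v w m u

lemma exists_descent_star (h : IsReduction φ v₁ v₂ f c N) :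
    ∃ β : DForm 4 (OrbitSpace N) 2 ℝ, formPullback 6 4 (proj N) β =
      formPullback 6 7 (Subtype.val : N → M)
        (interiorProduct (flowField v₁) (interiorProduct (flowField v₂) (g2Star φ))) := by
  refine h.exists_descent (((PreservesForm.g2Star h.exists_frame h.preserves).interiorProduct
    v₂).interiorProduct v₁) fun m w u => ?_
  rw [formAt_interiorProduct_star, frameAt_orbitDeriv]
  exact h.starPhi0_genAt w m _

/-- The forms on the quotient. -/
structure IsReducedTriple (φ : DForm 7 M 3 ℝ) (v₁ v₂ : ℝ × ℝ)
    (ϖ η₁ η₂ : DForm 4 (OrbitSpace N) 2 ℝ) : Prop where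
  pullback_omega : formPullback 6 4 (proj N) ϖ = formPullback 6 7 (Subtype.val : N → M)
    (interiorProduct (flowField v₁) (interiorProduct (flowField v₂) (g2Star φ)))
  pullback_eta₁ : formPullback 6 4 (proj N) η₁ = formPullback 6 7 (Subtype.val : N → M)
    (interiorProduct (flowField v₁) φ)
  pullback_eta₂ : formPullback 6 4 (proj N) η₂ = formPullback 6 7 (Subtype.val : N → M)
    (interiorProduct (flowField v₂) φ)

variable {ϖ η₁ η₂ : DForm 4 (OrbitSpace N) 2 ℝ}

/-- The complex structure in terms of the cross product. -/
lemma exists_data (h : IsReduction φ v₁ v₂ f c N) (ht : IsReducedTriple φ v₁ v₂ ϖ η₁ η₂)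
    (m : N) {e₁ e₂ : Euc 7}
    (he : IsAdaptedPair (genAt φ (m : M) v₁) (genAt φ (m : M) v₂) e₁ e₂) :
    ∃ ℓ : Euc 4 →ₗ[ℝ] Euc 6,
      IsTransverseTriple (formAt ϖ (proj N m)) (formAt η₁ (proj N m)) (formAt η₂ (proj N m))
        (tripleJAt η₁ η₂ (proj N m)) ∧
      (∀ x, md (𝓡 6) (𝓡 4) (proj N) m (ℓ x) = x) ∧ (∀ x, valAt φ m (ℓ x) ∈ transverse e₁ e₂) ∧
      (∀ x, valAt φ m (ℓ (tripleJAt η₁ η₂ (proj N m) x)) =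
        cross0 (valAt φ m (ℓ x)) (cross0 e₁ e₂)) ∧
      ∀ w ∈ transverse e₁ e₂, ∃ u, valAt φ m u = w ∧ ℓ (md (𝓡 6) (𝓡 4) (proj N) m u) = u := by
  obtain ⟨J, ℓ, hJ, hB, hT, hJl, hw⟩ := (h.isReducedAt m).exists_data he
    (ϖ := formAt ϖ (proj N m)) (η₁ := formAt η₁ (proj N m)) (η₂ := formAt η₂ (proj N m))
    (fun x y => by
      rw [formAt_descent ht.pullback_omega, formAt_interiorProduct_star, frameAt_md_val,
        frameAt_md_val])
    (fun x y => by
      rw [formAt_descent ht.pullback_eta₁, h.formAt_interiorProduct_phi, frameAt_md_val,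
        frameAt_md_val])
    (fun x y => by
      rw [formAt_descent ht.pullback_eta₂, h.formAt_interiorProduct_phi, frameAt_md_val,
        frameAt_md_val])
  -- J was built from e₁, e₂ at m, but uniqueness identifies it with the structure defined by the
  -- forms alone.
  have hJe : J = tripleJAt η₁ η₂ (proj N m) := hJ.quotient_eq.2.1.symm
  subst hJe
  exact ⟨ℓ, hJ, hB, hT, hJl, hw⟩

lemma areTransverse (h : IsReduction φ v₁ v₂ f c N) (ht : IsReducedTriple φ v₁ v₂ ϖ η₁ η₂) :
    AreTransverse ϖ η₁ η₂ := by
  intro q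
  obtain ⟨m, rfl⟩ := Quotient.exists_rep q
  obtain ⟨e₁, e₂, he⟩ := exists_isAdaptedPair_genAt (φ := φ) (h.free m m.2) h.indep
  obtain ⟨ℓ, hJ, -⟩ := h.exists_data ht m he
  exact hJ

lemma isAdaptedPair_of_isOrientedOrthonormalBasis {m : M} {e₁ e₂ : TangentSpace (𝓡 7) m}
    (he : IsOrientedOrthonormalBasis φ m (flowField v₁ m) (flowField v₂ m) e₁ e₂) :
    IsAdaptedPair (genAt φ m v₁) (genAt φ m v₂) (frameAt φ m e₁) (frameAt φ m e₂) := by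
  obtain ⟨⟨a, b, c, d, hD, h₁, h₂⟩, hn₁, hn₂, ho⟩ := he
  have key : ∀ a b : ℝ, frameAt φ m (a • flowField v₁ m + b • flowField v₂ m) =
      a • genAt φ m v₁ + b • genAt φ m v₂ := fun a b => by
    have h3 : ∀ x y : Euc 7, frameAt φ m (a • x + b • y) =
        a • frameAt φ m x + b • frameAt φ m y := fun x y => by rw [map_add, map_smul, map_smul]
    refine (h3 _ _).trans ?_
    rw [flowField_eq, flowField_eq]
    rfl
  exact IsAdaptedPair.of_eq hn₁ hn₂ ho hD ((congrArg (frameAt φ m) h₁).trans (key a b))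
    ((congrArg (frameAt φ m) h₂).trans (key c d))

/-- The complex structure is induced by the cross product with `e₃`. -/
lemma exists_tripleJ_eq (h : IsReduction φ v₁ v₂ f c N) (ht : IsReducedTriple φ v₁ v₂ ϖ η₁ η₂)
    (m : N) (e₁ e₂ e₃ : TangentSpace (𝓡 7) m.1)
    (he : IsOrientedOrthonormalBasis φ m.1 (flowField v₁ m.1) (flowField v₂ m.1) e₁ e₂)
    (he₃ : e₃ = g2Cross φ m.1 e₁ e₂) (w : TangentSpace (𝓡 7) m.1)
    (hw₁ : g2Metric φ m.1 w e₁ = 0) (hw₂ : g2Metric φ m.1 w e₂ = 0)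
    (hw₃ : g2Metric φ m.1 w e₃ = 0) :
    ∃ u u' : TangentSpace (𝓡 6) m,
      mfderiv (𝓡 6) (𝓡 7) (Subtype.val : N → M) m u = w ∧
      mfderiv (𝓡 6) (𝓡 7) (Subtype.val : N → M) m u' = g2Cross φ m.1 w e₃ ∧
      tripleJ η₁ η₂ (proj N m) (mfderiv (𝓡 6) (𝓡 4) (proj N) m u) =
        mfderiv (𝓡 6) (𝓡 4) (proj N) m u' := by
  obtain ⟨ℓ, -, hB, -, hJ, hw⟩ := h.exists_data ht m
    (isAdaptedPair_of_isOrientedOrthonormalBasis he)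
  have he₃' : frameAt φ m.1 e₃ = cross0 (frameAt φ m.1 e₁) (frameAt φ m.1 e₂) := by
    rw [he₃]
    exact frameAt_g2Cross φ m.1 e₁ e₂
  have hwt : frameAt φ m.1 w ∈ transverse (frameAt φ m.1 e₁) (frameAt φ m.1 e₂) := by
    rw [mem_transverse, ← he₃']
    exact ⟨hw₁, hw₂, hw₃⟩
  obtain ⟨u, hu, hℓ⟩ := hw _ hwt
  refine ⟨u, ℓ (tripleJAt η₁ η₂ (proj N m) (md (𝓡 6) (𝓡 4) (proj N) m u)),
    (frameAt φ m.1).injective hu, (frameAt φ m.1).injective ?_, (hB _).symm⟩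
  refine (hJ _).trans ?_
  rw [hℓ, hu, ← he₃']
  exact (frameAt_g2Cross φ m.1 w e₃).symm

end IsReduction

/-! ### Surfaces in the quotient and their lifts -/

section Surface

/-- The tangent space of an embedded submanifold is the kernel of a defining function. -/
lemma IsSmoothEmbedding.md_eq_zero_iff {n k : ℕ} {M : Type*} [TopologicalSpace M]
    [ChartedSpace (Euc n) M] [IsManifold (𝓡 n) ∞ M] {G : Type*} [NormedAddCommGroup G]
    [NormedSpace ℝ G] [FiniteDimensional ℝ G] {L : Set M} [ChartedSpace (Euc k) L]
    [IsManifold (𝓡 k) ∞ L] (hL : IsSmoothEmbedding (𝓡 k) (𝓡 n) ∞ (Subtype.val : L → M)) (p : L)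
    (hfr : k + Module.finrank ℝ G = n) {g : M → G} {U : Set M} (hU : IsOpen U) (hp : (p : M) ∈ U)
    (hg : ContMDiffOn (𝓡 n) 𝓘(ℝ, G) ∞ g U)
    (hs : Function.Surjective (md (𝓡 n) 𝓘(ℝ, G) g (p : M))) (hz : ∀ x ∈ U, x ∈ L → g x = 0)
    (w : Euc n) :
    md (𝓡 n) 𝓘(ℝ, G) g (p : M) w = 0 ↔
      w ∈ LinearMap.range (md (𝓡 k) (𝓡 n) (Subtype.val : L → M) p).toLinearMap := by
  set F := (md (𝓡 n) 𝓘(ℝ, G) g (p : M)).toLinearMap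
  set A := (md (𝓡 k) (𝓡 n) (Subtype.val : L → M) p).toLinearMap
  have h1 := LinearMap.finrank_range_add_finrank_ker F
  have h2 : LinearMap.range F = ⊤ := LinearMap.range_eq_top.2 hs
  have h3 := LinearMap.finrank_range_of_inj (f := A) (IsImmersion.md_injective hL.isImmersion p)
  have h4 : LinearMap.range A ≤ LinearMap.ker F := by
    rintro _ ⟨v, rfl⟩
    have h5 := md_comp (I₁ := 𝓡 k) (I₂ := 𝓡 n) (I₃ := 𝓘(ℝ, G)) (g := g)
      (f := (Subtype.val : L → M)) p
      ((hg.contMDiffAt (hU.mem_nhds hp)).mdifferentiableAt (by simp))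
      (hL.contMDiff.mdifferentiable (by simp) _)
    have h6 : g ∘ (Subtype.val : L → M) =ᶠ[𝓝 p] fun _ => 0 := by
      filter_upwards [(hU.preimage continuous_subtype_val).mem_nhds hp] with x hx
      exact hz x hx x.2
    rw [md_congr h6, md_const] at h5
    exact (congrArg (fun L => L v) h5).symm
  have h5 : LinearMap.range A = LinearMap.ker F := by
    refine Submodule.eq_of_le_of_finrank_eq h4 ?_
    rw [h2, finrank_top, finrank_euclideanSpace_fin] at h1
    rw [h3, finrank_euclideanSpace_fin]
    omega
  rw [h5]
  rfl

lemma finrank_range_md_val {n k : ℕ} {M : Type*} [TopologicalSpace M]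
    [ChartedSpace (Euc n) M] [IsManifold (𝓡 n) ∞ M] {L : Set M} [ChartedSpace (Euc k) L]
    [IsManifold (𝓡 k) ∞ L] (hL : IsSmoothEmbedding (𝓡 k) (𝓡 n) ∞ (Subtype.val : L → M)) (p : L) :
    Module.finrank ℝ
      (LinearMap.range (md (𝓡 k) (𝓡 n) (Subtype.val : L → M) p).toLinearMap) = k := by
  rw [LinearMap.finrank_range_of_inj (IsImmersion.md_injective hL.isImmersion p),
    finrank_euclideanSpace_fin]

lemma formPullback_eq_zero_iff {n k : ℕ} {M P : Type*} [TopologicalSpace M]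
    [ChartedSpace (Euc n) M] [TopologicalSpace P] [ChartedSpace (Euc k) P] {g : P → M}
    (η : DForm n M 2 ℝ) : formPullback k n g η = 0 ↔
      ∀ p, ∀ x ∈ LinearMap.range (md (𝓡 k) (𝓡 n) g p).toLinearMap,
        ∀ y ∈ LinearMap.range (md (𝓡 k) (𝓡 n) g p).toLinearMap, formAt η (g p) ![x, y] = 0 := by
  constructor
  · rintro h p _ ⟨x, rfl⟩ _ ⟨y, rfl⟩
    have h1 : formAt (formPullback k n g η) p = 0 := congrFun h p
    rw [formAt_formPullback] at h1
    refine (comp_two _ _ x y).symm.trans ?_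
    rw [h1]
    rfl
  · intro h
    ext1 p
    change formAt (formPullback k n g η) p = 0
    rw [formAt_formPullback]
    refine alternating_two_ext fun x y => ?_
    rw [comp_two]
    exact h p _ ⟨x, rfl⟩ _ ⟨y, rfl⟩

variable {Q : Type*} [TopologicalSpace Q] [ChartedSpace (Euc 4) Q] [IsManifold (𝓡 4) ∞ Q]
  {ϖ η₁ η₂ : DForm 4 Q 2 ℝ} {S : Set Q} [ChartedSpace (Euc 2) S] [IsManifold (𝓡 2) ∞ S]

lemma isPseudoholomorphic_tripleJ_iff : IsPseudoholomorphic (tripleJ η₁ η₂) 2 S ↔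
    ∀ s : S, ∀ y ∈ LinearMap.range (md (𝓡 2) (𝓡 4) (Subtype.val : S → Q) s).toLinearMap,
      tripleJAt η₁ η₂ (s : Q) y ∈
        LinearMap.range (md (𝓡 2) (𝓡 4) (Subtype.val : S → Q) s).toLinearMap := by
  constructor
  · rintro h s _ ⟨v, rfl⟩
    exact h s v
  · intro h s v
    exact h s _ ⟨v, rfl⟩

lemma AreTransverse.isPseudoholomorphic_iff (h : AreTransverse ϖ η₁ η₂)
    (hS : IsSmoothEmbedding (𝓡 2) (𝓡 4) ∞ (Subtype.val : S → Q)) :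
    IsPseudoholomorphic (tripleJ η₁ η₂) 2 S ↔
      formPullback 2 4 (Subtype.val : S → Q) η₁ = 0 ∧
      formPullback 2 4 (Subtype.val : S → Q) η₂ = 0 := by
  rw [isPseudoholomorphic_tripleJ_iff, formPullback_eq_zero_iff, formPullback_eq_zero_iff,
    ← forall_and]
  exact forall_congr' fun s => (h s).invariant_iff _ (finrank_range_md_val hS s)

end Surface

namespace IsReduction

variable {M : Type*} [TopologicalSpace M] [ChartedSpace (Euc 7) M] [IsManifold (𝓡 7) ∞ M]
  [MulAction Torus M] [ContMDiffSMul torusModel (𝓡 7) ∞ Torus M] {φ : DForm 7 M 3 ℝ}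
  {v₁ v₂ : ℝ × ℝ} {f : M → ℝ} {c : ℝ} {N : Set M}
  [ChartedSpace (Euc 6) N] [IsManifold (𝓡 6) ∞ N] [MulAction Torus N]
  [ContMDiffSMul torusModel (𝓡 6) ∞ Torus N]
  [ChartedSpace (Euc 4) (OrbitSpace N)] [IsManifold (𝓡 4) ∞ (OrbitSpace N)]
  {S : Set (OrbitSpace N)} [ChartedSpace (Euc 2) S] [IsManifold (𝓡 2) ∞ S]

/-- A defining function of the preimage of a surface. -/
lemma exists_definingFunction (h : IsReduction φ v₁ v₂ f c N)
    (hS : IsSmoothEmbedding (𝓡 2) (𝓡 4) ∞ (Subtype.val : S → OrbitSpace N)) (m : N)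
    (hm : proj N m ∈ S) :
    ∃ (g : M → ℝ × Euc 2) (U : Set M), IsOpen U ∧ (m : M) ∈ U ∧
      ContMDiffOn (𝓡 7) 𝓘(ℝ, ℝ × Euc 2) ∞ g U ∧
      Function.Surjective (md (𝓡 7) 𝓘(ℝ, ℝ × Euc 2) g (m : M)) ∧
      (∀ x ∈ U, x ∈ (Subtype.val : N → M) '' (proj N ⁻¹' S) ↔ g x = 0) ∧
      ∀ w, md (𝓡 7) 𝓘(ℝ, ℝ × Euc 2) g (m : M) w = 0 ↔
        ∃ u, md (𝓡 6) (𝓡 4) (proj N) m u ∈ LinearMap.range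
            (md (𝓡 2) (𝓡 4) (Subtype.val : S → OrbitSpace N) ⟨proj N m, hm⟩).toLinearMap ∧
          md (𝓡 6) (𝓡 7) (Subtype.val : N → M) m u = w := by
  obtain ⟨l, hl, hd⟩ := IsSmoothEmbedding.hasDefiningFunctionAt hS ⟨proj N m, hm⟩
  obtain rfl : l = 2 := by omega
  obtain ⟨k, W, hW, hmW, hk, hks, hkz⟩ := hd
  have hker := IsSmoothEmbedding.md_eq_zero_iff hS ⟨proj N m, hm⟩ (G := Euc 2) (by simp) hW hmW hk
    hks fun x hx => (hkz x hx).1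
  -- A defining function has to live on M: k is composed with π and a local retraction r of M onto
  -- N, and f - c cuts out N. The open set V' below ensures that r fixes the points of N in it.
  obtain ⟨r, U, V, hU, hV, hmU, hmV, hr, hrV⟩ :=
    IsImmersion.exists_leftInverse h.embedding.isImmersion m
  obtain ⟨V', hV', rfl⟩ := isOpen_induced_iff.1 hV
  have hrm : r (m : M) = m := (hrV m hmV).2
  have hpc : Continuous (proj N) := h.contMDiff_proj.continuous
  have hO : IsOpen (U ∩ r ⁻¹' (proj N ⁻¹' W)) :=
    hr.continuousOn.isOpen_inter_preimage hU (hW.preimage hpc)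
  let O : Set M := U ∩ r ⁻¹' (proj N ⁻¹' W) ∩ V'
  have hmO : (m : M) ∈ O := ⟨⟨hmU, by rw [mem_preimage, hrm]; exact hmW⟩, hmV⟩
  have hOo : IsOpen O := hO.inter hV'
  let k' : M → Euc 2 := k ∘ proj N ∘ r
  have hk' : ContMDiffOn (𝓡 7) 𝓘(ℝ, Euc 2) ∞ k' O :=
    hk.comp (h.contMDiff_proj.comp_contMDiffOn (hr.mono fun x hx => hx.1.1)) fun x hx => hx.1.2
  have hf : ContMDiff (𝓡 7) 𝓘(ℝ, ℝ) ∞ (fun x => f x - c) :=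
    (contMDiff_iff_contDiff.2 (contDiff_id.sub contDiff_const)).comp h.contMDiff_map
  have hg : ContMDiffOn (𝓡 7) 𝓘(ℝ, ℝ × Euc 2) ∞ (fun x => (f x - c, k' x)) O :=
    hf.contMDiffOn.prodMk_space hk'
  have hgd : MDifferentiableAt (𝓡 7) 𝓘(ℝ, ℝ × Euc 2) (fun x => (f x - c, k' x)) (m : M) :=
    (hg.contMDiffAt (hOo.mem_nhds hmO)).mdifferentiableAt (by simp)
  have hrd : MDifferentiableAt (𝓡 7) (𝓡 6) r (m : M) :=
    (hr.contMDiffAt (hU.mem_nhds hmU)).mdifferentiableAt (by simp)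
  have hkd : MDifferentiableAt (𝓡 4) 𝓘(ℝ, Euc 2) k (proj N m) :=
    (hk.contMDiffAt (hW.mem_nhds hmW)).mdifferentiableAt (by simp)
  have e₁ : ∀ w, (md (𝓡 7) 𝓘(ℝ, ℝ × Euc 2) (fun x => (f x - c, k' x)) (m : M) w).1 =
      md (𝓡 7) 𝓘(ℝ, ℝ) f (m : M) w := by
    intro w
    have h1 := md_comp (I₁ := 𝓡 7) (I₂ := 𝓘(ℝ, ℝ × Euc 2)) (I₃ := 𝓘(ℝ, ℝ))
      (g := fun y : ℝ × Euc 2 => y.1 + c) (f := fun x => (f x - c, k' x)) (m : M)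
      ((differentiable_fst.add_const c).mdifferentiable _) hgd
    have h2 : (fun y : ℝ × Euc 2 => y.1 + c) ∘ (fun x => (f x - c, k' x)) = f := by
      ext1 x
      simp
    have h3 : fderiv ℝ (fun y : ℝ × Euc 2 => y.1 + c) (f m - c, k' m) =
        ContinuousLinearMap.fst ℝ ℝ (Euc 2) := by
      rw [fderiv_add_const]
      exact fderiv_fst
    rw [h2, md_eq_fderiv, h3] at h1
    exact (congrArg (fun L => L w) h1).symm
  have e₂ : ∀ w, (md (𝓡 7) 𝓘(ℝ, ℝ × Euc 2) (fun x => (f x - c, k' x)) (m : M) w).2 =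
      md (𝓡 4) 𝓘(ℝ, Euc 2) k (proj N m) (md (𝓡 6) (𝓡 4) (proj N) m
        (md (𝓡 7) (𝓡 6) r (m : M) w)) := by
    intro w
    have h1 := md_comp (I₁ := 𝓡 7) (I₂ := 𝓘(ℝ, ℝ × Euc 2)) (I₃ := 𝓘(ℝ, Euc 2))
      (g := fun y : ℝ × Euc 2 => y.2) (f := fun x => (f x - c, k' x)) (m : M)
      (differentiable_snd.mdifferentiable _) hgd
    have h3 : fderiv ℝ (fun y : ℝ × Euc 2 => y.2) (f m - c, k' m) =
        ContinuousLinearMap.snd ℝ ℝ (Euc 2) := fderiv_snd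
    rw [md_eq_fderiv, h3] at h1
    have h4 := md_comp (I₁ := 𝓡 7) (I₂ := 𝓡 6) (I₃ := 𝓡 4) (g := proj N) (f := r) (m : M)
      (h.mdifferentiable_proj _) hrd
    have h5 := md_comp (I₁ := 𝓡 7) (I₂ := 𝓡 4) (I₃ := 𝓘(ℝ, Euc 2)) (g := k) (f := proj N ∘ r)
      (m : M) (by rw [Function.comp_apply, hrm]; exact hkd)
      ((h.mdifferentiable_proj _).comp _ hrd)
    rw [h4, Function.comp_apply, hrm] at h5
    have h6 : (fun y : ℝ × Euc 2 => y.2) ∘ (fun x => (f x - c, k' x)) = k ∘ proj N ∘ r := rfl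
    rw [h6, h5] at h1
    exact (congrArg (fun L => L w) h1).symm
  have hrv : ∀ u, md (𝓡 7) (𝓡 6) r (m : M) (md (𝓡 6) (𝓡 7) (Subtype.val : N → M) m u) = u := by
    intro u
    have h1 := md_comp (I₁ := 𝓡 6) (I₂ := 𝓡 7) (I₃ := 𝓡 6) (g := r)
      (f := (Subtype.val : N → M)) m hrd (h.mdifferentiable_val _)
    have h2 : r ∘ (Subtype.val : N → M) =ᶠ[𝓝 m] fun x => x := by
      filter_upwards [hV.mem_nhds hmV] with x hx using (hrV x hx).2
    rw [md_congr h2, md_id] at h1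
    exact (congrArg (fun L => L u) h1).symm
  refine ⟨fun x => (f x - c, k' x), O, hOo, hmO, hg, ?_, ?_, ?_⟩
  · rintro ⟨a, b⟩
    obtain ⟨w₁, hw₁⟩ := h.isDifferentialOf.md_surjective h.exists_frame h.indep (h.free m m.2) a
    obtain ⟨y, hy⟩ := hks b
    obtain ⟨u, hu⟩ := h.md_proj_surjective m y
    -- w₁ fixes the first component; the correction is tangent to N, so it does not change df and
    -- adjusts only the second.
    refine ⟨w₁ + md (𝓡 6) (𝓡 7) (Subtype.val : N → M) m (u - md (𝓡 7) (𝓡 6) r (m : M) w₁),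
      Prod.ext ?_ ?_⟩
    · rw [e₁, map_add, h.md_map_md_val, hw₁, add_zero]
    · rw [e₂, map_add, hrv, add_sub_cancel, hu]
      exact hy
  · rintro x ⟨⟨hxU, hxW⟩, hxV⟩
    rw [Prod.ext_iff]
    change _ ↔ f x - c = 0 ∧ k (proj N (r x)) = 0
    rw [sub_eq_zero]
    constructor
    · rintro ⟨y, hy, rfl⟩
      refine ⟨(h.mem_iff _).1 y.2, ?_⟩
      rw [← hkz _ hxW, (hrV y hxV).2]
      exact hy
    · rintro ⟨hxc, hx0⟩
      refine ⟨⟨x, (h.mem_iff x).2 hxc⟩, ?_, rfl⟩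
      have h1 : r x = ⟨x, (h.mem_iff x).2 hxc⟩ := (hrV ⟨x, (h.mem_iff x).2 hxc⟩ hxV).2
      rw [← hkz _ hxW, h1] at hx0
      exact hx0
  · intro w
    rw [Prod.ext_iff, e₁, e₂]
    constructor
    · rintro ⟨h1, h2⟩
      obtain ⟨u, rfl⟩ := h.exists_md_val_eq m h1
      rw [hrv] at h2
      exact ⟨u, (hker _).1 h2, rfl⟩
    · rintro ⟨u, hu, rfl⟩
      refine ⟨h.md_map_md_val m u, ?_⟩
      rw [hrv]
      exact (hker _).2 hu

/-- The tangent spaces of the preimage of a surface. -/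
lemma exists_md_val_preimage_iff (h : IsReduction φ v₁ v₂ f c N)
    (hS : IsSmoothEmbedding (𝓡 2) (𝓡 4) ∞ (Subtype.val : S → OrbitSpace N))
    [ChartedSpace (Euc 4) ((Subtype.val : N → M) '' (proj N ⁻¹' S))]
    [IsManifold (𝓡 4) ∞ ((Subtype.val : N → M) '' (proj N ⁻¹' S))]
    (hL : IsSmoothEmbedding (𝓡 4) (𝓡 7) ∞
      (Subtype.val : ((Subtype.val : N → M) '' (proj N ⁻¹' S)) → M))
    (m : N) (hm : proj N m ∈ S) (w : Euc 7) :
    (∃ u, md (𝓡 4) (𝓡 7) (Subtype.val : ((Subtype.val : N → M) '' (proj N ⁻¹' S)) → M)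
      ⟨m, m, hm, rfl⟩ u = w) ↔
    ∃ u, md (𝓡 6) (𝓡 4) (proj N) m u ∈ LinearMap.range
        (md (𝓡 2) (𝓡 4) (Subtype.val : S → OrbitSpace N) ⟨proj N m, hm⟩).toLinearMap ∧
      md (𝓡 6) (𝓡 7) (Subtype.val : N → M) m u = w := by
  obtain ⟨g, U, hU, hmU, hg, hgs, hgz, hgw⟩ := h.exists_definingFunction hS m hm
  rw [← hgw]
  exact (IsSmoothEmbedding.md_eq_zero_iff hL ⟨m, m, hm, rfl⟩ (G := ℝ × Euc 2) (by simp) hU hmU hg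
    hgs (fun x hx => (hgz x hx).1) w).symm

/-- Moves the calibration condition into the frame, where it depends only on the tangent space as a
subspace of ℝ⁷. -/
lemma abs_formPullback_g2Star_eq_one_iff {L : Set M} [ChartedSpace (Euc 4) L] (p : L) :
    (∀ u : Fin 4 → TangentSpace (𝓡 4) p,
      (∀ i j, g2Metric φ p.1 (mfderiv (𝓡 4) (𝓡 7) (Subtype.val : L → M) p (u i))
        (mfderiv (𝓡 4) (𝓡 7) (Subtype.val : L → M) p (u j)) = if i = j then 1 else 0) →
      |formPullback 4 7 (Subtype.val : L → M) (g2Star φ) p u| = 1) ↔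
    ∀ u : Fin 4 → Euc 7, (∀ i, ∃ w, md (𝓡 4) (𝓡 7) (Subtype.val : L → M) p w =
        (frameAt φ (p : M)).symm (u i)) →
      (∀ i j, inner ℝ (u i) (u j) = if i = j then (1 : ℝ) else 0) → |starPhi0 u| = 1 := by
  constructor
  · intro H u hu ho
    choose w hw using hu
    have h1 : ∀ i, frameAt φ (p : M) (md (𝓡 4) (𝓡 7) (Subtype.val : L → M) p (w i)) = u i :=
      fun i => by rw [hw, ContinuousLinearEquiv.apply_symm_apply]
    have h2 : (fun i => frameAt φ (p : M) (md (𝓡 4) (𝓡 7) (Subtype.val : L → M) p (w i))) = u :=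
      funext h1
    rw [← h2]
    refine H w fun i j => ?_
    rw [← ho i j, ← h1 i, ← h1 j]
    rfl
  · intro H u hu
    exact H (fun i => frameAt φ (p : M) (md (𝓡 4) (𝓡 7) (Subtype.val : L → M) p (u i)))
      (fun i => ⟨u i, ((frameAt φ (p : M)).symm_apply_apply _).symm⟩) hu

variable {ϖ η₁ η₂ : DForm 4 (OrbitSpace N) 2 ℝ}

/-- The calibration condition on the preimage of a surface. -/
lemma calibrated_preimage_iff (h : IsReduction φ v₁ v₂ f c N)
    (ht : IsReducedTriple φ v₁ v₂ ϖ η₁ η₂)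
    (hS : IsSmoothEmbedding (𝓡 2) (𝓡 4) ∞ (Subtype.val : S → OrbitSpace N))
    [ChartedSpace (Euc 4) ((Subtype.val : N → M) '' (proj N ⁻¹' S))]
    [IsManifold (𝓡 4) ∞ ((Subtype.val : N → M) '' (proj N ⁻¹' S))]
    (hL : IsSmoothEmbedding (𝓡 4) (𝓡 7) ∞
      (Subtype.val : ((Subtype.val : N → M) '' (proj N ⁻¹' S)) → M))
    (m : N) (hm : proj N m ∈ S) :
    (∀ u : Fin 4 → Euc 7, (∀ i, ∃ w, md (𝓡 4) (𝓡 7)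
        (Subtype.val : ((Subtype.val : N → M) '' (proj N ⁻¹' S)) → M) ⟨m, m, hm, rfl⟩ w =
          (frameAt φ (m : M)).symm (u i)) →
      (∀ i j, inner ℝ (u i) (u j) = if i = j then (1 : ℝ) else 0) → |starPhi0 u| = 1) ↔
    ∀ y ∈ LinearMap.range
      (md (𝓡 2) (𝓡 4) (Subtype.val : S → OrbitSpace N) ⟨proj N m, hm⟩).toLinearMap,
      tripleJAt η₁ η₂ (proj N m) y ∈ LinearMap.range
        (md (𝓡 2) (𝓡 4) (Subtype.val : S → OrbitSpace N) ⟨proj N m, hm⟩).toLinearMap := by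
  obtain ⟨e₁, e₂, he⟩ := exists_isAdaptedPair_genAt (φ := φ) (h.free m m.2) h.indep
  obtain ⟨ℓ, -, hB, hT, hJ, -⟩ := h.exists_data ht m he
  rw [← (h.isReducedAt m).calibrated_iff he hB hT hJ _ (finrank_range_md_val hS ⟨proj N m, hm⟩)]
  have hv : ∀ u w, md (𝓡 6) (𝓡 7) (Subtype.val : N → M) m u = (frameAt φ (m : M)).symm w ↔
      valAt φ m u = w := fun u w =>
    (ContinuousLinearEquiv.eq_symm_apply (frameAt φ (m : M))).trans (by rw [frameAt_md_val])
  simp only [h.exists_md_val_preimage_iff hS hL m hm, hv]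

/-- `IsCoassociative` only asserts that some manifold structure exists. For any such structure the
tangent spaces are the kernels of the derivatives of the defining functions, so the condition does
not depend on it; conversely the defining functions provide one. -/
lemma isCoassociative_iff (h : IsReduction φ v₁ v₂ f c N)
    (ht : IsReducedTriple φ v₁ v₂ ϖ η₁ η₂)
    (hS : IsSmoothEmbedding (𝓡 2) (𝓡 4) ∞ (Subtype.val : S → OrbitSpace N)) :
    IsCoassociative φ ((Subtype.val : N → M) '' (proj N ⁻¹' S)) ↔
      IsPseudoholomorphic (tripleJ η₁ η₂) 2 S := by
  rw [isPseudoholomorphic_tripleJ_iff]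
  constructor
  · rintro ⟨cs, hman, hL, hcal⟩ ⟨q, hq⟩
    obtain ⟨m, rfl⟩ := Quotient.exists_rep q
    exact (h.calibrated_preimage_iff ht hS hL m hq).1
      ((abs_formPullback_g2Star_eq_one_iff _).1 (hcal ⟨m, m, hq, rfl⟩))
  · intro hJ
    obtain ⟨cs, hman, hL⟩ := exists_isSmoothEmbedding_of_hasDefiningFunctionAt (k := 4) (n := 7)
      (G := ℝ × Euc 2) (by simp) (L := (Subtype.val : N → M) '' (proj N ⁻¹' S)) (by
        rintro _ ⟨m, hm, rfl⟩
        obtain ⟨g, U, hU, hmU, hg, hgs, hgz, -⟩ := h.exists_definingFunction hS m hm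
        exact ⟨g, U, hU, hmU, hg, hgs, hgz⟩)
    refine ⟨cs, hman, hL, ?_⟩
    rintro ⟨_, m, hm, rfl⟩
    exact (abs_formPullback_g2Star_eq_one_iff _).2
      ((h.calibrated_preimage_iff ht hS hL m hm).2 (hJ ⟨proj N m, hm⟩))

end IsReduction

end G2Reduction

end

/-! ### The reduction theorem -/

theorem mainTheorem9 {M : Type*} [TopologicalSpace M] [T2Space M] [SecondCountableTopology M]
    [ChartedSpace (Euc 7) M] [IsManifold (𝓡 7) ∞ M]
    [MulAction Torus M] [ContMDiffSMul torusModel (𝓡 7) ∞ Torus M]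
    (φ : DForm 7 M 3 ℝ) (hφ : IsParallelG2Form φ) (hb : FirstBettiZero 7 M)
    (hT : PreservesForm φ) (v₁ v₂ : ℝ × ℝ) (hv : LinearIndependent ℝ ![v₁, v₂]) :
    -- the `1`-form `i_{X₁} i_{X₂} φ` is exact
    (∃ f : M → ℝ, ContMDiff (𝓡 7) 𝓘(ℝ, ℝ) ∞ f ∧
      IsDifferentialOf (interiorProduct (flowField v₁) (interiorProduct (flowField v₂) φ)) f) ∧
    ∀ f : M → ℝ, ContMDiff (𝓡 7) 𝓘(ℝ, ℝ) ∞ f →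
      IsDifferentialOf (interiorProduct (flowField v₁) (interiorProduct (flowField v₂) φ)) f →
      (∀ (t : Torus) (m : M), f (t • m) = f m) ∧
      ∀ (c : ℝ) (N : Set M), N = f ⁻¹' {c} →
        (∀ m ∈ N, ∀ t : Torus, t • m = m → t = 1) →
        -- `N` is an embedded hypersurface and `N / T²` is a quotient manifold of dimension `4`
        ∃ (_ : ChartedSpace (Euc 6) N) (_ : IsManifold (𝓡 6) ∞ N)
          (_ : ChartedSpace (Euc 4) (OrbitSpace N)) (_ : IsManifold (𝓡 4) ∞ (OrbitSpace N)),
          IsSmoothEmbedding (𝓡 6) (𝓡 7) ∞ (Subtype.val : N → M) ∧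
          T2Space (OrbitSpace N) ∧ SecondCountableTopology (OrbitSpace N) ∧
          IsSubmersion (𝓡 6) (𝓡 4) ∞ (proj N) ∧
          ∃ (ω' η₁' η₂' : DForm 4 (OrbitSpace N) 2 ℝ)
            (J : ∀ q : OrbitSpace N, TangentSpace (𝓡 4) q →L[ℝ] TangentSpace (𝓡 4) q),
            -- `ω'`, `η₁'`, `η₂'` are the unique forms that pull back to the restrictions to `N`
            -- of `i_{X₁} i_{X₂} ∗φ`, `i_{X₁} φ`, `i_{X₂} φ`
            (∀ β : DForm 4 (OrbitSpace N) 2 ℝ, formPullback 6 4 (proj N) β =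
              formPullback 6 7 (Subtype.val : N → M)
                (interiorProduct (flowField v₁) (interiorProduct (flowField v₂) (g2Star φ))) ↔ β = ω') ∧
            (∀ β : DForm 4 (OrbitSpace N) 2 ℝ, formPullback 6 4 (proj N) β =
              formPullback 6 7 (Subtype.val : N → M) (interiorProduct (flowField v₁) φ) ↔ β = η₁') ∧
            (∀ β : DForm 4 (OrbitSpace N) 2 ℝ, formPullback 6 4 (proj N) β =
              formPullback 6 7 (Subtype.val : N → M) (interiorProduct (flowField v₂) φ) ↔ β = η₂') ∧
            IsClosedForm η₁' ∧ IsClosedForm η₂' ∧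
            -- `J` is induced by right Cayley multiplication by `e₃ = e₁ × e₂` on the orthogonal
            -- complement of `span(X₁, X₂, e₃)`
            (∀ (m : N) (e₁ e₂ e₃ : TangentSpace (𝓡 7) m.1),
              IsOrientedOrthonormalBasis φ m.1 (flowField v₁ m.1) (flowField v₂ m.1) e₁ e₂ →
              e₃ = g2Cross φ m.1 e₁ e₂ →
              ∀ w : TangentSpace (𝓡 7) m.1, g2Metric φ m.1 w e₁ = 0 → g2Metric φ m.1 w e₂ = 0 →
                g2Metric φ m.1 w e₃ = 0 →
                ∃ u u' : TangentSpace (𝓡 6) m,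
                  mfderiv (𝓡 6) (𝓡 7) (Subtype.val : N → M) m u = w ∧
                  mfderiv (𝓡 6) (𝓡 7) (Subtype.val : N → M) m u' = g2Cross φ m.1 w e₃ ∧
                  J (proj N m) (mfderiv (𝓡 6) (𝓡 4) (proj N) m u) =
                    mfderiv (𝓡 6) (𝓡 4) (proj N) m u') ∧
            IsSymplectic ω' ∧ IsAlmostComplex J ∧ IsCompatible ω' J ∧
            HasTrivialCanonicalBundle J ∧
            -- embedded surfaces `S` in `N / T²` and their lifts
            ∀ (S : Set (OrbitSpace N)) [ChartedSpace (Euc 2) S] [IsManifold (𝓡 2) ∞ S],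
              IsSmoothEmbedding (𝓡 2) (𝓡 4) ∞ (Subtype.val : S → OrbitSpace N) →
              (IsCoassociative φ ((Subtype.val : N → M) '' (proj N ⁻¹' S)) ↔
                IsPseudoholomorphic J 2 S) ∧
              (IsPseudoholomorphic J 2 S ↔
                formPullback 2 4 (Subtype.val : S → OrbitSpace N) η₁' = 0 ∧
                formPullback 2 4 (Subtype.val : S → OrbitSpace N) η₂' = 0) := by
  have h2 : IsClosedForm (interiorProduct (flowField v₂) φ) := hφ.closed.interiorProduct hT v₂
  -- The first contraction is closed and still invariant, so the second is closed too, and b₁(M) = 0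
  -- gives f.
  refine ⟨hb _ (h2.interiorProduct (hT.interiorProduct v₂) v₁), fun f hf hd =>
    ⟨hd.invariant hφ.exists_frame hv hf, fun c N hN hfree => ?_⟩⟩
  obtain ⟨csN, hmanN, actN, hsm, csQ, hmanQ, hT2, hsc, hsub, h⟩ :=
    exists_isReduction hφ.exists_frame hT hv hf hd c hN hfree
  obtain ⟨ω', hω⟩ := h.exists_descent_star
  obtain ⟨η₁', hη₁⟩ := h.exists_descent_phi v₁
  obtain ⟨η₂', hη₂⟩ := h.exists_descent_phi v₂
  have ht : IsReduction.IsReducedTriple φ v₁ v₂ ω' η₁' η₂' := ⟨hω, hη₁, hη₂⟩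
  have hc₁ : IsClosedForm η₁' := h.isClosedForm_descent (hφ.closed.interiorProduct hT v₁) hη₁
  have hc₂ : IsClosedForm η₂' := h.isClosedForm_descent h2 hη₂
  have hTs : PreservesForm (g2Star φ) := hT.g2Star hφ.exists_frame
  have hcω : IsClosedForm ω' := h.isClosedForm_descent
    ((hφ.coclosed.interiorProduct hTs v₂).interiorProduct (hTs.interiorProduct v₂) v₁) hω
  have htr := h.areTransverse ht
  have uniq : ∀ {α : DForm 7 M 2 ℝ} {β' : DForm 4 (OrbitSpace N) 2 ℝ},
      formPullback 6 4 (proj N) β' = formPullback 6 7 (Subtype.val : N → M) α →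
      ∀ β, formPullback 6 4 (proj N) β = formPullback 6 7 (Subtype.val : N → M) α ↔ β = β' :=
    fun h' β => ⟨fun hβ => h.formPullback_proj_injective (hβ.trans h'.symm), fun hβ => hβ ▸ h'⟩
  exact ⟨csN, hmanN, csQ, hmanQ, h.embedding, hT2, hsc, hsub, ω', η₁', η₂', tripleJ η₁' η₂',
    uniq hω, uniq hη₁, uniq hη₂, hc₁, hc₂, h.exists_tripleJ_eq ht, htr.isSymplectic hcω,
    htr.isAlmostComplex hc₁.1 hc₂.1, htr.isCompatible,
    htr.hasTrivialCanonicalBundle hc₁.1 hc₂.1,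
    fun S _ _ hS => ⟨h.isCoassociative_iff ht hS, htr.isPseudoholomorphic_iff hS⟩⟩
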